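/- **Set-up.** Let $(M,g_M)$ and $(N,g_N)$ be oriented smooth riemannian 3-manifolds with volume forms $V_M,V_N$. Let $G=\mathrm U(1)$ act smoothly on $N$ preserving $g_N$ and the orientation, let $\nu(y)=\frac{d}{dt}\big|_{t=0}e^{-it}\cdot y$ be the generating vector field, and let $\mu$ be a moment map, i.e. a smooth invariant 1-form on $N$ with $\mathrm d\mu=\iota_\nu V_N$ and $\iota_\nu\mu=0$; let $\mu^\sharp$ be the $g_N$-dual vector field. Let $\pi:P\to M$ be a principal $\mathrm U(1)$-bundle, $A$ a connection on $P$ with curvature $F$, and $\phi$ a smooth section of $P\times_{\mathrm U(1)}N$. In a local gauge $\phi$ is a map to $N$, $A$ is a real 1-form, $F=\mathrm dA$ and $\mathrm d^A\phi=\mathrm d\phi-A\,\nu(\phi)$. Let $\Sigma$ be the $TN$-valued 2-form with $g_N(u,\Sigma(v,w))=V_N(u,v,w)$, and put $$\phi^{*A}\Sigma=\Sigma(\mathrm d^A\phi,\mathrm d^A\phi),\qquad \phi^{*A}\mu^\sharp=F\otimes\mu^\sharp(\phi),\qquad \phi^{*A}\nu=F\otimes\nu(\phi).$$ For $\alpha,\beta,\gamma\in\mathbb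 R$ the BPS equations are $$\star_M\mathrm d^A\phi-\phi^{*A}(\Sigma+3\mu^\sharp)=0,\qquad \phi^{*A}(\alpha\Sigma+\beta\mu^\sharp+\gamma\nu)=0 .$$ Whether $\nu(\phi(x))\neq0$, and whether $\nu,\mu^\sharp$ are linearly independent at $\phi(x)$, does not depend on the gauge. Call $x\in M$ *regular* if $\mathrm d^A\phi$ has full rank at $x$ and $\nu,\mu^\sharp$ are linearly independent at $\phi(x)$. Say that $(M,g_M,P,A,\phi)$ is *locally the identity near $x$* if there are an open neighbourhood $U$ of $x$ and a gauge over $U$ in which $\phi$ is an orientation-preserving diffeomorphism of $U$ onto an open set $W\subseteq N$ on which $\nu,\mu^\sharp$ are linearly independent, such that, after identifying $U$ with $W$ through $\phi$ (so that $\phi$ becomes the identity map), $A$ is a smooth 1-form on $W$ with $$\iota_\nu A=\iota_{\mu^\sharp}A=\mathcal L_{\mu^\sharp}A=0,$$ and $$g_M=g_\mu+\bigl(1+3\star_N(F\wedge\mu)\bigr)g_C,\qquad g_\mu=\frac{\mu^2}{\mu(\mu^\sharp)},\qquad g_C=\phi^{*A}g_N-g_\mu,$$ where $\phi^{*A}g_N(u,v)=g_N(u-A(u)\nu,\,v-A(v)\nu)$.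 **Theorem 4.1.** 1. If the BPS equations hold on $M$ and there is a point $x\in M$ with $F_x\neq0$ and $\nu(\phi(x))\neq0$, then $\alpha=\beta=\gamma=0$. 2. Let the BPS equations hold on $M$ with $\alpha=\beta=\gamma=0$. Then the solution is locally the identity near every regular point. Moreover, if $Y\subseteq M$ is open and connected, $\nu(\phi(x))\neq 0$ for all $x\in Y$, and $F$ is not identically zero on $Y$, then the regular points are dense in $Y$. 3. Conversely, if $(M,g_M,P,A,\phi)$ is locally the identity near $x$, then it satisfies the BPS equations with $\alpha=\beta=\gamma=0$ at $x$. -/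

import Mathlib

open scoped Manifold ContDiff

noncomputable section

namespace GaugedSkyrme

/-! ### One-forms on a manifold: smoothness, exterior derivative, Lie derivative -/

section Forms

variable {n : ℕ} {X : Type*} [TopologicalSpace X] [ChartedSpace (EuclideanSpace ℝ (Fin n)) X]

/-- A (not necessarily smooth) vector field on the `n`-manifold `X`. -/
abbrev VecField (n : ℕ) (X : Type*) [TopologicalSpace X]
    [ChartedSpace (EuclideanSpace ℝ (Fin n)) X] : Type _ :=
  ∀ x : X, TangentSpace (𝓡 n) x

/-- A (not necessarily smooth) real one-form on the `n`-manifold `X`. -/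
abbrev OneForm (n : ℕ) (X : Type*) [TopologicalSpace X]
    [ChartedSpace (EuclideanSpace ℝ (Fin n)) X] : Type _ :=
  ∀ x : X, TangentSpace (𝓡 n) x →L[ℝ] ℝ

/-- A (not necessarily smooth) real three-form on the `n`-manifold `X`. -/
abbrev ThreeForm (n : ℕ) (X : Type*) [TopologicalSpace X]
    [ChartedSpace (EuclideanSpace ℝ (Fin n)) X] : Type _ :=
  ∀ x : X, TangentSpace (𝓡 n) x [⋀^Fin 3]→L[ℝ] ℝ

/-- The derivative at `z` of the inverse of the preferred chart at `x₀`, i.e. the coordinate frame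
of that chart. -/
def coordFrame (x₀ : X) (z : EuclideanSpace ℝ (Fin n)) :
    EuclideanSpace ℝ (Fin n) →L[ℝ] TangentSpace (𝓡 n) ((extChartAt (𝓡 n) x₀).symm z) :=
  mfderiv 𝓘(ℝ, EuclideanSpace ℝ (Fin n)) (𝓡 n) (extChartAt (𝓡 n) x₀).symm z

/-- The coordinate expression of a one-form in the preferred chart at `x₀`. -/
def OneForm.inChart (η : OneForm n X) (x₀ : X) (z : EuclideanSpace ℝ (Fin n)) :
    EuclideanSpace ℝ (Fin n) →L[ℝ] ℝ :=
  (η ((extChartAt (𝓡 n) x₀).symm z)).comp (coordFrame x₀ z)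

/-- The coordinate expression of a vector field in the preferred chart at `x₀`. -/
def VecField.inChart (Z : VecField n X) (x₀ : X) (z : EuclideanSpace ℝ (Fin n)) :
    EuclideanSpace ℝ (Fin n) :=
  mfderiv (𝓡 n) 𝓘(ℝ, EuclideanSpace ℝ (Fin n)) (extChartAt (𝓡 n) x₀)
    ((extChartAt (𝓡 n) x₀).symm z) (Z ((extChartAt (𝓡 n) x₀).symm z))

/-- The coordinate expression of a three-form in the preferred chart at `x₀`. -/
def ThreeForm.inChart (V : ThreeForm n X) (x₀ : X) (z : EuclideanSpace ℝ (Fin n)) :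
    EuclideanSpace ℝ (Fin n) [⋀^Fin 3]→L[ℝ] ℝ :=
  (V ((extChartAt (𝓡 n) x₀).symm z)).compContinuousLinearMap (coordFrame x₀ z)

/-- The one-form `η` is smooth on the (open) set `W`: its coefficients in every chart are. -/
def OneForm.SmoothOn (η : OneForm n X) (W : Set X) : Prop :=
  ∀ x₀ : X, ContDiffOn ℝ ∞ (η.inChart x₀)
    ((extChartAt (𝓡 n) x₀).target ∩ (extChartAt (𝓡 n) x₀).symm ⁻¹' W)

/-- The three-form `V` is smooth: its coefficients in every chart are. -/
def ThreeForm.Smooth (V : ThreeForm n X) : Prop :=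
  ∀ x₀ : X, ContDiffOn ℝ ∞ (V.inChart x₀) (extChartAt (𝓡 n) x₀).target

/-- The exterior derivative of a one-form, `(dη)(u, v) = ∂_u η(v) - ∂_v η(u)`, computed at `x` in
the preferred chart at `x` (the chart through which Mathlib identifies `TangentSpace (𝓡 n) x` with
`EuclideanSpace ℝ (Fin n)`). -/
def extD (η : OneForm n X) (x : X) (u v : TangentSpace (𝓡 n) x) : ℝ :=
  fderiv ℝ (η.inChart x) (extChartAt (𝓡 n) x x) u v -
    fderiv ℝ (η.inChart x) (extChartAt (𝓡 n) x x) v u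

/-- The Lie derivative of a one-form along a vector field, `(L_Z η)_i = Z^j ∂_j η_i + η_j ∂_i Z^j`,
computed at `x` in the preferred chart at `x`. -/
def lieD (Z : VecField n X) (η : OneForm n X) (x : X) (v : TangentSpace (𝓡 n) x) : ℝ :=
  fderiv ℝ (η.inChart x) (extChartAt (𝓡 n) x x) (Z x) v +
    η x (fderiv ℝ (Z.inChart x) (extChartAt (𝓡 n) x x) v)

/-- The wedge product `f ∧ η` of a two-form and a one-form on a vector space. -/
def wedgeTwoOne {E : Type*} (f : E → E → ℝ) (η : E → ℝ) (u v w : E) : ℝ :=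
  f u v * η w + f v w * η u + f w u * η v

end Forms

/-! ### Oriented riemannian three-manifolds -/

section Riemannian

variable {X : Type*} [TopologicalSpace X] [ChartedSpace (EuclideanSpace ℝ (Fin 3)) X]
  [IsManifold (𝓡 3) ∞ X]

/-- Smooth riemannian metrics on a three-manifold. -/
abbrev Metric (X : Type*) [TopologicalSpace X] [ChartedSpace (EuclideanSpace ℝ (Fin 3)) X]
    [IsManifold (𝓡 3) ∞ X] : Type _ :=
  Bundle.ContMDiffRiemannianMetric (𝓡 3) ∞ (EuclideanSpace ℝ (Fin 3))
    (fun x : X => TangentSpace (𝓡 3) x)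

/-- `V` is the volume form of `g` for one of the orientations of `X`. An orientation of a riemannian
three-manifold is the same thing as such a `V`, and is given in this form. -/
structure IsVolumeForm (g : Metric X) (V : ThreeForm 3 X) : Prop where
  smooth : V.Smooth
  unit : ∀ (x : X) (e : Fin 3 → TangentSpace (𝓡 3) x),
    (∀ i j, g.inner x (e i) (e j) = if i = j then 1 else 0) → |V x e| = 1

/-- Lowering an index: `u ↦ g(u, ·)`. -/
def flat (g : Metric X) (x : X) :
    TangentSpace (𝓡 3) x →ₗ[ℝ] Module.Dual ℝ (TangentSpace (𝓡 3) x) where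
  toFun u := (g.inner x u).toLinearMap
  map_add' u v := by ext w; simp
  map_smul' c u := by ext w; simp

theorem flat_injective (g : Metric X) (x : X) : Function.Injective (flat g x) := by
  rw [← LinearMap.ker_eq_bot, LinearMap.ker_eq_bot']
  intro u hu
  by_contra h
  have h1 := g.pos x u h
  have h2 : g.inner x u u = 0 := by
    have := LinearMap.congr_fun hu u
    simpa [flat] using this
  exact absurd h2 h1.ne'

instance (x : X) : FiniteDimensional ℝ (TangentSpace (𝓡 3) x) :=
  inferInstanceAs (FiniteDimensional ℝ (EuclideanSpace ℝ (Fin 3)))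

/-- Raising an index: the vector `sharp g x ξ` with `g(sharp g x ξ, v) = ξ(v)` for all `v`. -/
def sharp (g : Metric X) (x : X) (ξ : Module.Dual ℝ (TangentSpace (𝓡 3) x)) :
    TangentSpace (𝓡 3) x :=
  (LinearMap.linearEquivOfInjective (flat g x) (flat_injective g x)
    Subspace.dual_finrank_eq.symm).symm ξ

theorem inner_sharp (g : Metric X) (x : X) (ξ : Module.Dual ℝ (TangentSpace (𝓡 3) x))
    (v : TangentSpace (𝓡 3) x) : g.inner x (sharp g x ξ) v = ξ v := by
  have h : flat g x (sharp g x ξ) = ξ :=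
    (LinearMap.linearEquivOfInjective (flat g x) (flat_injective g x)
      Subspace.dual_finrank_eq.symm).apply_symm_apply ξ
  exact LinearMap.congr_fun h v

/-- The `TX`-valued two-form `Σ` that represents the Hodge star:
`g(u, Σ(v, w)) = V(u, v, w)`. -/
def Sig (g : Metric X) (V : ThreeForm 3 X) (x : X) (v w : TangentSpace (𝓡 3) x) :
    TangentSpace (𝓡 3) x :=
  sharp g x ((V x).toAlternatingMap.toMultilinearMap.toLinearMap ![0, v, w] 0)

theorem inner_Sig (g : Metric X) (V : ThreeForm 3 X) (x : X) (u v w : TangentSpace (𝓡 3) x) :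
    g.inner x u (Sig g V x v w) = V x ![u, v, w] := by
  rw [g.symm, Sig, inner_sharp]
  change V x (Function.update ![0, v, w] 0 u) = V x ![u, v, w]
  congr 1
  ext i
  fin_cases i <;> rfl

/-- The Hodge star of a (vector-valued) one-form `T` on `T_x X`. For a real one-form it is
`(⋆T)(v, w) = V(T^♯, v, w) = g(T^♯, Σ(v, w)) = T(Σ(v, w))`, so that `⋆e¹ = e² ∧ e³` for an oriented
orthonormal coframe; for vector-valued forms it is the same componentwise. -/
def hodgeOne (g : Metric X) (V : ThreeForm 3 X) (x : X) {F : Type*} [AddCommGroup F] [Module ℝ F]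
    [TopologicalSpace F] (T : TangentSpace (𝓡 3) x →L[ℝ] F) (v w : TangentSpace (𝓡 3) x) : F :=
  T (Sig g V x v w)

/-- The `i`-th coordinate vector of `T_x X`. -/
def coordVec (x : X) (i : Fin 3) : TangentSpace (𝓡 3) x :=
  (EuclideanSpace.single i (1 : ℝ) : EuclideanSpace ℝ (Fin 3))

/-- The Hodge star of a three-form `t` on `T_x X`: the number `c` with `t = c V`, found by
evaluating both on a basis. -/
def hodgeThree (V : ThreeForm 3 X) (x : X)
    (t : TangentSpace (𝓡 3) x → TangentSpace (𝓡 3) x → TangentSpace (𝓡 3) x → ℝ) : ℝ :=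
  t (coordVec x 0) (coordVec x 1) (coordVec x 2) /
    V x ![coordVec x 0, coordVec x 1, coordVec x 2]

end Riemannian

/-! ### The target: isometric circle action and moment map -/

section Target

variable {N : Type*} [TopologicalSpace N] [ChartedSpace (EuclideanSpace ℝ (Fin 3)) N]
  [IsManifold (𝓡 3) ∞ N] [MulAction Circle N]

/-- The vector field `ν = ν(1)`, `ν(y) = d/dt|₀ exp(-t) · y`, where the Lie algebra of the circle is
identified with `ℝ` through `t ↦ exp(it)`. -/
def nu : VecField 3 N := fun y =>
  mfderiv 𝓘(ℝ, ℝ) (𝓡 3) (fun t : ℝ => Circle.exp (-t) • y) 0 (1 : ℝ)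

/-- The action preserves the metric and the orientation (the latter follows from the former, as the
circle is connected). -/
structure IsIsometricAction (g : Metric N) (V : ThreeForm 3 N) : Prop where
  isometry : ∀ (z : Circle) (y : N) (u v : TangentSpace (𝓡 3) y),
    g.inner (z • y) (mfderiv (𝓡 3) (𝓡 3) (fun y' : N => z • y') y u)
      (mfderiv (𝓡 3) (𝓡 3) (fun y' : N => z • y') y v) = g.inner y u v
  orientation : ∀ (z : Circle) (y : N),
    (V (z • y)).compContinuousLinearMap (mfderiv (𝓡 3) (𝓡 3) (fun y' : N => z • y') y) = V y

/-- `μ = μ(1)` is a moment map: an invariant one-form with `dμ = ι_ν V` and `ι_ν μ = 0`. -/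
structure IsMomentMap (V : ThreeForm 3 N) (μ : OneForm 3 N) : Prop where
  smooth : μ.SmoothOn Set.univ
  invariant : ∀ (z : Circle) (y : N),
    (μ (z • y)).comp (mfderiv (𝓡 3) (𝓡 3) (fun y' : N => z • y') y) = μ y
  extD_eq : ∀ (y : N) (v w : TangentSpace (𝓡 3) y), extD μ y v w = V y ![nu y, v, w]
  apply_nu : ∀ y : N, μ y (nu y) = 0

/-- The vector field `μ♯` dual to `μ`. -/
def muSharp (g : Metric N) (μ : OneForm 3 N) : VecField 3 N := fun y =>
  sharp g y (μ y).toLinearMap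

/-- The symmetric tensor `g_μ = μ² / μ(μ♯)`. -/
def gMu (g : Metric N) (μ : OneForm 3 N) (y : N) (u v : TangentSpace (𝓡 3) y) : ℝ :=
  μ y u * μ y v / μ y (muSharp g μ y)

/-- The covariant differential of the identity map of `N` with respect to a connection form `B`
on `N`: `v ↦ v - B(v) ν`. -/
def covId (B : OneForm 3 N) (y : N) (v : TangentSpace (𝓡 3) y) : TangentSpace (𝓡 3) y :=
  v - B y v • nu y

/-- The symmetric tensor `g_μ + (1 + 3 ⋆_N(F ∧ μ)) g_C` on `N`, where `F = dB` and
`g_C = id^{*B} g_N - g_μ`. -/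
def solutionMetric (g : Metric N) (V : ThreeForm 3 N) (μ B : OneForm 3 N) (y : N)
    (u v : TangentSpace (𝓡 3) y) : ℝ :=
  gMu g μ y u v + (1 + 3 * hodgeThree V y (wedgeTwoOne (extD B y) (μ y))) *
    (g.inner y (covId B y u) (covId B y v) - gMu g μ y u v)

end Target

/-! ### Principal circle bundle, connection, Skyrme field -/

section Bundle

variable {M : Type*} [TopologicalSpace M] [ChartedSpace (EuclideanSpace ℝ (Fin 3)) M]
  [IsManifold (𝓡 3) ∞ M]
  {N : Type*} [TopologicalSpace N] [ChartedSpace (EuclideanSpace ℝ (Fin 3)) N]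
  [IsManifold (𝓡 3) ∞ N] [MulAction Circle N]
  {P : Type*} [TopologicalSpace P] [ChartedSpace (EuclideanSpace ℝ (Fin 4)) P]
  [IsManifold (𝓡 4) ∞ P] [MulAction Circle P]

/-- `s` is a smooth section of `π` over the open set `U`, i.e. a local gauge. -/
structure IsLocalSection (π : P → M) (U : Set M) (s : M → P) : Prop where
  isOpen : IsOpen U
  smooth : ContMDiffOn (𝓡 3) (𝓡 4) ∞ s U
  proj : ∀ x ∈ U, π (s x) = x

/-- `π : P → M` is a smooth principal circle bundle. The circle being commutative, its right action
on `P` is written as `z • p`. Each point of `M` has a neighbourhood `U` with a section `s` such that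
`(x, z) ↦ z • s x` is a diffeomorphism of `U × Circle` onto `π⁻¹ U`, with inverse
`p ↦ (π p, τ p)`. -/
structure IsPrincipalBundle (π : P → M) : Prop where
  smooth_smul : ContMDiff ((𝓡 1).prod (𝓡 4)) (𝓡 4) ∞ (fun q : Circle × P => q.1 • q.2)
  smooth_proj : ContMDiff (𝓡 4) (𝓡 3) ∞ π
  proj_smul : ∀ (z : Circle) (p : P), π (z • p) = π p
  locally_trivial : ∀ x : M, ∃ (U : Set M) (s : M → P) (τ : P → Circle),
    x ∈ U ∧ IsLocalSection π U s ∧ ContMDiffOn (𝓡 4) (𝓡 1) ∞ τ (π ⁻¹' U) ∧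
    (∀ p ∈ π ⁻¹' U, τ p • s (π p) = p) ∧ ∀ y ∈ U, ∀ z : Circle, τ (z • s y) = z

/-- `A` is a connection form on `P`: smooth, invariant, and equal to `1` on the vector field
`d/dt|₀ p · exp(t)` that generates the action. -/
structure IsConnection (A : OneForm 4 P) : Prop where
  smooth : A.SmoothOn Set.univ
  invariant : ∀ (z : Circle) (p : P),
    (A (z • p)).comp (mfderiv (𝓡 4) (𝓡 4) (fun p' : P => z • p') p) = A p
  apply_vertical : ∀ p : P,
    A p (mfderiv 𝓘(ℝ, ℝ) (𝓡 4) (fun t : ℝ => Circle.exp t • p) 0 (1 : ℝ)) = 1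

/-- A smooth section of the associated bundle `P ×_{U(1)} N`, given as an equivariant map
`P → N`. -/
structure IsSkyrmeField (Φ : P → N) : Prop where
  smooth : ContMDiff (𝓡 4) (𝓡 3) ∞ Φ
  equivariant : ∀ (z : Circle) (p : P), Φ (z • p) = z⁻¹ • Φ p

/-- The local gauge potential `s^* A` on `M`. -/
def potential (A : OneForm 4 P) (s : M → P) : OneForm 3 M := fun x =>
  (A (s x)).comp (mfderiv (𝓡 3) (𝓡 4) s x)

/-- The covariant differential `d^A φ = dφ - A ν(φ)` in a local gauge. -/
def covD (φ : M → N) (a : OneForm 3 M) (x : M) :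
    TangentSpace (𝓡 3) x →L[ℝ] TangentSpace (𝓡 3) (φ x) :=
  mfderiv (𝓡 3) (𝓡 3) φ x - (a x).smulRight (nu (φ x))

/-- The equivariant pullback of `Σ`, `φ^{*A} Σ`, in a local gauge. -/
def pullSig (gN : Metric N) (VN : ThreeForm 3 N) (φ : M → N) (a : OneForm 3 M) (x : M)
    (v w : TangentSpace (𝓡 3) x) : TangentSpace (𝓡 3) (φ x) :=
  Sig gN VN (φ x) (covD φ a x v) (covD φ a x w)

/-- The equivariant pullback `φ^{*A} Z = F ⊗ Z(φ)`, `F = dA`, of the equivariant two-form given by a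
vector field `Z = Z(1)` (here `ν` or `μ♯`), in a local gauge. -/
def pullField (Z : VecField 3 N) (φ : M → N) (a : OneForm 3 M) (x : M)
    (v w : TangentSpace (𝓡 3) x) : TangentSpace (𝓡 3) (φ x) :=
  extD a x v w • Z (φ x)

/-- The first BPS equation `⋆_M d^A φ - φ^{*A}(Σ + 3 μ♯) = 0` at `x`, in a local gauge. -/
def BPS1 (gM : Metric M) (VM : ThreeForm 3 M) (gN : Metric N) (VN : ThreeForm 3 N)
    (μ : OneForm 3 N) (φ : M → N) (a : OneForm 3 M) (x : M) : Prop :=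
  ∀ v w : TangentSpace (𝓡 3) x,
    hodgeOne gM VM x (covD φ a x) v w -
      (pullSig gN VN φ a x v w + (3 : ℝ) • pullField (muSharp gN μ) φ a x v w) = 0

/-- The second BPS equation `φ^{*A}(α Σ + β μ♯ + γ ν) = 0` at `x`, in a local gauge. -/
def BPS2 (gN : Metric N) (VN : ThreeForm 3 N) (μ : OneForm 3 N) (α β γ : ℝ) (φ : M → N)
    (a : OneForm 3 M) (x : M) : Prop :=
  ∀ v w : TangentSpace (𝓡 3) x,
    α • pullSig gN VN φ a x v w + β • pullField (muSharp gN μ) φ a x v w +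
      γ • pullField nu φ a x v w = 0

/-- `(Φ, A)` satisfies both BPS equations at `x` (in every local gauge). -/
def SolvesBPSAt (gM : Metric M) (VM : ThreeForm 3 M) (gN : Metric N) (VN : ThreeForm 3 N)
    (μ : OneForm 3 N) (α β γ : ℝ) (π : P → M) (A : OneForm 4 P) (Φ : P → N) (x : M) : Prop :=
  ∀ (U : Set M) (s : M → P), IsLocalSection π U s → x ∈ U →
    BPS1 gM VM gN VN μ (Φ ∘ s) (potential A s) x ∧
    BPS2 gN VN μ α β γ (Φ ∘ s) (potential A s) x

/-- The curvature `F` does not vanish at `x`. -/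
def CurvatureNeZeroAt (π : P → M) (A : OneForm 4 P) (x : M) : Prop :=
  ∃ (U : Set M) (s : M → P), IsLocalSection π U s ∧ x ∈ U ∧
    ∃ v w : TangentSpace (𝓡 3) x, extD (potential A s) x v w ≠ 0

/-- `d^A φ` has full rank at `x`, and `ν`, `μ♯` are linearly independent at `φ(x)`. -/
def RegularAt (gN : Metric N) (μ : OneForm 3 N) (π : P → M) (A : OneForm 4 P) (Φ : P → N)
    (x : M) : Prop :=
  ∃ (U : Set M) (s : M → P), IsLocalSection π U s ∧ x ∈ U ∧
    Function.Bijective (covD (Φ ∘ s) (potential A s) x) ∧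
    LinearIndependent ℝ ![nu (Φ (s x)), muSharp gN μ (Φ (s x))]

/-- Near `x`, the configuration is the identity map of an open piece `W` of `N`: there are a local
gauge `s` over a neighbourhood `U` of `x` in which `φ` is an orientation-preserving diffeomorphism
`e` of `U` onto an open set `W ⊆ N` on which `ν`, `μ♯` are linearly independent, and, when `U` is
identified with `W` through `e` (so that `φ` becomes the identity), the connection becomes a one-form
`B` on `W` with `ι_ν B = ι_{μ♯} B = L_{μ♯} B = 0` and the metric of `M` becomes
`g_μ + (1 + 3 ⋆_N(dB ∧ μ)) g_C`. -/
def LocallyIdentityAt (gM : Metric M) (VM : ThreeForm 3 M) (gN : Metric N) (VN : ThreeForm 3 N)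
    (μ : OneForm 3 N) (π : P → M) (A : OneForm 4 P) (Φ : P → N) (x : M) : Prop :=
  ∃ (e : PartialDiffeomorph (𝓡 3) (𝓡 3) M N ∞) (s : M → P) (B : OneForm 3 N),
    x ∈ e.source ∧ IsLocalSection π e.source s ∧ B.SmoothOn e.target ∧
    (∀ x' ∈ e.source, Φ (s x') = e x' ∧
      potential A s x' = (B (e x')).comp (mfderiv (𝓡 3) (𝓡 3) e x') ∧
      (∀ b : Fin 3 → TangentSpace (𝓡 3) x', 0 < VM x' b →
        0 < VN (e x') (fun i => mfderiv (𝓡 3) (𝓡 3) e x' (b i))) ∧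
      ∀ u v : TangentSpace (𝓡 3) x', gM.inner x' u v =
        solutionMetric gN VN μ B (e x') (mfderiv (𝓡 3) (𝓡 3) e x' u)
          (mfderiv (𝓡 3) (𝓡 3) e x' v)) ∧
    ∀ y ∈ e.target, LinearIndependent ℝ ![nu y, muSharp gN μ y] ∧
      B y (nu y) = 0 ∧ B y (muSharp gN μ y) = 0 ∧
      ∀ v : TangentSpace (𝓡 3) y, lieD (muSharp gN μ) B y v = 0

end Bundle

end GaugedSkyrme

end

open GaugedSkyrme

set_option linter.unusedSectionVars false

noncomputable section

namespace GaugedSkyrme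

open scoped Manifold ContDiff

section

open Set Filter Topology

/-! ### One-forms in charts, their pullbacks, and naturality of the exterior derivative. -/

section ChartCalculus

variable {n : ℕ} {X : Type*} [TopologicalSpace X] [ChartedSpace (EuclideanSpace ℝ (Fin n)) X]
  [IsManifold (𝓡 n) ∞ X]
  {E' : Type*} [NormedAddCommGroup E'] [NormedSpace ℝ E']

/-! Everything rests on the pointwise algebra of the first BPS equation. At a point with `ν ≠ 0`,
choose an oriented orthonormal frame `b` of the target with `μ♯ = c b₀` and `ν = ρ b₁` (possible
because `ι_ν μ = 0`), and an oriented orthonormal frame of the source. If `p, q, r` are the rows of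
the matrix of `d^A φ`, the equation reads `p = q × r + 3c ⋆F`, `q = r × p`, `r = p × q`. So the rows
are mutually orthogonal, `|q|² = |r|² = δ`, and `δ(|p|² - 1) = 0` (`cofactor_dichotomy`,
`BPSRel.cases`). Either `δ = 0`, and `d^A φ` has image in the line of `b₀` and vanishes if `F` does;
or `δ > 0`, and `d^A φ` is bijective, `|p| = 1`, and both `g_M` and `cF` are determined by `d^A φ`
and `δ`. The second alternative is, with `1/δ = 1 + 3⋆(F ∧ μ)`, the metric formula of the theorem,
and it also gives `ι F = 0` on the vector sent to `μ♯ ≠ 0`.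

Global arguments take place on `P`, where the horizontal lift turns `d^A φ` and `F` into gauge-free
objects `covP` and `curvP`.

Degenerate region. If `d^A φ` fails to be bijective on an open set where `ν ≠ 0`, it is orthogonal
to `ν` there, so `A = Φ^*θ` with `θ = g(ν, ·)/|ν|²`; since `d^A φ` has rank at most one, `F = 0`
(`curvP_eq_zero`). Also, if `μ♯` vanishes along `φ` near a point, then `0 = Φ^*dμ = Φ^*(ι_ν V)`
excludes bijectivity (`not_bijective_of_muSharp_eq_zero`). These two facts give the vanishing of `α,
β, γ` (`eq_zero_of_curvature`). For density (`subset_closure_regular`), the complement of the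
closure of the regular points in `Y` is open, and `d^A φ = 0` on it. It is also closed in `Y`,
because at regular points `d^A φ` preserves the length of some nonzero vector, whereas near a zero
it shortens all of them. Connectedness concludes.

Local form. Near a regular point, `(dΦ, A)` is an isomorphism of `TP` onto `TN × ℝ`. The fields `X`
with `(dΦ, A) = (μ♯, 0)` and `Y` with `(dΦ, A) = (0, -1)` give, through their flows and a shift
along the fibres, a three-dimensional box in `P` on which `A` kills the two directions that `Φ` maps
to `ν` and `μ♯` (`exists_gauge_box`, `exists_adapted_box`); the vanishing of `F` on the lift of `μ♯`
is what makes this consistent. The box projects diffeomorphically to `M` and to `N`, which is the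
required gauge (`locallyIdentityAt_of_regularAt`). Cartan's formula turns `ι_{μ♯} dB = 0` into
`L_{μ♯} B = 0`. The converse reads the same linear algebra backwards (`bpsRel_of_metric`). -/

theorem contMDiffOn_chart_symm (x₀ : X) :
    ContMDiffOn 𝓘(ℝ, EuclideanSpace ℝ (Fin n)) (𝓡 n) ∞ (extChartAt (𝓡 n) x₀).symm
      (extChartAt (𝓡 n) x₀).target :=
  contMDiffOn_extChartAt_symm x₀

theorem contMDiffAt_chart_symm {x₀ : X} {z : EuclideanSpace ℝ (Fin n)}
    (hz : z ∈ (extChartAt (𝓡 n) x₀).target) :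
    ContMDiffAt 𝓘(ℝ, EuclideanSpace ℝ (Fin n)) (𝓡 n) ∞ (extChartAt (𝓡 n) x₀).symm z :=
  (contMDiffOn_chart_symm x₀).contMDiffAt ((isOpen_extChartAt_target x₀).mem_nhds hz)

theorem contMDiffAt_chart {x₀ x : X} (hx : x ∈ (extChartAt (𝓡 n) x₀).source) :
    ContMDiffAt (𝓡 n) 𝓘(ℝ, EuclideanSpace ℝ (Fin n)) ∞ (extChartAt (𝓡 n) x₀) x :=
  contMDiffAt_extChartAt' (by simpa using hx)

theorem mfderiv_chart_comp_coordFrame {x₀ : X} {z : EuclideanSpace ℝ (Fin n)}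
    (hz : z ∈ (extChartAt (𝓡 n) x₀).target) :
    (mfderiv (𝓡 n) 𝓘(ℝ, EuclideanSpace ℝ (Fin n)) (extChartAt (𝓡 n) x₀)
      ((extChartAt (𝓡 n) x₀).symm z)).comp (coordFrame x₀ z) = ContinuousLinearMap.id ℝ _ := by
  have := mfderiv_extChartAt_comp_mfderivWithin_extChartAt_symm (I := 𝓡 n) hz
  simp only [ModelWithCorners.range_eq_univ, mfderivWithin_univ] at this
  exact this

theorem coordFrame_comp_mfderiv_chart {x₀ : X} {z : EuclideanSpace ℝ (Fin n)}
    (hz : z ∈ (extChartAt (𝓡 n) x₀).target) :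
    (coordFrame x₀ z).comp (mfderiv (𝓡 n) 𝓘(ℝ, EuclideanSpace ℝ (Fin n)) (extChartAt (𝓡 n) x₀)
      ((extChartAt (𝓡 n) x₀).symm z)) = ContinuousLinearMap.id ℝ _ := by
  have := mfderivWithin_extChartAt_symm_comp_mfderiv_extChartAt (I := 𝓡 n) hz
  simp only [ModelWithCorners.range_eq_univ, mfderivWithin_univ] at this
  exact this

theorem coordFrame_self (x : X) : (coordFrame x (extChartAt (𝓡 n) x x) :
    EuclideanSpace ℝ (Fin n) →L[ℝ] EuclideanSpace ℝ (Fin n)) = ContinuousLinearMap.id ℝ _ := by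
  have := mfderivWithin_range_extChartAt_symm (I := 𝓡 n) (x := x) (𝕜 := ℝ)
  simp only [ModelWithCorners.range_eq_univ, mfderivWithin_univ] at this
  exact this

theorem inChart_self (Z : VecField n X) (x : X) :
    Z.inChart x (extChartAt (𝓡 n) x x) = Z x := by
  have h1 := mfderiv_extChartAt_self (I := 𝓡 n) (x := x) (𝕜 := ℝ)
  have h2 : (extChartAt (𝓡 n) x).symm (extChartAt (𝓡 n) x x) = x := extChartAt_to_inv x
  -- The two sides belong to tangent spaces over points that are equal but not syntactically so.
  -- Quantifying over the base point allows the equality to be substituted; statements named `key`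
  -- serve this purpose throughout.
  have key : ∀ y : X, y = x →
      (mfderiv (𝓡 n) 𝓘(ℝ, EuclideanSpace ℝ (Fin n)) (extChartAt (𝓡 n) x) y (Z y) :
        EuclideanSpace ℝ (Fin n)) = Z x := by
    rintro y rfl
    rw [h1]; rfl
  exact key _ h2

theorem OneForm.inChart_self (η : OneForm n X) (x : X) :
    (η.inChart x (extChartAt (𝓡 n) x x) : EuclideanSpace ℝ (Fin n) →L[ℝ] ℝ) = η x := by
  have h2 : (extChartAt (𝓡 n) x).symm (extChartAt (𝓡 n) x x) = x := extChartAt_to_inv x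
  have h3 := coordFrame_self (n := n) x
  have key : ∀ (y : X) (T : EuclideanSpace ℝ (Fin n) →L[ℝ] EuclideanSpace ℝ (Fin n)), y = x →
      T = ContinuousLinearMap.id ℝ _ →
      ((η y : EuclideanSpace ℝ (Fin n) →L[ℝ] ℝ).comp T) = η x := by
    rintro y T rfl rfl
    rfl
  exact key _ _ h2 h3

/-- The pullback of a one-form on a manifold by a map from a normed space. -/
def pullE (η : OneForm n X) (h : E' → X) (q : E') : E' →L[ℝ] ℝ :=
  (η (h q)).comp (mfderiv 𝓘(ℝ, E') (𝓡 n) h q)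

theorem mfderiv_eq_coordFrame_comp {h : E' → X} {q : E'} {x₀ : X}
    (hq : h q ∈ (extChartAt (𝓡 n) x₀).source) (hd : MDifferentiableAt 𝓘(ℝ, E') (𝓡 n) h q) :
    (mfderiv 𝓘(ℝ, E') (𝓡 n) h q : E' →L[ℝ] EuclideanSpace ℝ (Fin n)) =
      (coordFrame x₀ (extChartAt (𝓡 n) x₀ (h q)) :
        EuclideanSpace ℝ (Fin n) →L[ℝ] EuclideanSpace ℝ (Fin n)).comp
          (fderiv ℝ (fun q => extChartAt (𝓡 n) x₀ (h q)) q) := by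
  have hc : MDifferentiableAt (𝓡 n) 𝓘(ℝ, EuclideanSpace ℝ (Fin n)) (extChartAt (𝓡 n) x₀) (h q) :=
    (contMDiffAt_chart hq).mdifferentiableAt (by simp)
  have hs : MDifferentiableAt 𝓘(ℝ, EuclideanSpace ℝ (Fin n)) (𝓡 n) (extChartAt (𝓡 n) x₀).symm
      (extChartAt (𝓡 n) x₀ (h q)) :=
    (contMDiffAt_chart_symm ((extChartAt (𝓡 n) x₀).map_source hq)).mdifferentiableAt (by simp)
  have e1 : h =ᶠ[𝓝 q] (extChartAt (𝓡 n) x₀).symm ∘ (fun q => extChartAt (𝓡 n) x₀ (h q)) := by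
    have : ∀ᶠ q' in 𝓝 q, h q' ∈ (extChartAt (𝓡 n) x₀).source :=
      hd.continuousAt.eventually ((isOpen_extChartAt_source x₀).mem_nhds hq)
    filter_upwards [this] with q' hq'
    exact ((extChartAt (𝓡 n) x₀).left_inv hq').symm
  rw [← mfderiv_eq_fderiv]
  have e2 := mfderiv_comp (I := 𝓘(ℝ, E')) (I' := 𝓘(ℝ, EuclideanSpace ℝ (Fin n))) (I'' := 𝓡 n) q
    (f := fun q => extChartAt (𝓡 n) x₀ (h q)) (g := (extChartAt (𝓡 n) x₀).symm) hs (hc.comp q hd)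
  have e3 := e1.mfderiv_eq (I := 𝓘(ℝ, E')) (I' := 𝓡 n)
  exact e3.trans e2

theorem fderiv_chart_comp {h : E' → X} {q : E'} {x₀ : X}
    (hq : h q ∈ (extChartAt (𝓡 n) x₀).source) (hd : MDifferentiableAt 𝓘(ℝ, E') (𝓡 n) h q) :
    fderiv ℝ (fun q => extChartAt (𝓡 n) x₀ (h q)) q =
      (mfderiv (𝓡 n) 𝓘(ℝ, EuclideanSpace ℝ (Fin n)) (extChartAt (𝓡 n) x₀) (h q)).comp
        (mfderiv 𝓘(ℝ, E') (𝓡 n) h q) := by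
  have hc : MDifferentiableAt (𝓡 n) 𝓘(ℝ, EuclideanSpace ℝ (Fin n)) (extChartAt (𝓡 n) x₀) (h q) :=
    (contMDiffAt_chart hq).mdifferentiableAt (by simp)
  rw [← mfderiv_eq_fderiv]
  exact mfderiv_comp q hc hd

theorem pullE_eq {η : OneForm n X} {h : E' → X} {q : E'} {x₀ : X}
    (hq : h q ∈ (extChartAt (𝓡 n) x₀).source) (hd : MDifferentiableAt 𝓘(ℝ, E') (𝓡 n) h q) :
    pullE η h q = (η.inChart x₀ (extChartAt (𝓡 n) x₀ (h q))).comp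
      (fderiv ℝ (fun q => extChartAt (𝓡 n) x₀ (h q)) q) := by
  have h1 := mfderiv_eq_coordFrame_comp hq hd
  have h2 : (extChartAt (𝓡 n) x₀).symm (extChartAt (𝓡 n) x₀ (h q)) = h q :=
    (extChartAt (𝓡 n) x₀).left_inv hq
  have key : ∀ (y : X) (A : E' →L[ℝ] EuclideanSpace ℝ (Fin n)),
      y = h q → (η y : EuclideanSpace ℝ (Fin n) →L[ℝ] ℝ).comp A
        = (η (h q) : EuclideanSpace ℝ (Fin n) →L[ℝ] ℝ).comp A := by
    rintro y A rfl; rfl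
  have := key _ (mfderiv 𝓘(ℝ, E') (𝓡 n) h q) h2
  refine Eq.trans this.symm ?_
  refine (congrArg (fun A => (η ((extChartAt (𝓡 n) x₀).symm (extChartAt (𝓡 n) x₀ (h q))) :
    EuclideanSpace ℝ (Fin n) →L[ℝ] ℝ).comp A) h1).trans ?_
  rfl

theorem contDiffOn_chart_comp {h : E' → X} {O : Set E'} {x₀ : X}
    (hO : ∀ q ∈ O, h q ∈ (extChartAt (𝓡 n) x₀).source)
    (hd : ContMDiffOn 𝓘(ℝ, E') (𝓡 n) ∞ h O) :
    ContDiffOn ℝ ∞ (fun q => extChartAt (𝓡 n) x₀ (h q)) O := by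
  rw [← contMDiffOn_iff_contDiffOn]
  intro q hq
  exact (contMDiffAt_chart (hO q hq)).comp_contMDiffWithinAt q (hd q hq)

theorem contDiffOn_pullE {η : OneForm n X} {W : Set X} (hη : η.SmoothOn W) {h : E' → X} {O : Set E'}
    (hO : IsOpen O) (hW : ∀ q ∈ O, h q ∈ W) (hd : ContMDiffOn 𝓘(ℝ, E') (𝓡 n) ∞ h O) :
    ContDiffOn ℝ ∞ (pullE η h) O := by
  intro q hq
  set x₀ := h q
  set O' := O ∩ h ⁻¹' (extChartAt (𝓡 n) x₀).source with hO'
  have hO'o : IsOpen O' := hd.continuousOn.isOpen_inter_preimage hO (isOpen_extChartAt_source x₀)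
  have hqO' : q ∈ O' := ⟨hq, mem_extChartAt_source x₀⟩
  have h1 : ContDiffOn ℝ ∞ (fun q => extChartAt (𝓡 n) x₀ (h q)) O' :=
    contDiffOn_chart_comp (fun q hq => hq.2) (hd.mono inter_subset_left)
  have h2 : ContDiffOn ℝ ∞ (fderiv ℝ (fun q => extChartAt (𝓡 n) x₀ (h q))) O' :=
    h1.fderiv_of_isOpen hO'o (by simp)
  have h3 : ContDiffOn ℝ ∞ (fun q => η.inChart x₀ (extChartAt (𝓡 n) x₀ (h q))) O' := by
    refine (hη x₀).comp h1 ?_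
    intro q' hq'
    refine ⟨(extChartAt (𝓡 n) x₀).map_source hq'.2, ?_⟩
    simp only [mem_preimage]
    rw [(extChartAt (𝓡 n) x₀).left_inv hq'.2]
    exact hW _ hq'.1
  have h4 : ContDiffOn ℝ ∞ (pullE η h) O' := by
    refine (h3.clm_comp h2).congr ?_
    intro q' hq'
    exact pullE_eq hq'.2 ((hd.contMDiffAt (hO.mem_nhds hq'.1)).mdifferentiableAt (by simp))
  exact (h4.contDiffAt (hO'o.mem_nhds hqO')).contDiffWithinAt

/-- Naturality of `d`. With `k` the map `h` read in the chart at `h q`, the pullback is `(η ∘ k) ·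
Dk`. Its derivative has a term with `Dη`, which is the claim, and a term with `D²k`, which is
symmetric and drops out of the difference. Using the chart at `h q` itself makes `Dk` equal to the
manifold derivative at `q`. -/
theorem fderiv_pullE {η : OneForm n X} {W : Set X} (hη : η.SmoothOn W) (hWo : IsOpen W)
    {h : E' → X} {O : Set E'} (hO : IsOpen O) (hd : ContMDiffOn 𝓘(ℝ, E') (𝓡 n) ∞ h O) {q : E'}
    (hq : q ∈ O) (hqW : h q ∈ W) (u v : E') :
    fderiv ℝ (pullE η h) q u v - fderiv ℝ (pullE η h) q v u =
      extD η (h q) (mfderiv 𝓘(ℝ, E') (𝓡 n) h q u) (mfderiv 𝓘(ℝ, E') (𝓡 n) h q v) := by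
  set x₀ := h q with hx₀
  set O' := O ∩ h ⁻¹' (extChartAt (𝓡 n) x₀).source with hO'
  have hO'o : IsOpen O' := hd.continuousOn.isOpen_inter_preimage hO (isOpen_extChartAt_source x₀)
  have hqO' : q ∈ O' := ⟨hq, mem_extChartAt_source x₀⟩
  set k : E' → EuclideanSpace ℝ (Fin n) := fun q => extChartAt (𝓡 n) x₀ (h q) with hk
  have h1 : ContDiffOn ℝ ∞ k O' :=
    contDiffOn_chart_comp (fun q hq => hq.2) (hd.mono inter_subset_left)
  have h2 : ContDiffOn ℝ ∞ (fderiv ℝ k) O' := h1.fderiv_of_isOpen hO'o (by simp)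
  have hkq : ContDiffAt ℝ ∞ k q := h1.contDiffAt (hO'o.mem_nhds hqO')
  have hmd : MDifferentiableAt 𝓘(ℝ, E') (𝓡 n) h q :=
    (hd.contMDiffAt (hO.mem_nhds hq)).mdifferentiableAt (by simp)
  have hη' : DifferentiableAt ℝ (η.inChart x₀) (k q) := by
    have h5 : IsOpen ((extChartAt (𝓡 n) x₀).target ∩ (extChartAt (𝓡 n) x₀).symm ⁻¹' W) :=
      (continuousOn_extChartAt_symm x₀).isOpen_inter_preimage (isOpen_extChartAt_target x₀) hWo
    have h6 : k q ∈ (extChartAt (𝓡 n) x₀).target ∩ (extChartAt (𝓡 n) x₀).symm ⁻¹' W := by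
      refine ⟨mem_extChartAt_target x₀, ?_⟩
      simp only [mem_preimage, hk]
      rw [(extChartAt (𝓡 n) x₀).left_inv hqO'.2]
      exact hqW
    exact ((hη x₀).contDiffAt (h5.mem_nhds h6)).differentiableAt (by simp)
  have hev : pullE η h =ᶠ[𝓝 q] fun q => (η.inChart x₀ (k q)).comp (fderiv ℝ k q) := by
    filter_upwards [hO'o.mem_nhds hqO'] with q' hq'
    exact pullE_eq hq'.2 ((hd.contMDiffAt (hO.mem_nhds hq'.1)).mdifferentiableAt (by simp))
  have hD : HasFDerivAt (fun q => η.inChart x₀ (k q))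
      ((fderiv ℝ (η.inChart x₀) (k q)).comp (fderiv ℝ k q)) q :=
    hη'.hasFDerivAt.comp q (hkq.differentiableAt (by simp)).hasFDerivAt
  have hD2 : HasFDerivAt (fderiv ℝ k) (fderiv ℝ (fderiv ℝ k) q) q :=
    ((h2.contDiffAt (hO'o.mem_nhds hqO')).differentiableAt (by simp)).hasFDerivAt
  have hsym : IsSymmSndFDerivAt ℝ k q := hkq.isSymmSndFDerivAt (by
    rw [minSmoothness_of_isRCLikeNormedField]
    exact WithTop.coe_le_coe.2 (le_top : (2 : ℕ∞) ≤ ⊤))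
  have hfd : ∀ w : E', fderiv ℝ k q w = mfderiv 𝓘(ℝ, E') (𝓡 n) h q w := by
    intro w
    have e1 := mfderiv_eq_coordFrame_comp (x₀ := x₀) hqO'.2 hmd
    have e2 := coordFrame_self (n := n) x₀
    have e3 : (mfderiv 𝓘(ℝ, E') (𝓡 n) h q : E' →L[ℝ] EuclideanSpace ℝ (Fin n)) = fderiv ℝ k q := by
      refine e1.trans ?_
      rw [← hx₀, e2]
      rfl
    exact (congrArg (fun T : E' →L[ℝ] EuclideanSpace ℝ (Fin n) => T w) e3).symm
  rw [hev.fderiv_eq, (hD.clm_comp hD2).fderiv]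
  simp only [extD, add_apply, ContinuousLinearMap.comp_apply,
    ContinuousLinearMap.compL_apply, ContinuousLinearMap.flip_apply, hsym u v]
  rw [← hfd u, ← hfd v]
  change _ = fderiv ℝ (η.inChart x₀) (k q) (fderiv ℝ k q u) (fderiv ℝ k q v) -
    fderiv ℝ (η.inChart x₀) (k q) (fderiv ℝ k q v) (fderiv ℝ k q u)
  ring

end ChartCalculus

end

section

open Set Filter Topology

/-! ### Pullback of one-forms between manifolds, and Cartan's formula. -/

section Pullback

variable {n m : ℕ} {X : Type*} [TopologicalSpace X] [ChartedSpace (EuclideanSpace ℝ (Fin n)) X]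
  [IsManifold (𝓡 n) ∞ X]
  {Y : Type*} [TopologicalSpace Y] [ChartedSpace (EuclideanSpace ℝ (Fin m)) Y]
  [IsManifold (𝓡 m) ∞ Y]

theorem isOpen_chart_preimage (x₀ : X) {W : Set X} (hW : IsOpen W) :
    IsOpen ((extChartAt (𝓡 n) x₀).target ∩ (extChartAt (𝓡 n) x₀).symm ⁻¹' W) :=
  (continuousOn_extChartAt_symm x₀).isOpen_inter_preimage (isOpen_extChartAt_target x₀) hW

theorem mem_chart_preimage {x₀ x : X} {W : Set X} (hx : x ∈ (extChartAt (𝓡 n) x₀).source)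
    (hW : x ∈ W) : extChartAt (𝓡 n) x₀ x ∈
      (extChartAt (𝓡 n) x₀).target ∩ (extChartAt (𝓡 n) x₀).symm ⁻¹' W := by
  refine ⟨(extChartAt (𝓡 n) x₀).map_source hx, ?_⟩
  rw [mem_preimage, (extChartAt (𝓡 n) x₀).left_inv hx]
  exact hW

/-- The pullback of a one-form by a map of manifolds. -/
def pullM (η : OneForm n X) (e : Y → X) : OneForm m Y := fun y =>
  (η (e y)).comp (mfderiv (𝓡 m) (𝓡 n) e y)

theorem pullM_inChart {η : OneForm n X} {e : Y → X} {y₀ : Y} {z : EuclideanSpace ℝ (Fin m)}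
    (hz : z ∈ (extChartAt (𝓡 m) y₀).target)
    (he : MDifferentiableAt (𝓡 m) (𝓡 n) e ((extChartAt (𝓡 m) y₀).symm z)) :
    (pullM η e).inChart y₀ z = pullE η (e ∘ (extChartAt (𝓡 m) y₀).symm) z := by
  have := mfderiv_comp z he ((contMDiffAt_chart_symm hz).mdifferentiableAt (by simp))
  rw [pullE, this]
  rfl

theorem contMDiffOn_comp_chart_symm {e : Y → X} {O : Set Y} (he : ContMDiffOn (𝓡 m) (𝓡 n) ∞ e O)
    (y₀ : Y) : ContMDiffOn 𝓘(ℝ, EuclideanSpace ℝ (Fin m)) (𝓡 n) ∞ (e ∘ (extChartAt (𝓡 m) y₀).symm)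
      ((extChartAt (𝓡 m) y₀).target ∩ (extChartAt (𝓡 m) y₀).symm ⁻¹' O) :=
  he.comp ((contMDiffOn_chart_symm y₀).mono inter_subset_left) (fun _ h => h.2)

theorem smoothOn_pullM {η : OneForm n X} {W : Set X} (hη : η.SmoothOn W) {e : Y → X} {O : Set Y}
    (hO : IsOpen O) (hW : ∀ y ∈ O, e y ∈ W) (he : ContMDiffOn (𝓡 m) (𝓡 n) ∞ e O) :
    OneForm.SmoothOn (n := m) (pullM η e) O := by
  intro y₀
  refine (contDiffOn_pullE hη (isOpen_chart_preimage y₀ hO) (fun z hz => hW _ hz.2)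
    (contMDiffOn_comp_chart_symm he y₀)).congr ?_
  intro z hz
  exact pullM_inChart hz.1 ((he.contMDiffAt (hO.mem_nhds hz.2)).mdifferentiableAt (by simp))

theorem extD_congr {η η' : OneForm n X} {x : X} (h : ∀ᶠ y in 𝓝 x, η y = η' y)
    (u v : TangentSpace (𝓡 n) x) : extD η x u v = extD η' x u v := by
  have : η.inChart x =ᶠ[𝓝 (extChartAt (𝓡 n) x x)] η'.inChart x := by
    have h1 : ContinuousAt (extChartAt (𝓡 n) x).symm (extChartAt (𝓡 n) x x) :=
      continuousAt_extChartAt_symm x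
    have h2 := h1.tendsto
    rw [extChartAt_to_inv] at h2
    filter_upwards [h2.eventually h] with z hz
    simp only [OneForm.inChart, hz]
  simp only [extD, this.fderiv_eq]

theorem extD_eq_of_eq (η : OneForm n X) {x y : X} (h : x = y) (u v : EuclideanSpace ℝ (Fin n)) :
    extD η x u v = extD η y u v := by subst h; rfl

theorem extD_pullM {η : OneForm n X} {W : Set X} (hη : η.SmoothOn W) (hWo : IsOpen W)
    {e : Y → X} {O : Set Y} (hO : IsOpen O) (he : ContMDiffOn (𝓡 m) (𝓡 n) ∞ e O) {y : Y}
    (hy : y ∈ O) (hyW : e y ∈ W) (u v : TangentSpace (𝓡 m) y) :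
    extD (pullM η e) y u v =
      extD η (e y) (mfderiv (𝓡 m) (𝓡 n) e y u) (mfderiv (𝓡 m) (𝓡 n) e y v) := by
  set z := extChartAt (𝓡 m) y y with hz
  have hO' := isOpen_chart_preimage (n := m) y hO
  have hz' := mem_chart_preimage (n := m) (mem_extChartAt_source (I := 𝓡 m) y) hy
  have hinv : (extChartAt (𝓡 m) y).symm z = y := extChartAt_to_inv y
  have hev : (pullM η e).inChart y =ᶠ[𝓝 z] pullE η (e ∘ (extChartAt (𝓡 m) y).symm) := by
    filter_upwards [hO'.mem_nhds hz'] with z' hz'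
    exact pullM_inChart hz'.1 ((he.contMDiffAt (hO.mem_nhds hz'.2)).mdifferentiableAt (by simp))
  have key := fderiv_pullE hη hWo hO' (contMDiffOn_comp_chart_symm he y) hz'
    (by rw [Function.comp_apply, hinv]; exact hyW) u v
  have hmd : (mfderiv 𝓘(ℝ, EuclideanSpace ℝ (Fin m)) (𝓡 n) (e ∘ (extChartAt (𝓡 m) y).symm) z :
      EuclideanSpace ℝ (Fin m) →L[ℝ] EuclideanSpace ℝ (Fin n)) = mfderiv (𝓡 m) (𝓡 n) e y := by
    have hd : MDifferentiableAt (𝓡 m) (𝓡 n) e y :=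
      (he.contMDiffAt (hO.mem_nhds hy)).mdifferentiableAt (by simp)
    have e1 := mfderiv_comp z (by rw [hinv]; exact hd)
      ((contMDiffAt_chart_symm hz'.1).mdifferentiableAt (by simp))
    have e2 := coordFrame_self (n := m) y
    have key : ∀ (y' : Y) (T : EuclideanSpace ℝ (Fin m) →L[ℝ] EuclideanSpace ℝ (Fin m)), y' = y →
      T = ContinuousLinearMap.id ℝ _ →
      ((mfderiv (𝓡 m) (𝓡 n) e y' : EuclideanSpace ℝ (Fin m) →L[ℝ] EuclideanSpace ℝ (Fin n)).comp T)
        = mfderiv (𝓡 m) (𝓡 n) e y := by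
      rintro y' T rfl rfl; rfl
    exact e1.trans (key _ _ hinv e2)
  have h2 : extD (pullM η e) y u v =
      extD η ((e ∘ (extChartAt (𝓡 m) y).symm) z)
      (mfderiv 𝓘(ℝ, EuclideanSpace ℝ (Fin m)) (𝓡 n) (e ∘ (extChartAt (𝓡 m) y).symm) z u)
      (mfderiv 𝓘(ℝ, EuclideanSpace ℝ (Fin m)) (𝓡 n) (e ∘ (extChartAt (𝓡 m) y).symm) z v) := by
    rw [← key]
    simp only [extD]
    rw [← hz, hev.fderiv_eq]
  rw [h2]
  have h3 := extD_eq_of_eq η (x := (e ∘ (extChartAt (𝓡 m) y).symm) z) (y := e y)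
    (by rw [Function.comp_apply, hinv])
  refine (h3 _ _).trans ?_
  have h4 : ∀ (T T' : EuclideanSpace ℝ (Fin m) →L[ℝ] EuclideanSpace ℝ (Fin n)), T = T' →
    extD η (e y) (T u) (T v) = extD η (e y) (T' u) (T' v) := by rintro T T' rfl; rfl
  exact h4 _ _ hmd

/-- The exterior derivative in a fixed chart. -/
theorem fderiv_inChart_sub {η : OneForm n X} {W : Set X} (hη : η.SmoothOn W) (hWo : IsOpen W)
    {x₀ : X} {z : EuclideanSpace ℝ (Fin n)} (hz : z ∈ (extChartAt (𝓡 n) x₀).target)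
    (hzW : (extChartAt (𝓡 n) x₀).symm z ∈ W) (u v : EuclideanSpace ℝ (Fin n)) :
    fderiv ℝ (η.inChart x₀) z u v - fderiv ℝ (η.inChart x₀) z v u =
      extD η ((extChartAt (𝓡 n) x₀).symm z) (coordFrame x₀ z u) (coordFrame x₀ z v) :=
  fderiv_pullE hη hWo (isOpen_extChartAt_target x₀) (contMDiffOn_chart_symm x₀) hz hzW u v

theorem inChart_apply_inChart (η : OneForm n X) (Z : VecField n X) {x₀ : X}
    {z : EuclideanSpace ℝ (Fin n)} (hz : z ∈ (extChartAt (𝓡 n) x₀).target) :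
    η.inChart x₀ z (Z.inChart x₀ z) =
      η ((extChartAt (𝓡 n) x₀).symm z) (Z ((extChartAt (𝓡 n) x₀).symm z)) := by
  have := coordFrame_comp_mfderiv_chart hz
  exact congrArg (η ((extChartAt (𝓡 n) x₀).symm z))
    (congrArg (fun T => T (Z ((extChartAt (𝓡 n) x₀).symm z))) this)

theorem OneForm.SmoothOn.differentiableAt {η : OneForm n X} {W : Set X} (hη : η.SmoothOn W)
    (hWo : IsOpen W) {x : X} (hx : x ∈ W) :
    DifferentiableAt ℝ (η.inChart x) (extChartAt (𝓡 n) x x) :=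
  ((hη x).contDiffAt ((isOpen_chart_preimage x hWo).mem_nhds
    (mem_chart_preimage (mem_extChartAt_source x) hx))).differentiableAt (by simp)

/-- Cartan's formula for a one-form that vanishes on the vector field. -/
theorem lieD_eq_extD {η : OneForm n X} {W : Set X} (hη : η.SmoothOn W) (hWo : IsOpen W) {x : X}
    (hx : x ∈ W) {Z : VecField n X}
    (hZ : DifferentiableAt ℝ (Z.inChart x) (extChartAt (𝓡 n) x x))
    (h0 : ∀ y ∈ W, η y (Z y) = 0) (v : TangentSpace (𝓡 n) x) :
    lieD Z η x v = extD η x (Z x) v := by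
  have hη' := hη.differentiableAt hWo hx
  have hev : (fun z => η.inChart x z (Z.inChart x z)) =ᶠ[𝓝 (extChartAt (𝓡 n) x x)] fun _ => 0 := by
    filter_upwards [(isOpen_chart_preimage x hWo).mem_nhds
      (mem_chart_preimage (mem_extChartAt_source x) hx)] with z hz
    rw [inChart_apply_inChart _ _ hz.1]
    exact h0 _ hz.2
  -- Differentiating `η(Z) = 0` trades the term of the Lie derivative that contains `∂Z` for the
  -- second term of `dη(Z, v)`.
  have h1 := (hη'.hasFDerivAt.clm_apply hZ.hasFDerivAt).fderiv
  rw [hev.fderiv_eq, fderiv_fun_const] at h1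
  have h2 : (0 : ℝ) = η.inChart x (extChartAt (𝓡 n) x x)
      (fderiv ℝ (Z.inChart x) (extChartAt (𝓡 n) x x) v) +
      (fderiv ℝ (η.inChart x) (extChartAt (𝓡 n) x x) v) (Z.inChart x (extChartAt (𝓡 n) x x)) :=
    congrArg (fun T : EuclideanSpace ℝ (Fin n) →L[ℝ] ℝ => T v) h1
  have h3 : (fderiv ℝ (η.inChart x) (extChartAt (𝓡 n) x x) v) (Z x) = -
    η x (fderiv ℝ (Z.inChart x) (extChartAt (𝓡 n) x x) v) := by
    have h4 : η.inChart x (extChartAt (𝓡 n) x x)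
      (fderiv ℝ (Z.inChart x) (extChartAt (𝓡 n) x x) v) = 
      η x (fderiv ℝ (Z.inChart x) (extChartAt (𝓡 n) x x) v) := by
      exact congrArg (fun T : EuclideanSpace ℝ (Fin n) →L[ℝ] ℝ =>
        T (fderiv ℝ (Z.inChart x) (extChartAt (𝓡 n) x x) v)) (OneForm.inChart_self η x)
    have h5 : (fderiv ℝ (η.inChart x) (extChartAt (𝓡 n) x x) v)
      (Z.inChart x (extChartAt (𝓡 n) x x)) =
      (fderiv ℝ (η.inChart x) (extChartAt (𝓡 n) x x) v) (Z x) :=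
      congrArg _ (GaugedSkyrme.inChart_self Z x)
    linarith [h2, h4, h5]
  simp only [lieD, extD]
  linarith

end Pullback

/-! ### Contraction of an invariant form's differential with the generator of the flow. -/

section Invariant

variable {n : ℕ} {X : Type*} [TopologicalSpace X] [ChartedSpace (EuclideanSpace ℝ (Fin n)) X]
  [IsManifold (𝓡 n) ∞ X]

/-- If a one-form is invariant under a flow and constant on its generator `Z`, then `ι_Z dη = 0`. -/
theorem extD_generator_eq_zero {η : OneForm n X} {W : Set X} (hη : η.SmoothOn W) (hWo : IsOpen W)
    {ψ : ℝ × X → X} (hψ : ContMDiff (𝓘(ℝ, ℝ).prod (𝓡 n)) (𝓡 n) ∞ ψ) (hψ0 : ∀ y, ψ (0, y) = y)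
    {Z : VecField n X}
    (hZ : ∀ t y, mfderiv 𝓘(ℝ, ℝ) (𝓡 n) (fun t => ψ (t, y)) t (1 : ℝ) = Z (ψ (t, y)))
    (hinv : ∀ t y, (η (ψ (t, y))).comp (mfderiv (𝓡 n) (𝓡 n) (fun y => ψ (t, y)) y) = η y)
    {C : ℝ} (hC : ∀ y ∈ W, η y (Z y) = C) {y : X} (hy : y ∈ W) (v : TangentSpace (𝓡 n) y) :
    extD η y (Z y) v = 0 := by
  set c := extChartAt (𝓡 n) y with hc
  set h : ℝ × EuclideanSpace ℝ (Fin n) → X := fun q => ψ (q.1, c.symm q.2) with hh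
  set O₁ : Set (ℝ × EuclideanSpace ℝ (Fin n)) := univ ×ˢ (c.target ∩ c.symm ⁻¹' W) with hO₁
  have hO₁o : IsOpen O₁ := isOpen_univ.prod (isOpen_chart_preimage y hWo)
  have hsm : ContMDiffOn 𝓘(ℝ, ℝ × EuclideanSpace ℝ (Fin n)) (𝓡 n) ∞ h O₁ := by
    have h1 : ContMDiffOn 𝓘(ℝ, ℝ × EuclideanSpace ℝ (Fin n)) (𝓡 n) ∞
        (fun q : ℝ × EuclideanSpace ℝ (Fin n) => c.symm q.2) O₁ :=
      (contMDiffOn_chart_symm y).comp (contDiff_snd.contMDiff.contMDiffOn)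
        (fun q hq => hq.2.1)
    have h2 : ContMDiffOn 𝓘(ℝ, ℝ × EuclideanSpace ℝ (Fin n)) 𝓘(ℝ, ℝ) ∞
        (fun q : ℝ × EuclideanSpace ℝ (Fin n) => q.1) O₁ :=
      contDiff_fst.contMDiff.contMDiffOn
    exact hψ.comp_contMDiffOn (h2.prodMk h1)
  set O := O₁ ∩ h ⁻¹' W with hO
  have hOo : IsOpen O := hsm.continuousOn.isOpen_inter_preimage hO₁o hWo
  have hsm' := hsm.mono (inter_subset_left : O ⊆ O₁)
  have hcy : c.symm (c y) = y := extChartAt_to_inv y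
  have h0 : h (0, c y) = y := by simp only [hh, hψ0, hcy]
  have hq0 : ((0 : ℝ), c y) ∈ O := by
    refine ⟨⟨mem_univ _, mem_chart_preimage (mem_extChartAt_source y) hy⟩, ?_⟩
    rw [mem_preimage, h0]; exact hy
  have hmd : ∀ q ∈ O, MDifferentiableAt 𝓘(ℝ, ℝ × EuclideanSpace ℝ (Fin n)) (𝓡 n) h q :=
    fun q hq => (hsm'.contMDiffAt (hOo.mem_nhds hq)).mdifferentiableAt (by simp)
  have hd1 : ∀ q ∈ O, mfderiv 𝓘(ℝ, ℝ × EuclideanSpace ℝ (Fin n)) (𝓡 n) h q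
      ((1 : ℝ), (0 : EuclideanSpace ℝ (Fin n))) = Z (h q) := by
    intro q hq
    rw [← hZ q.1 (c.symm q.2)]
    have e1 : HasFDerivAt (fun t : ℝ => (t, q.2)) (ContinuousLinearMap.inl ℝ ℝ _) q.1 :=
      hasFDerivAt_prodMk_left q.1 q.2
    have e2 := mfderiv_comp (I := 𝓘(ℝ, ℝ)) (I' := 𝓘(ℝ, ℝ × EuclideanSpace ℝ (Fin n)))
      (I'' := 𝓡 n) q.1 (f := fun t : ℝ => (t, q.2)) (g := h) (hmd q hq)
      e1.differentiableAt.mdifferentiableAt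
    have e3 : mfderiv 𝓘(ℝ, ℝ) (𝓡 n) (fun t => ψ (t, c.symm q.2)) q.1 =
      mfderiv 𝓘(ℝ, ℝ) (𝓡 n) (h ∘ fun t : ℝ => (t, q.2)) q.1 := rfl
    rw [e3, e2, mfderiv_eq_fderiv, e1.fderiv]
    rfl
  have hd2' : ∀ q ∈ O, ∀ w : EuclideanSpace ℝ (Fin n),
      mfderiv 𝓘(ℝ, ℝ × EuclideanSpace ℝ (Fin n)) (𝓡 n) h q ((0 : ℝ), w) =
        mfderiv (𝓡 n) (𝓡 n) (fun y => ψ (q.1, y)) (c.symm q.2) (coordFrame y q.2 w) := by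
    intro q hq w
    have e1 : HasFDerivAt (fun u : EuclideanSpace ℝ (Fin n) => (q.1, u))
      (ContinuousLinearMap.inr ℝ ℝ _) q.2 := hasFDerivAt_prodMk_right q.1 q.2
    have e2 := mfderiv_comp (I := 𝓘(ℝ, EuclideanSpace ℝ (Fin n)))
      (I' := 𝓘(ℝ, ℝ × EuclideanSpace ℝ (Fin n)))
      (I'' := 𝓡 n) q.2 (f := fun u : EuclideanSpace ℝ (Fin n) => (q.1, u)) (g := h) (hmd q hq)
      e1.differentiableAt.mdifferentiableAt
    have e4 : MDifferentiable (𝓡 n) (𝓡 n) (fun y => ψ (q.1, y)) :=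
      (hψ.comp (contMDiff_const.prodMk contMDiff_id)).mdifferentiable (by simp)
    have e5 := mfderiv_comp (I := 𝓘(ℝ, EuclideanSpace ℝ (Fin n))) (I' := 𝓡 n) (I'' := 𝓡 n) q.2
      (f := c.symm) (g := fun y => ψ (q.1, y)) (e4 _)
      ((contMDiffAt_chart_symm hq.1.2.1).mdifferentiableAt (by simp))
    rw [mfderiv_eq_fderiv, e1.fderiv] at e2
    exact congrArg (fun T => T w) (e2.symm.trans e5)
  have hd2 : ∀ q ∈ O, ∀ w : EuclideanSpace ℝ (Fin n),
      η (h q) (mfderiv 𝓘(ℝ, ℝ × EuclideanSpace ℝ (Fin n)) (𝓡 n) h q ((0 : ℝ), w)) =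
        η.inChart y q.2 w := by
    intro q hq w
    rw [hd2' q hq]
    exact congrArg (fun T => T (coordFrame y q.2 w)) (hinv q.1 (c.symm q.2))
  -- By invariance, `h^*η = C dt +` (`η` in the chart), with no dependence on `t`. Hence
  -- `d(h^*η)(∂_t, v) = 0`, and naturality of `d` carries this to `X`.
  have hform : ∀ q ∈ O, pullE η h q = (ContinuousLinearMap.fst ℝ ℝ _).smulRight C +
      (η.inChart y q.2).comp (ContinuousLinearMap.snd ℝ ℝ _) := by
    intro q hq
    ext p
    · change η (h q) (mfderiv 𝓘(ℝ, ℝ × EuclideanSpace ℝ (Fin n)) (𝓡 n) h q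
        ((1 : ℝ), (0 : EuclideanSpace ℝ (Fin n)))) = _
      rw [hd1 q hq, hC _ hq.2]
      simp
    · change η (h q) (mfderiv 𝓘(ℝ, ℝ × EuclideanSpace ℝ (Fin n)) (𝓡 n) h q ((0 : ℝ), _)) = _
      rw [hd2 q hq]
      simp
  have hev : pullE η h =ᶠ[𝓝 (0, c y)] fun q => (ContinuousLinearMap.fst ℝ ℝ _).smulRight C +
      (η.inChart y q.2).comp (ContinuousLinearMap.snd ℝ ℝ _) := by
    filter_upwards [hOo.mem_nhds hq0] with q hq using hform q hq
  have hη' := hη.differentiableAt hWo hy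
  have hD1 : HasFDerivAt (fun q : ℝ × EuclideanSpace ℝ (Fin n) => η.inChart y q.2)
      ((fderiv ℝ (η.inChart y) (c y)).comp (ContinuousLinearMap.snd ℝ ℝ _)) (0, c y) :=
    HasFDerivAt.comp (g := η.inChart y) (0, c y) hη'.hasFDerivAt hasFDerivAt_snd
  have hD := (hD1.clm_comp (hasFDerivAt_const (ContinuousLinearMap.snd ℝ ℝ
    (EuclideanSpace ℝ (Fin n))) (0, c y))).const_add ((ContinuousLinearMap.fst ℝ ℝ _).smulRight C)
  have key := fderiv_pullE hη hWo hOo hsm' hq0 hq0.2 ((1 : ℝ), (0 : EuclideanSpace ℝ (Fin n)))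
    ((0 : ℝ), v)
  rw [hev.fderiv_eq, hD.fderiv] at key
  simp at key
  rw [hd1 _ hq0] at key
  have e7 : (mfderiv 𝓘(ℝ, ℝ × EuclideanSpace ℝ (Fin n)) (𝓡 n) h (0, c y) ((0 : ℝ), v) :
      EuclideanSpace ℝ (Fin n)) = v := by
    have e9 : ∀ (f : X → X) (T : EuclideanSpace ℝ (Fin n) →L[ℝ] EuclideanSpace ℝ (Fin n)) (y' : X),
        f = id → T = ContinuousLinearMap.id ℝ _ →
        (mfderiv (𝓡 n) (𝓡 n) f y' (T v) : EuclideanSpace ℝ (Fin n)) = v := by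
      rintro f T y' rfl rfl
      rw [mfderiv_id]; rfl
    exact (hd2' _ hq0 v).trans (e9 _ _ _ (funext fun y => hψ0 y) (coordFrame_self y))
  have e8 : ∀ (y' : X) (w : EuclideanSpace ℝ (Fin n)), y' = y → w = v →
    extD η y' (Z y') w = extD η y (Z y) v := by rintro y' w rfl rfl; rfl
  rw [← e8 _ _ h0 e7]
  exact key.symm

end Invariant

end

section

open Set Filter Topology

/-! ### Smooth dependence of flows on initial conditions, through composition operators and the
inverse function theorem. -/

section Nemytskii

universe u

variable {K : Type*} [TopologicalSpace K] [CompactSpace K]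
  {E F : Type u} [NormedAddCommGroup E] [NormedSpace ℝ E] [NormedAddCommGroup F] [NormedSpace ℝ F]

/-- Pointwise application of a continuous family of linear maps to a continuous function. -/
def pointwiseApply : C(K, E →L[ℝ] F) →L[ℝ] C(K, E) →L[ℝ] C(K, F) :=
  LinearMap.mkContinuous₂ (LinearMap.mk₂ ℝ
    (fun (A : C(K, E →L[ℝ] F)) (γ : C(K, E)) => (⟨fun t => A t (γ t), by fun_prop⟩ : C(K, F)))
    (fun _ _ _ => by ext; simp) (fun _ _ _ => by ext; simp)
    (fun _ _ _ => by ext; simp) (fun _ _ _ => by ext; simp)) 1 (fun A γ => by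
      rw [one_mul]
      refine (ContinuousMap.norm_le _ (by positivity)).2 fun t => ?_
      refine ((A t).le_opNorm _).trans ?_
      gcongr
      · exact A.norm_coe_le_norm t
      · exact γ.norm_coe_le_norm t)

/-- The mean value inequality is applied at each point `t`, and has to be uniform in `t`. Uniformity
comes from continuity of `γ ↦ g' ∘ γ` in the supremum norm. -/
theorem hasFDerivAt_postcomp (g : C(E, F)) (g' : C(E, E →L[ℝ] F))
    (hg : ∀ x, HasFDerivAt g (g' x) x) (γ : C(K, E)) :
    HasFDerivAt (fun γ : C(K, E) => g.comp γ) (pointwiseApply (g'.comp γ)) γ := by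
  rw [hasFDerivAt_iff_isLittleO_nhds_zero, Asymptotics.isLittleO_iff]
  intro c hc
  have hcont := (ContinuousMap.continuous_postcomp (X := K) g').tendsto γ
  obtain ⟨δ, hδ, h⟩ := (Metric.tendsto_nhds_nhds (α := C(K, E)) (β := C(K, E →L[ℝ] F))).1 hcont c hc
  have hball : ∀ (t : K), ∀ z ∈ Metric.ball (γ t) δ, ‖g' z - g' (γ t)‖ ≤ c := by
    intro t z hz
    -- A constant shift of `γ` takes the prescribed value `z` at `t` and stays within `δ` of `γ` in
    -- the supremum norm.
    have h1 : dist (γ + ContinuousMap.const K (z - γ t)) γ < δ := by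
      rw [dist_eq_norm, add_sub_cancel_left]
      refine (ContinuousMap.norm_lt_iff _ hδ).2 fun s => ?_
      simpa [dist_eq_norm] using hz
    have h2 := (ContinuousMap.dist_apply_le_dist (f := g'.comp (γ + ContinuousMap.const K (z - γ t)))
      (g := g'.comp γ) t).trans (h h1).le
    simpa [dist_eq_norm] using h2
  filter_upwards [Metric.ball_mem_nhds (0 : C(K, E)) hδ] with k hk
  have hk' : ‖k‖ < δ := by simpa using hk
  refine (ContinuousMap.norm_le _ (by positivity)).2 fun t => ?_
  have hmem : γ t + k t ∈ Metric.ball (γ t) δ := by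
    simpa [dist_eq_norm] using (k.norm_coe_le_norm t).trans_lt hk'
  have h3 := (convex_ball (γ t) δ).norm_image_sub_le_of_norm_hasFDerivWithin_le'
    (f := g) (f' := g') (φ := g' (γ t)) (fun z _ => (hg z).hasFDerivWithinAt) (hball t)
    (Metric.mem_ball_self hδ) hmem
  have h4 : ‖g (γ t + k t) - g (γ t) - g' (γ t) (k t)‖ ≤ c * ‖k t‖ := by
    simpa using h3
  refine h4.trans ?_
  gcongr
  exact k.norm_coe_le_norm t

/-- Up to the continuous linear map `pointwiseApply`, the derivative of composition with `g` is
composition with the derivative of `g`. The induction therefore replaces `F` by `E →L[ℝ] F`, which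
is why `F` is quantified inside and shares a universe with `E`. -/
theorem contDiff_postcomp_nat (n : ℕ) : ∀ {F : Type u} [NormedAddCommGroup F] [NormedSpace ℝ F]
    (g : C(E, F)), ContDiff ℝ n g → ContDiff ℝ n (fun γ : C(K, E) => g.comp γ) := by
  induction n with
  | zero =>
    intro F _ _ g _
    exact contDiff_zero.2 (ContinuousMap.continuous_postcomp g)
  | succ n ih =>
    intro F _ _ g hg
    have hg1 := contDiff_succ_iff_fderiv.1 (by exact_mod_cast hg : ContDiff ℝ ((n : ℕ∞ω) + 1) g)
    set g' : C(E, E →L[ℝ] F) := ⟨fderiv ℝ g, hg1.2.2.continuous⟩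
    have hd := hasFDerivAt_postcomp (K := K) g g' fun x => (hg1.1 x).hasFDerivAt
    have : ContDiff ℝ ((n : ℕ∞ω) + 1) (fun γ : C(K, E) => g.comp γ) := by
      refine contDiff_succ_iff_fderiv.2 ⟨fun γ => (hd γ).differentiableAt, by simp, ?_⟩
      rw [show fderiv ℝ (fun γ : C(K, E) => g.comp γ) = fun γ => pointwiseApply (g'.comp γ) from
        funext fun γ => (hd γ).fderiv]
      exact pointwiseApply.contDiff.comp (ih g' hg1.2.2)
    exact_mod_cast this

/-- Composition with a smooth map is a smooth operation on continuous functions. -/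
theorem contDiff_postcomp (g : C(E, F)) (hg : ContDiff ℝ ∞ g) :
    ContDiff ℝ ∞ (fun γ : C(K, E) => g.comp γ) :=
  contDiff_infty.2 fun n => contDiff_postcomp_nat n g (hg.of_le (by exact_mod_cast le_top))

end Nemytskii

section InverseFunction

variable {E F : Type*} [NormedAddCommGroup E] [NormedSpace ℝ E] [CompleteSpace E]
  [NormedAddCommGroup F] [NormedSpace ℝ F]

/-- The inverse function theorem, with a smooth inverse on the whole target. -/
theorem exists_smooth_inverse {f : E → F} {O : Set E} (hO : IsOpen O) (hf : ContDiffOn ℝ ∞ f O)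
    {a : E} (ha : a ∈ O) {f' : E ≃L[ℝ] F} (hf' : HasFDerivAt f (f' : E →L[ℝ] F) a) :
    ∃ e : OpenPartialHomeomorph E F, a ∈ e.source ∧ e.source ⊆ O ∧ (∀ x, e x = f x) ∧
      ContDiffOn ℝ ∞ e.symm e.target := by
  have hfa : ContDiffAt ℝ ∞ f a := hf.contDiffAt (hO.mem_nhds ha)
  set e₀ := hfa.toOpenPartialHomeomorph f hf' (by simp) with he₀
  have he₀f : ∀ x, e₀ x = f x := fun x => rfl
  -- The source is shrunk to points with invertible derivative, an open condition, so that the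
  -- inverse is smooth at every point of the target and not only at the image of `a`.
  set S : Set E := O ∩ fderiv ℝ f ⁻¹' (range ((↑) : (E ≃L[ℝ] F) → E →L[ℝ] F)) with hS
  have hSo : IsOpen S := (hf.continuousOn_fderiv_of_isOpen hO (by simp)).isOpen_inter_preimage hO
    ContinuousLinearEquiv.isOpen
  have haS : a ∈ S := ⟨ha, f', hf'.fderiv.symm⟩
  refine ⟨e₀.restrOpen S hSo, ⟨hfa.mem_toOpenPartialHomeomorph_source hf' (by simp), haS⟩,
    fun x hx => hx.2.1, fun x => rfl, ?_⟩
  intro y hy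
  obtain ⟨hy1, hy2⟩ : y ∈ e₀.target ∧ e₀.symm y ∈ S := by
    have := (e₀.restrOpen S hSo).map_target hy
    exact ⟨hy.1, this.2⟩
  obtain ⟨hyO, g', hg'⟩ := hy2
  have hfy := hf.contDiffAt (hO.mem_nhds hyO)
  have h1 : HasFDerivAt e₀ (g' : E →L[ℝ] F) (e₀.symm y) := by
    rw [hg']
    exact (hfy.differentiableAt (by simp)).hasFDerivAt
  exact (e₀.contDiffAt_symm hy1 h1 hfy).contDiffWithinAt

end InverseFunction

section Flow

variable {E : Type*} [NormedAddCommGroup E] [NormedSpace ℝ E]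

/-- The primitive of a continuous function on `[-1, 1]` that vanishes at `0`. -/
def primitiveCLM : C(Icc (-1 : ℝ) 1, E) →L[ℝ] C(Icc (-1 : ℝ) 1, E) :=
  LinearMap.mkContinuous
    { toFun := fun γ => ⟨fun t => ∫ s in (0 : ℝ)..t, IccExtend (by norm_num) γ s, by
        have : Continuous fun t : ℝ => ∫ s in (0 : ℝ)..t, IccExtend (by norm_num) γ s :=
          intervalIntegral.continuous_primitive
            (fun a b => (γ.continuous.Icc_extend').intervalIntegrable a b) 0
        exact this.comp continuous_subtype_val⟩
      map_add' := fun γ γ' => by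
        ext t
        exact intervalIntegral.integral_add ((γ.continuous.Icc_extend').intervalIntegrable _ _)
          ((γ'.continuous.Icc_extend').intervalIntegrable _ _)
      map_smul' := fun c γ => by
        ext t
        exact intervalIntegral.integral_smul c _ } 1 (fun γ => by
      rw [one_mul]
      refine (ContinuousMap.norm_le _ (norm_nonneg _)).2 fun t => ?_
      have h1 : ‖∫ s in (0 : ℝ)..t, IccExtend (by norm_num : (-1 : ℝ) ≤ 1) γ s‖ ≤
          ‖γ‖ * |(t : ℝ) - 0| :=
        intervalIntegral.norm_integral_le_of_norm_le_const fun s _ => γ.norm_coe_le_norm _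
      have h2 : |(t : ℝ) - 0| ≤ 1 := by
        rw [sub_zero, abs_le]
        exact t.2
      refine h1.trans ?_
      nlinarith [norm_nonneg γ])

theorem hasDerivAt_primitiveCLM (γ : C(Icc (-1 : ℝ) 1, E)) [CompleteSpace E] {t : ℝ}
    (ht : t ∈ Icc (-1 : ℝ) 1) :
    HasDerivAt (fun t : ℝ => ∫ s in (0 : ℝ)..t, IccExtend (by norm_num : (-1 : ℝ) ≤ 1) γ s)
      (γ ⟨t, ht⟩) t := by
  have h := intervalIntegral.integral_hasDerivAt_right (a := 0) (b := t)
    ((γ.continuous.Icc_extend' (h := (by norm_num : (-1 : ℝ) ≤ 1))).intervalIntegrable 0 t)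
    ((γ.continuous.Icc_extend').stronglyMeasurableAtFilter _ _)
    (γ.continuous.Icc_extend').continuousAt
  rwa [IccExtend_of_mem _ _ ht] at h

variable [CompleteSpace E]

/-- The integral curve is rescaled to the fixed interval `[-1, 1]`: for `γ` in the Banach space of
continuous curves, the equation is `γ(s) = x + t ∫₀ˢ X(γ)`. The map `f(t, x, γ) = (t, x, γ - x - t ∫
X(γ))` is smooth, and its local inverse on `(t, x, 0)` gives a solution depending smoothly on `(t,
x)`. The flow is the value of this solution at `s = 1`. -/
theorem exists_smooth_flow_of_contDiff {X : E → E} (hX : ContDiff ℝ ∞ X) (x₀ : E) :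
    ∃ (r : ℝ) (Ψ : ℝ × E → E), 0 < r ∧
      ContDiffOn ℝ ∞ Ψ (Metric.ball 0 r ×ˢ Metric.ball x₀ r) ∧
      (∀ x ∈ Metric.ball x₀ r, Ψ (0, x) = x) ∧
      ∀ t ∈ Metric.ball (0 : ℝ) r, ∀ x ∈ Metric.ball x₀ r,
        HasDerivAt (fun t => Ψ (t, x)) (X (Ψ (t, x))) t := by
  set g : C(E, E) := ⟨X, hX.continuous⟩ with hg
  let C := C(Icc (-1 : ℝ) 1, E)
  set N : C → C := fun γ => g.comp γ with hN
  have hNs : ContDiff ℝ ∞ N := contDiff_postcomp g hX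
  set cst : E →L[ℝ] C := ContinuousLinearMap.const ℝ _ with hcst
  set f : (ℝ × E) × C → (ℝ × E) × C := fun a =>
    (a.1, a.2 - cst a.1.2 - a.1.1 • primitiveCLM (N a.2)) with hf
  have hfs : ContDiff ℝ ∞ f := by
    have : ContDiff ℝ ∞ fun a : (ℝ × E) × C => primitiveCLM (N a.2) :=
      primitiveCLM.contDiff.comp (hNs.comp contDiff_snd)
    fun_prop
  set a₀ : (ℝ × E) × C := ((0, x₀), cst x₀) with ha₀
  -- At `t = 0` the integral term does not contribute to the derivative in the direction of `γ`, so
  -- the derivative of `f` is the shear `(a, γ) ↦ (a, γ - L a)`, inverted by changing the sign of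
  -- `L`.
  set L : ℝ × E →L[ℝ] C := cst.comp (ContinuousLinearMap.snd ℝ ℝ E) +
    (ContinuousLinearMap.fst ℝ ℝ E).smulRight (primitiveCLM (N (cst x₀))) with hL
  set T : ((ℝ × E) × C) ≃L[ℝ] ((ℝ × E) × C) := ContinuousLinearEquiv.equivOfInverse
    ((ContinuousLinearMap.fst ℝ (ℝ × E) C).prod
      (ContinuousLinearMap.snd ℝ (ℝ × E) C - L.comp (ContinuousLinearMap.fst ℝ (ℝ × E) C)))
    ((ContinuousLinearMap.fst ℝ (ℝ × E) C).prod
      (ContinuousLinearMap.snd ℝ (ℝ × E) C + L.comp (ContinuousLinearMap.fst ℝ (ℝ × E) C)))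
    (fun a => by simp) (fun a => by simp) with hT
  have hfT : HasFDerivAt f (T : ((ℝ × E) × C) →L[ℝ] ((ℝ × E) × C)) a₀ := by
    have h1 : HasFDerivAt (fun a : (ℝ × E) × C => a.1) (ContinuousLinearMap.fst ℝ (ℝ × E) C) a₀ :=
      hasFDerivAt_fst
    have h2 : HasFDerivAt (fun a : (ℝ × E) × C => a.2) (ContinuousLinearMap.snd ℝ (ℝ × E) C) a₀ :=
      hasFDerivAt_snd
    have h3 : HasFDerivAt (fun a : (ℝ × E) × C => a.1.1)
        ((ContinuousLinearMap.fst ℝ ℝ E).comp (ContinuousLinearMap.fst ℝ (ℝ × E) C)) a₀ := h1.fst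
    have h4 : HasFDerivAt (fun a : (ℝ × E) × C => cst a.1.2)
        (cst.comp ((ContinuousLinearMap.snd ℝ ℝ E).comp (ContinuousLinearMap.fst ℝ (ℝ × E) C))) a₀ :=
      cst.hasFDerivAt.comp a₀ h1.snd
    have h5' : ContDiff ℝ ∞ fun a : (ℝ × E) × C => primitiveCLM (N a.2) :=
      primitiveCLM.contDiff.comp (hNs.comp contDiff_snd)
    have h5 : DifferentiableAt ℝ (fun a : (ℝ × E) × C => primitiveCLM (N a.2)) a₀ :=
      h5'.differentiable (by simp) a₀
    have h6 := h1.prodMk ((h2.sub h4).sub (h3.smul h5.hasFDerivAt))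
    refine h6.congr_fderiv ?_
    refine ContinuousLinearMap.ext fun a => ?_
    simp [hT, hL, ha₀, sub_sub]
  obtain ⟨e, hea, -, hef, hes⟩ := exists_smooth_inverse isOpen_univ hfs.contDiffOn (mem_univ a₀) hfT
  set y : ℝ × E → C := fun p => (e.symm (p, 0)).2 with hy
  set Ω : Set (ℝ × E) := {p | (p, (0 : C)) ∈ e.target} with hΩ
  have hys : ContDiffOn ℝ ∞ y Ω :=
    contDiff_snd.comp_contDiffOn (hes.comp (by fun_prop) fun p hp => hp)
  have hey : ∀ p ∈ Ω, e.symm (p, 0) = (p, y p) := by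
    intro p hp
    have h1 := e.right_inv hp
    rw [hef] at h1
    have h2 := congrArg Prod.fst h1
    exact Prod.ext h2 rfl
  have hyeq : ∀ p ∈ Ω, y p = cst p.2 + p.1 • primitiveCLM (N (y p)) := by
    intro p hp
    have h1 := e.right_inv hp
    rw [hef, hey p hp] at h1
    have h2 : y p - cst p.2 - p.1 • primitiveCLM (N (y p)) = 0 := congrArg Prod.snd h1
    rwa [sub_sub, sub_eq_zero] at h2
  have hyuniq : ∀ p γ, (p, γ) ∈ e.source → γ = cst p.2 + p.1 • primitiveCLM (N γ) → y p = γ := by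
    intro p γ hs hγ
    have h1 : e (p, γ) = (p, 0) := by
      rw [hef]
      refine Prod.ext rfl ?_
      change γ - cst p.2 - p.1 • primitiveCLM (N γ) = 0
      rw [sub_sub, sub_eq_zero]; exact hγ
    rw [hy]
    simp only
    rw [← h1, e.left_inv hs]
  have hea0 : e a₀ = ((0, x₀), 0) := by rw [hef]; simp [hf, ha₀]
  have hp₀ : ((0 : ℝ), x₀) ∈ Ω := by
    have := e.map_source hea
    rwa [hea0] at this
  have hΩo : IsOpen Ω := e.open_target.preimage (by fun_prop)
  have hy0 : y (0, x₀) = cst x₀ := by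
    rw [hy]; simp only
    rw [← hea0, e.left_inv hea]
  obtain ⟨ρ, hρ, hρs⟩ := Metric.mem_nhds_iff.1 (e.open_source.mem_nhds hea)
  have hcont : ContinuousAt y (0, x₀) := hys.continuousOn.continuousAt (hΩo.mem_nhds hp₀)
  have hnhds : Ω ∩ y ⁻¹' Metric.ball (cst x₀) ρ ∈ 𝓝 ((0 : ℝ), x₀) :=
    inter_mem (hΩo.mem_nhds hp₀) (hcont (by rw [hy0]; exact Metric.ball_mem_nhds _ hρ))
  obtain ⟨r₀, hr₀, hr₀s⟩ := Metric.mem_nhds_iff.1 hnhds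
  set r := min r₀ ρ with hr
  have hrpos : 0 < r := lt_min hr₀ hρ
  have hbox : ∀ t ∈ Metric.ball (0 : ℝ) r, ∀ x ∈ Metric.ball x₀ r,
      (t, x) ∈ Ω ∧ ‖y (t, x) - cst x₀‖ < ρ := by
    intro t ht x hx
    have h1 : (t, x) ∈ Metric.ball ((0 : ℝ), x₀) r₀ := by
      rw [Metric.mem_ball, Prod.dist_eq]
      exact max_lt (lt_of_lt_of_le ht (min_le_left _ _)) (lt_of_lt_of_le hx (min_le_left _ _))
    have h2 := hr₀s h1
    exact ⟨h2.1, (dist_eq_norm (y (t, x)) (cst x₀)).symm.trans_lt h2.2⟩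
  have hone : (1 : ℝ) ∈ Icc (-1 : ℝ) 1 := by norm_num
  -- The curve `s ↦ y(τ, x)(a s)` solves the equation with time parameter `a τ`. It lies in the
  -- source of the local inverse, where solutions are unique, so it equals `y(a τ, x)`.
  have hscale : ∀ τ ∈ Metric.ball (0 : ℝ) r, ∀ x ∈ Metric.ball x₀ r, ∀ a (ha : a ∈ Icc (-1 : ℝ) 1),
      y (a * τ, x) ⟨1, hone⟩ = y (τ, x) ⟨a, ha⟩ := by
    intro τ hτ x hx a ha
    have hmul : ∀ s : Icc (-1 : ℝ) 1, a * s ∈ Icc (-1 : ℝ) 1 := fun s => by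
      rw [mem_Icc, ← abs_le, abs_mul]
      exact mul_le_one₀ (abs_le.2 ha) (abs_nonneg _) (abs_le.2 s.2)
    set γ : C := ⟨fun s => y (τ, x) ⟨a * s, hmul s⟩, by fun_prop⟩ with hγ
    obtain ⟨hΩτ, hyτ⟩ := hbox τ hτ x hx
    have hγs : ((a * τ, x), γ) ∈ e.source := by
      apply hρs
      rw [Metric.mem_ball, Prod.dist_eq, Prod.dist_eq]
      have hτ' : |τ| < ρ := by
        have := lt_of_lt_of_le hτ (min_le_right r₀ ρ)
        simpa using this
      refine max_lt (max_lt ?_ (lt_of_lt_of_le hx (min_le_right _ _))) ?_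
      · simp only [ha₀, dist_zero_right, Real.norm_eq_abs, abs_mul]
        exact (mul_le_of_le_one_left (abs_nonneg _) (abs_le.2 ha)).trans_lt hτ'
      · rw [dist_eq_norm]
        refine (ContinuousMap.norm_lt_iff _ hρ).2 fun s => ?_
        exact ((y (τ, x) - cst x₀).norm_coe_le_norm ⟨a * s, hmul s⟩).trans_lt hyτ
    have h1 := hyuniq _ γ hγs ?_
    · rw [h1]
      exact congrArg (y (τ, x)) (Subtype.ext (mul_one a))
    · ext s
      have h2 : y (τ, x) ⟨a * s, hmul s⟩ = x + τ • ∫ u in (0 : ℝ)..(a * s),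
          IccExtend (by norm_num : (-1 : ℝ) ≤ 1) (N (y (τ, x))) u :=
        congrArg (fun η : C => η ⟨a * s, hmul s⟩) (hyeq _ hΩτ)
      change y (τ, x) ⟨a * s, hmul s⟩ = x + (a * τ) • ∫ u in (0 : ℝ)..s,
          IccExtend (by norm_num : (-1 : ℝ) ≤ 1) (N γ) u
      rw [h2, mul_comm a τ, mul_smul]
      congr 2
      have h3 := intervalIntegral.smul_integral_comp_mul_left
        (IccExtend (by norm_num : (-1 : ℝ) ≤ 1) (N (y (τ, x)))) a (a := 0) (b := s)
      rw [mul_zero] at h3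
      rw [← h3]
      congr 1
      refine intervalIntegral.integral_congr fun u hu => ?_
      have hu' : u ∈ Icc (-1 : ℝ) 1 :=
        uIcc_subset_Icc (by norm_num : (0 : ℝ) ∈ Icc (-1 : ℝ) 1) s.2 hu
      rw [IccExtend_of_mem _ _ hu', IccExtend_of_mem _ _ (hmul ⟨u, hu'⟩)]
      rfl
  refine ⟨r, fun p => y p ⟨1, hone⟩, hrpos, ?_, ?_, ?_⟩
  · refine ((ContinuousMap.evalCLM ℝ (⟨1, hone⟩ : Icc (-1 : ℝ) 1)).contDiff).comp_contDiffOn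
      (hys.mono ?_)
    rintro ⟨t, x⟩ ⟨ht, hx⟩
    exact (hbox t ht x hx).1
  · intro x hx
    have := hyeq _ (hbox 0 (Metric.mem_ball_self hrpos) x hx).1
    simp only
    rw [this]
    simp [hcst]
    rfl
  · intro t ht x hx
    simp only
    -- With one fixed `τ` beyond `|t|`, the flow at every time `s` near `t` is the single curve
    -- `y(τ, x)` at `s / τ`, and the fundamental theorem of calculus gives its derivative.
    obtain ⟨τ, hτ1, hτ2⟩ := exists_between (show |t| < r by simpa using ht)
    have hτ0 : 0 < τ := (abs_nonneg t).trans_lt hτ1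
    have hτ : τ ∈ Metric.ball (0 : ℝ) r := by simpa [abs_of_pos hτ0] using hτ2
    have hmem : ∀ s : ℝ, |s| ≤ τ → s / τ ∈ Icc (-1 : ℝ) 1 := fun s hs => by
      rw [mem_Icc, ← abs_le, abs_div, abs_of_pos hτ0]
      exact (div_le_one hτ0).2 hs
    have hval : ∀ s (hs : |s| ≤ τ), y (s, x) ⟨1, hone⟩ = y (τ, x) ⟨s / τ, hmem s hs⟩ := fun s hs => by
      have := hscale τ hτ x hx (s / τ) (hmem s hs)
      rwa [div_mul_cancel₀ _ hτ0.ne'] at this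
    have hformula : ∀ s, |s| ≤ τ → y (s, x) ⟨1, hone⟩ = x + τ • ∫ u in (0 : ℝ)..(s / τ),
        IccExtend (by norm_num : (-1 : ℝ) ≤ 1) (N (y (τ, x))) u := fun s hs => by
      rw [hval s hs]
      exact congrArg (fun η : C => η ⟨s / τ, hmem s hs⟩) (hyeq _ (hbox τ hτ x hx).1)
    have hev : (fun s => y (s, x) ⟨1, hone⟩) =ᶠ[𝓝 t] fun s => x + τ • ∫ u in (0 : ℝ)..(s / τ),
        IccExtend (by norm_num : (-1 : ℝ) ≤ 1) (N (y (τ, x))) u := by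
      filter_upwards [(isOpen_lt continuous_abs continuous_const).mem_nhds hτ1] with s hs
      exact hformula s hs.le
    refine HasDerivAt.congr_of_eventuallyEq ?_ hev
    have h1 := hasDerivAt_primitiveCLM (N (y (τ, x))) (hmem t hτ1.le)
    have h2 := (h1.scomp t ((hasDerivAt_id t).div_const τ)).const_smul τ |>.const_add x
    refine h2.congr_deriv ?_
    rw [smul_smul, mul_one_div_cancel hτ0.ne', one_smul, hval t hτ1.le]
    rfl

/-- A smooth vector field near a point of a finite-dimensional space has a smooth local flow. -/
theorem exists_smooth_flow [FiniteDimensional ℝ E] {X : E → E} {O : Set E} (hO : IsOpen O)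
    (hX : ContDiffOn ℝ ∞ X O) {x₀ : E} (hx₀ : x₀ ∈ O) :
    ∃ (r : ℝ) (Ψ : ℝ × E → E), 0 < r ∧
      ContDiffOn ℝ ∞ Ψ (Metric.ball 0 r ×ˢ Metric.ball x₀ r) ∧
      (∀ x ∈ Metric.ball x₀ r, Ψ (0, x) = x) ∧
      ∀ t ∈ Metric.ball (0 : ℝ) r, ∀ x ∈ Metric.ball x₀ r, Ψ (t, x) ∈ O ∧
        HasDerivAt (fun t => Ψ (t, x)) (X (Ψ (t, x))) t := by
  obtain ⟨ε, hε, hεO⟩ := Metric.nhds_basis_closedBall.mem_iff.1 (hO.mem_nhds hx₀)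
  -- The field is cut off to a globally smooth one that is unchanged on the ball of radius `ε / 2`.
  -- For short times the flow stays in that ball, so it is also a flow of the original field.
  set b : ContDiffBump x₀ := ⟨ε / 2, ε, by positivity, by linarith⟩
  set X' : E → E := fun x => b x • X x
  have hX' : ContDiff ℝ ∞ X' := by
    rw [contDiff_iff_contDiffAt]
    intro x
    by_cases hx : x ∈ O
    · exact b.contDiff.contDiffAt.smul (hX.contDiffAt (hO.mem_nhds hx))
    · have h1 : x ∉ tsupport b := fun h => hx (hεO (by rwa [b.tsupport_eq] at h))
      have h2 : X' =ᶠ[𝓝 x] fun _ => 0 := by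
        filter_upwards [(isClosed_tsupport b).isOpen_compl.mem_nhds h1] with z hz
        simp [X', image_eq_zero_of_notMem_tsupport hz]
      exact contDiffAt_const.congr_of_eventuallyEq h2
  obtain ⟨r, Ψ, hr, hΨ, hΨ0, hΨd⟩ := exists_smooth_flow_of_contDiff hX' x₀
  have hmem : ((0 : ℝ), x₀) ∈ Metric.ball (0 : ℝ) r ×ˢ Metric.ball x₀ r :=
    ⟨Metric.mem_ball_self hr, Metric.mem_ball_self hr⟩
  have hcont : ContinuousAt Ψ (0, x₀) :=
    hΨ.continuousOn.continuousAt ((Metric.isOpen_ball.prod Metric.isOpen_ball).mem_nhds hmem)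
  have hnhds : Ψ ⁻¹' Metric.ball x₀ (ε / 2) ∈ 𝓝 ((0 : ℝ), x₀) :=
    hcont (by rw [hΨ0 x₀ hmem.2]; exact Metric.ball_mem_nhds _ (by positivity))
  obtain ⟨r₁, hr₁, hr₁s⟩ := Metric.mem_nhds_iff.1 hnhds
  have hle1 : min r r₁ ≤ r := min_le_left _ _
  refine ⟨min r r₁, Ψ, lt_min hr hr₁, hΨ.mono (prod_mono (Metric.ball_subset_ball hle1)
    (Metric.ball_subset_ball hle1)), fun x hx => hΨ0 x (Metric.ball_subset_ball hle1 hx), ?_⟩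
  intro t ht x hx
  have h1 : Ψ (t, x) ∈ Metric.ball x₀ (ε / 2) := by
    refine @hr₁s (t, x) ?_
    rw [Metric.mem_ball, Prod.dist_eq]
    exact max_lt (lt_of_lt_of_le ht (min_le_right _ _)) (lt_of_lt_of_le hx (min_le_right _ _))
  refine ⟨hεO (Metric.ball_subset_closedBall (Metric.ball_subset_ball (by linarith) h1)), ?_⟩
  have h2 := hΨd t (Metric.ball_subset_ball hle1 ht) x (Metric.ball_subset_ball hle1 hx)
  have h3 : X' (Ψ (t, x)) = X (Ψ (t, x)) := by
    simp [X', b.one_of_mem_closedBall (Metric.ball_subset_closedBall h1)]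
  rwa [h3] at h2

end Flow

end

section

open Set Filter Topology Module

/-! ### Oriented orthonormal frames and the cross product `Sig` in coordinates. -/

section Frames

variable {X : Type*} [TopologicalSpace X] [ChartedSpace (EuclideanSpace ℝ (Fin 3)) X]
  [IsManifold (𝓡 3) ∞ X]

/-- Oriented orthonormal frames of a tangent space. -/
structure IsFrame (g : Metric X) (V : ThreeForm 3 X) (x : X) (e : Fin 3 → TangentSpace (𝓡 3) x) :
    Prop where
  inner_eq : ∀ i j, g.inner x (e i) (e j) = if i = j then 1 else 0
  vol_eq : V x e = 1

theorem finrank_tangent (x : X) : finrank ℝ (TangentSpace (𝓡 3) x) = 3 := by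
  change finrank ℝ (EuclideanSpace ℝ (Fin 3)) = 3
  simp

theorem exists_orthonormal (g : Metric X) (x : X) : ∃ e : Fin 3 → TangentSpace (𝓡 3) x,
    ∀ i j, g.inner x (e i) (e j) = if i = j then 1 else 0 := by
  have hsymm : LinearMap.IsSymm (B := (flat g x : LinearMap.BilinForm ℝ (TangentSpace (𝓡 3) x))) :=
    ⟨fun u v => g.symm x u v⟩
  obtain ⟨v, hv⟩ := LinearMap.BilinForm.exists_orthogonal_basis hsymm
  set w := v.reindex (finCongr (finrank_tangent x)) with hw
  have hw0 : ∀ i, 0 < g.inner x (w i) (w i) := fun i => g.pos x _ (w.ne_zero i)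
  have hort : ∀ i j, i ≠ j → g.inner x (w i) (w j) = 0 := by
    intro i j hij
    have : (finCongr (finrank_tangent x)).symm i ≠ (finCongr (finrank_tangent x)).symm j := by
      simpa using hij
    have h := hv this
    simp only [hw, Basis.reindex_apply]
    exact h
  refine ⟨fun i => (Real.sqrt (g.inner x (w i) (w i)))⁻¹ • w i, fun i j => ?_⟩
  simp only [map_smul, smul_apply, smul_eq_mul]
  split_ifs with h
  · subst h
    have h1 := Real.mul_self_sqrt (hw0 i).le
    have h2 := Real.sqrt_pos.2 (hw0 i)
    field_simp
    nlinarith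
  · rw [hort i j h]; simp

variable {g : Metric X} {V : ThreeForm 3 X} {x : X}

theorem exists_isFrame (hV : IsVolumeForm g V) (x : X) : ∃ e, IsFrame g V x e := by
  obtain ⟨e, he⟩ := exists_orthonormal g x
  rcases abs_eq (zero_le_one' ℝ) |>.1 (hV.unit x e he) with h | h
  · exact ⟨e, he, h⟩
  · refine ⟨Function.update e 2 (-e 2), fun i j => ?_, ?_⟩
    · fin_cases i <;> fin_cases j <;> simp [he, Function.update]
    · have := (V x).map_update_neg e 2 (e 2)
      rw [Function.update_eq_self] at this
      exact this.trans (neg_eq_iff_eq_neg.2 h)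

namespace IsFrame

variable {e : Fin 3 → TangentSpace (𝓡 3) x} (he : IsFrame g V x e)
include he

theorem linearIndependent : LinearIndependent ℝ e := by
  rw [Fintype.linearIndependent_iff]
  intro c hc i
  have := congrArg (g.inner x (e i)) hc
  simpa [he.inner_eq, map_sum] using this

/-- The basis given by a frame. -/
def basis : Basis (Fin 3) ℝ (TangentSpace (𝓡 3) x) :=
  basisOfLinearIndependentOfCardEqFinrank he.linearIndependent (by simp [finrank_tangent])

theorem basis_apply (i : Fin 3) : he.basis i = e i := by
  simp [basis]

theorem basis_repr (v : TangentSpace (𝓡 3) x) (i : Fin 3) :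
    he.basis.repr v i = g.inner x (e i) v := by
  conv_rhs => rw [← he.basis.sum_repr v]
  simp [basis_apply, he.inner_eq]

theorem expand (v : TangentSpace (𝓡 3) x) :
    v = g.inner x (e 0) v • e 0 + g.inner x (e 1) v • e 1 + g.inner x (e 2) v • e 2 := by
  conv_lhs => rw [← he.basis.sum_repr v]
  simp [Fin.sum_univ_three, basis_repr, basis_apply]

theorem ext {u v : TangentSpace (𝓡 3) x} (h : ∀ i, g.inner x (e i) u = g.inner x (e i) v) :
    u = v := by
  rw [he.expand u, he.expand v, h, h, h]

theorem inner_coord (u v : TangentSpace (𝓡 3) x) :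
    g.inner x u v = g.inner x (e 0) u * g.inner x (e 0) v + g.inner x (e 1) u * g.inner x (e 1) v +
      g.inner x (e 2) u * g.inner x (e 2) v := by
  conv_lhs => rw [he.expand u]
  simp

theorem vol_coord (u v w : TangentSpace (𝓡 3) x) :
    V x ![u, v, w] =
      g.inner x (e 0) u * (g.inner x (e 1) v * g.inner x (e 2) w -
        g.inner x (e 2) v * g.inner x (e 1) w) +
      g.inner x (e 1) u * (g.inner x (e 2) v * g.inner x (e 0) w -
        g.inner x (e 0) v * g.inner x (e 2) w) +
      g.inner x (e 2) u * (g.inner x (e 0) v * g.inner x (e 1) w -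
        g.inner x (e 1) v * g.inner x (e 0) w) := by
  have h1 := AlternatingMap.eq_smul_basis_det he.basis (V x).toAlternatingMap
  have h2 : (V x).toAlternatingMap he.basis = 1 := by
    have : (he.basis : Fin 3 → TangentSpace (𝓡 3) x) = e := funext he.basis_apply
    rw [this]; exact he.vol_eq
  have h3 : V x ![u, v, w] = he.basis.det ![u, v, w] := by
    have := congrArg (fun f => f ![u, v, w]) h1
    rw [h2, one_smul] at this
    exact this
  rw [h3, Basis.det_apply, Matrix.det_fin_three]
  simp [Basis.toMatrix_apply, basis_repr]
  ring

theorem sig_coord_zero (v w : TangentSpace (𝓡 3) x) : g.inner x (e 0) (Sig g V x v w) =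
    g.inner x (e 1) v * g.inner x (e 2) w - g.inner x (e 2) v * g.inner x (e 1) w := by
  rw [inner_Sig, he.vol_coord]; simp [he.inner_eq]

theorem sig_coord_one (v w : TangentSpace (𝓡 3) x) : g.inner x (e 1) (Sig g V x v w) =
    g.inner x (e 2) v * g.inner x (e 0) w - g.inner x (e 0) v * g.inner x (e 2) w := by
  rw [inner_Sig, he.vol_coord]; simp [he.inner_eq]

theorem sig_coord_two (v w : TangentSpace (𝓡 3) x) : g.inner x (e 2) (Sig g V x v w) =
    g.inner x (e 0) v * g.inner x (e 1) w - g.inner x (e 1) v * g.inner x (e 0) w := by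
  rw [inner_Sig, he.vol_coord]; simp [he.inner_eq]

theorem sig_zero_one : Sig g V x (e 0) (e 1) = e 2 := he.ext fun i => by
  fin_cases i <;> simp [he.sig_coord_zero, he.sig_coord_one, he.sig_coord_two, he.inner_eq]

theorem sig_one_two : Sig g V x (e 1) (e 2) = e 0 := he.ext fun i => by
  fin_cases i <;> simp [he.sig_coord_zero, he.sig_coord_one, he.sig_coord_two, he.inner_eq]

theorem sig_two_zero : Sig g V x (e 2) (e 0) = e 1 := he.ext fun i => by
  fin_cases i <;> simp [he.sig_coord_zero, he.sig_coord_one, he.sig_coord_two, he.inner_eq]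

theorem vol_coordVec_ne_zero : V x ![coordVec x 0, coordVec x 1, coordVec x 2] ≠ 0 := by
  intro h
  set b : Basis (Fin 3) ℝ (TangentSpace (𝓡 3) x) := (EuclideanSpace.basisFun (Fin 3) ℝ).toBasis
  have hb : (b : Fin 3 → TangentSpace (𝓡 3) x) =
      ![coordVec x 0, coordVec x 1, coordVec x 2] := by
    funext i
    have : b i = coordVec x i := by
      change (EuclideanSpace.basisFun (Fin 3) ℝ).toBasis i = _
      simp [coordVec]
    rw [this]
    fin_cases i <;> rfl
  have h1 := AlternatingMap.eq_smul_basis_det b (V x).toAlternatingMap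
  have h2 : (V x).toAlternatingMap b = 0 := by rw [hb]; exact h
  rw [h2, zero_smul] at h1
  have h3 : V x e = 0 := congrArg (fun f => f e) h1
  rw [he.vol_eq] at h3
  exact one_ne_zero h3

end IsFrame

/-- A frame whose first two vectors point along given orthogonal vectors. -/
theorem exists_adapted_frame (hV : IsVolumeForm g V) {m n : TangentSpace (𝓡 3) x} (hn : n ≠ 0)
    (hmn : g.inner x m n = 0) : ∃ (e : Fin 3 → TangentSpace (𝓡 3) x) (c ρ : ℝ), IsFrame g V x e ∧
      m = c • e 0 ∧ n = ρ • e 1 ∧ 0 < ρ ∧ (m ≠ 0 → 0 < c) := by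
  have unit : ∀ u : TangentSpace (𝓡 3) x, u ≠ 0 → ∃ (e : TangentSpace (𝓡 3) x) (c : ℝ), 0 < c ∧
      u = c • e ∧ g.inner x e e = 1 := by
    intro u hu
    have h1 := g.pos x u hu
    have h2 := Real.sqrt_pos.2 h1
    refine ⟨(Real.sqrt (g.inner x u u))⁻¹ • u, _, h2, ?_, ?_⟩
    · rw [smul_smul, mul_inv_cancel₀ h2.ne', one_smul]
    · simp only [map_smul, smul_apply, smul_eq_mul]
      have h3 := Real.mul_self_sqrt h1.le
      field_simp
      nlinarith
  obtain ⟨f, hf⟩ := exists_isFrame hV x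
  obtain ⟨e₁, ρ, hρ, hne, he₁⟩ := unit n hn
  -- Two orthonormal vectors are completed by their cross product. Its unit length is Lagrange's
  -- identity, and the same number is the volume of the frame.
  have main : ∀ e₀ : TangentSpace (𝓡 3) x, g.inner x e₀ e₀ = 1 → g.inner x e₀ e₁ = 0 →
      IsFrame g V x ![e₀, e₁, Sig g V x e₀ e₁] := by
    intro e₀ he₀ he₀₁
    have he₁' := he₁
    have h02 : g.inner x e₀ (Sig g V x e₀ e₁) = 0 := by
      rw [hf.inner_coord, hf.sig_coord_zero, hf.sig_coord_one, hf.sig_coord_two]; ring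
    have h12 : g.inner x e₁ (Sig g V x e₀ e₁) = 0 := by
      rw [hf.inner_coord, hf.sig_coord_zero, hf.sig_coord_one, hf.sig_coord_two]; ring
    have h22 : g.inner x (Sig g V x e₀ e₁) (Sig g V x e₀ e₁) = 1 := by
      rw [hf.inner_coord, hf.sig_coord_zero, hf.sig_coord_one, hf.sig_coord_two]
      rw [hf.inner_coord] at he₀ he₁' he₀₁
      linear_combination (g.inner x (f 0) e₁ * g.inner x (f 0) e₁ +
        g.inner x (f 1) e₁ * g.inner x (f 1) e₁ + g.inner x (f 2) e₁ * g.inner x (f 2) e₁) * he₀ +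
        he₁' - (g.inner x (f 0) e₀ * g.inner x (f 0) e₁ +
        g.inner x (f 1) e₀ * g.inner x (f 1) e₁ + g.inner x (f 2) e₀ * g.inner x (f 2) e₁) * he₀₁
    refine ⟨fun i j => ?_, ?_⟩
    · fin_cases i <;> fin_cases j <;> simp [he₀, he₁, he₀₁, h02, h12, h22, g.symm x e₁ e₀,
        g.symm x (Sig g V x e₀ e₁) e₀, g.symm x (Sig g V x e₀ e₁) e₁]
    · rw [hf.vol_coord, hf.sig_coord_zero, hf.sig_coord_one, hf.sig_coord_two]
      rw [hf.inner_coord, hf.sig_coord_zero, hf.sig_coord_one, hf.sig_coord_two] at h22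
      linear_combination h22
  by_cases hm : m = 0
  -- When `m = 0`, any unit vector orthogonal to `e₁` serves as `e₀`. One is found by normalising a
  -- cross product of `e₁` with a frame vector; these products cannot all vanish.
  · have : ∃ i, Sig g V x (f i) e₁ ≠ 0 := by
      by_contra! h
      have h0 := congrArg (g.inner x (f 2)) (h 0)
      have h1 := congrArg (g.inner x (f 0)) (h 1)
      have h2 := congrArg (g.inner x (f 1)) (h 2)
      simp only [hf.sig_coord_zero, hf.sig_coord_one, hf.sig_coord_two, hf.inner_eq, map_zero] at h0 h1 h2
      simp at h0 h1 h2
      rw [hf.inner_coord, h0, h1, h2] at he₁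
      simp at he₁
    obtain ⟨i, hi⟩ := this
    obtain ⟨e₀, c, hc, hce, he₀⟩ := unit _ hi
    have h01 : g.inner x e₀ e₁ = 0 := by
      have : g.inner x (Sig g V x (f i) e₁) e₁ = 0 := by
        rw [hf.inner_coord, hf.sig_coord_zero, hf.sig_coord_one, hf.sig_coord_two]; ring
      rw [hce] at this
      simpa [hc.ne'] using this
    exact ⟨_, 0, ρ, main e₀ he₀ h01, by simp [hm], hne, hρ, fun h => (h hm).elim⟩
  · obtain ⟨e₀, c, hc, hce, he₀⟩ := unit m hm
    have h01 : g.inner x e₀ e₁ = 0 := by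
      rw [hce, hne] at hmn
      simpa [hc.ne', hρ.ne'] using hmn
    exact ⟨_, c, ρ, main e₀ he₀ h01, hce, hne, hρ, fun _ => hc⟩

end Frames

end

section

open Set Filter Topology Module

/-! ### Pointwise algebra of the first BPS equation. -/

section Core

/-- The rows `p, q, r` of a `3 × 3` matrix that equals its cofactor matrix up to a perturbation `k`
of the first row. -/
theorem cofactor_dichotomy {p0 p1 p2 q0 q1 q2 r0 r1 r2 k0 k1 k2 : ℝ}
    (hp0 : p0 = q1 * r2 - q2 * r1 + k0) (hp1 : p1 = q2 * r0 - q0 * r2 + k1)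
    (hp2 : p2 = q0 * r1 - q1 * r0 + k2)
    (hq0 : q0 = r1 * p2 - r2 * p1) (hq1 : q1 = r2 * p0 - r0 * p2) (hq2 : q2 = r0 * p1 - r1 * p0)
    (hr0 : r0 = p1 * q2 - p2 * q1) (hr1 : r1 = p2 * q0 - p0 * q2) (hr2 : r2 = p0 * q1 - p1 * q0) :
    (q0 = 0 ∧ q1 = 0 ∧ q2 = 0 ∧ r0 = 0 ∧ r1 = 0 ∧ r2 = 0 ∧ p0 = k0 ∧ p1 = k1 ∧ p2 = k2) ∨
    ∃ δ : ℝ, 0 < δ ∧ p0 * p0 + p1 * p1 + p2 * p2 = 1 ∧ q0 * q0 + q1 * q1 + q2 * q2 = δ ∧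
      r0 * r0 + r1 * r1 + r2 * r2 = δ ∧ p0 * q0 + p1 * q1 + p2 * q2 = 0 ∧
      p0 * r0 + p1 * r1 + p2 * r2 = 0 ∧ q0 * r0 + q1 * r1 + q2 * r2 = 0 ∧
      k0 = (1 - δ) * p0 ∧ k1 = (1 - δ) * p1 ∧ k2 = (1 - δ) * p2 := by
  have hpq : p0 * q0 + p1 * q1 + p2 * q2 = 0 := by
    linear_combination p0 * hq0 + p1 * hq1 + p2 * hq2
  have hpr : p0 * r0 + p1 * r1 + p2 * r2 = 0 := by
    linear_combination p0 * hr0 + p1 * hr1 + p2 * hr2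
  have hqr : q0 * r0 + q1 * r1 + q2 * r2 = 0 := by
    linear_combination q0 * hr0 + q1 * hr1 + q2 * hr2
  have hrr : r0 * r0 + r1 * r1 + r2 * r2 = q0 * q0 + q1 * q1 + q2 * q2 := by
    linear_combination r0 * hr0 + r1 * hr1 + r2 * hr2 - q0 * hq0 - q1 * hq1 - q2 * hq2
  -- Lagrange's identity for `q = r × p`, with `p · r = 0` and `|r|² = |q|²`.
  have hδ : q0 * q0 + q1 * q1 + q2 * q2 =
      (q0 * q0 + q1 * q1 + q2 * q2) * (p0 * p0 + p1 * p1 + p2 * p2) := by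
    rw [← hrr]
    linear_combination hrr + q0 * hq0 + q1 * hq1 + q2 * hq2 + (r1 * p2 - r2 * p1) * hq0 +
      (r2 * p0 - r0 * p2) * hq1 + (r0 * p1 - r1 * p0) * hq2 -
      (p0 * r0 + p1 * r1 + p2 * r2) * hpr
  rcases eq_or_ne (q0 * q0 + q1 * q1 + q2 * q2) 0 with h | h
  · left
    have h0 : q0 = 0 := mul_self_eq_zero.1 (by
      linarith [mul_self_nonneg q0, mul_self_nonneg q1, mul_self_nonneg q2])
    have h1 : q1 = 0 := mul_self_eq_zero.1 (by
      linarith [mul_self_nonneg q0, mul_self_nonneg q1, mul_self_nonneg q2])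
    have h2 : q2 = 0 := mul_self_eq_zero.1 (by
      linarith [mul_self_nonneg q0, mul_self_nonneg q1, mul_self_nonneg q2])
    subst h0 h1 h2
    simp only [mul_zero, sub_self, zero_mul, zero_add] at *
    exact ⟨trivial, trivial, trivial, hr0, hr1, hr2, hp0, hp1, hp2⟩
  · right
    have hp : p0 * p0 + p1 * p1 + p2 * p2 = 1 := by
      have := mul_left_cancel₀ h (hδ.symm.trans (mul_one _).symm)
      exact this
    have hpos : 0 ≤ q0 * q0 + q1 * q1 + q2 * q2 := by
      linarith [mul_self_nonneg q0, mul_self_nonneg q1, mul_self_nonneg q2]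
    -- The last three goals are `k = p - q × r` combined with `q × r = (r × p) × r = |r|² p - (p ·
    -- r) r = δ p`.
    refine ⟨q0 * q0 + q1 * q1 + q2 * q2, lt_of_le_of_ne hpos h.symm, hp, rfl, hrr, hpq, hpr, hqr,
      ?_, ?_, ?_⟩
    · linear_combination -hp0 - p0 * hrr - r2 * hq1 + r1 * hq2 + r0 * hpr
    · linear_combination -hp1 - p1 * hrr - r0 * hq2 + r2 * hq0 + r1 * hpr
    · linear_combination -hp2 - p2 * hrr - r1 * hq0 + r0 * hq1 + r2 * hpr

/-- Rows that are orthogonal with squared lengths `1, δ, δ` have orthonormal weighted columns. -/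
theorem columns_of_rows {p0 p1 p2 q0 q1 q2 r0 r1 r2 δ : ℝ} (hδ : δ ≠ 0)
    (hp : p0 * p0 + p1 * p1 + p2 * p2 = 1) (hq : q0 * q0 + q1 * q1 + q2 * q2 = δ)
    (hr : r0 * r0 + r1 * r1 + r2 * r2 = δ) (hpq : p0 * q0 + p1 * q1 + p2 * q2 = 0)
    (hpr : p0 * r0 + p1 * r1 + p2 * r2 = 0) (hqr : q0 * r0 + q1 * r1 + q2 * r2 = 0) :
    (p0 * p0 + (q0 * q0 + r0 * r0) / δ = 1 ∧ p1 * p1 + (q1 * q1 + r1 * r1) / δ = 1 ∧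
      p2 * p2 + (q2 * q2 + r2 * r2) / δ = 1) ∧ p0 * p1 + (q0 * q1 + r0 * r1) / δ = 0 ∧
      p0 * p2 + (q0 * q2 + r0 * r2) / δ = 0 ∧ p1 * p2 + (q1 * q2 + r1 * r2) / δ = 0 := by
  have h1 : !![p0, p1, p2; q0, q1, q2; r0, r1, r2] *
      !![p0, q0 / δ, r0 / δ; p1, q1 / δ, r1 / δ; p2, q2 / δ, r2 / δ] = 1 := by
    ext i j
    fin_cases i <;> fin_cases j <;> simp [Matrix.mul_apply, Fin.sum_univ_three] <;> field_simp <;>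
      linarith
  -- The relations between rows give a right inverse of the matrix. For a square matrix it is also a
  -- left inverse, and this expresses the relations between columns.
  have h2 := mul_eq_one_comm.1 h1
  have h3 := fun i j => congrFun (congrFun h2 i) j
  have e00 := h3 0 0
  have e11 := h3 1 1
  have e22 := h3 2 2
  have e01 := h3 0 1
  have e02 := h3 0 2
  have e12 := h3 1 2
  simp [Matrix.mul_apply, Fin.sum_univ_three] at e00 e11 e22 e01 e02 e12
  exact ⟨⟨by linear_combination e00, by linear_combination e11, by linear_combination e22⟩,
    by linear_combination e01, by linear_combination e02, by linear_combination e12⟩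

end Core

section TwoForms

/-- Alternating bilinear functions. -/
def IsTwoForm {E : Type*} [AddCommGroup E] [Module ℝ E] (F : E → E → ℝ) : Prop :=
  ∃ b : E →ₗ[ℝ] E →ₗ[ℝ] ℝ, ∀ u v, F u v = b u v - b v u

theorem isTwoForm_extD {n : ℕ} {X : Type*} [TopologicalSpace X]
    [ChartedSpace (EuclideanSpace ℝ (Fin n)) X] (η : OneForm n X) (x : X) :
    IsTwoForm (extD η x) :=
  ⟨(ContinuousLinearMap.coeLM ℝ).comp
    (fderiv ℝ (η.inChart x) (extChartAt (𝓡 n) x x)).toLinearMap, fun _ _ => rfl⟩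

namespace IsTwoForm

variable {E : Type*} [AddCommGroup E] [Module ℝ E] {F : E → E → ℝ} (hF : IsTwoForm F)
include hF

theorem self (u : E) : F u u = 0 := by
  obtain ⟨b, h⟩ := hF; simp [h]

theorem swap (u v : E) : F u v = -F v u := by
  obtain ⟨b, h⟩ := hF; simp [h]

theorem add_left (u u' v : E) : F (u + u') v = F u v + F u' v := by
  obtain ⟨b, h⟩ := hF; simp only [h, map_add, LinearMap.add_apply]; ring

theorem smul_left (c : ℝ) (u v : E) : F (c • u) v = c * F u v := by
  obtain ⟨b, h⟩ := hF; simp only [h, map_smul, LinearMap.smul_apply, smul_eq_mul]; ring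

theorem add_right (u v v' : E) : F u (v + v') = F u v + F u v' := by
  obtain ⟨b, h⟩ := hF; simp only [h, map_add, LinearMap.add_apply]; ring

theorem smul_right (c : ℝ) (u v : E) : F u (c • v) = c * F u v := by
  obtain ⟨b, h⟩ := hF; simp only [h, map_smul, LinearMap.smul_apply, smul_eq_mul]; ring

theorem expand (e : Fin 3 → E) (u₀ u₁ u₂ v₀ v₁ v₂ : ℝ) :
    F (u₀ • e 0 + u₁ • e 1 + u₂ • e 2) (v₀ • e 0 + v₁ • e 1 + v₂ • e 2) =
      F (e 1) (e 2) * (u₁ * v₂ - u₂ * v₁) + F (e 2) (e 0) * (u₂ * v₀ - u₀ * v₂) +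
        F (e 0) (e 1) * (u₀ * v₁ - u₁ * v₀) := by
  simp only [hF.add_left, hF.add_right, hF.smul_left, hF.smul_right, hF.self,
    hF.swap (e 2) (e 1), hF.swap (e 0) (e 2), hF.swap (e 1) (e 0)]
  ring

end IsTwoForm

end TwoForms

section Pointwise

variable {M : Type*} [TopologicalSpace M] [ChartedSpace (EuclideanSpace ℝ (Fin 3)) M]
  [IsManifold (𝓡 3) ∞ M]
  {N : Type*} [TopologicalSpace N] [ChartedSpace (EuclideanSpace ℝ (Fin 3)) N]
  [IsManifold (𝓡 3) ∞ N]

/-- The algebraic form of the first BPS equation. -/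
def BPSRel (gM : Metric M) (VM : ThreeForm 3 M) (gN : Metric N) (VN : ThreeForm 3 N) (x : M) (y : N)
    (D : TangentSpace (𝓡 3) x →L[ℝ] TangentSpace (𝓡 3) y)
    (F : TangentSpace (𝓡 3) x → TangentSpace (𝓡 3) x → ℝ) (m : TangentSpace (𝓡 3) y) : Prop :=
  ∀ v w : TangentSpace (𝓡 3) x,
    D (Sig gM VM x v w) - (Sig gN VN y (D v) (D w) + (3 : ℝ) • (F v w • m)) = 0

variable {gM : Metric M} {VM : ThreeForm 3 M} {gN : Metric N} {VN : ThreeForm 3 N} {x : M} {y : N}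
  {D : TangentSpace (𝓡 3) x →L[ℝ] TangentSpace (𝓡 3) y}
  {F : TangentSpace (𝓡 3) x → TangentSpace (𝓡 3) x → ℝ} {m : TangentSpace (𝓡 3) y}

set_option maxHeartbeats 1000000 in
/-- At each point, either `D` maps into the line spanned by `m`, or it is bijective and determines
the metric of the source and the two-form. -/
theorem BPSRel.cases (h : BPSRel gM VM gN VN x y D F m) (hF : IsTwoForm F)
    (hVM : IsVolumeForm gM VM) {b : Fin 3 → TangentSpace (𝓡 3) y} (hb : IsFrame gN VN y b) {c : ℝ}
    (hm : m = c • b 0) :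
    ((∀ v, ∃ l : ℝ, D v = l • b 0) ∧ ((∀ v w, F v w = 0) → ∀ v, D v = 0)) ∨
    ∃ δ : ℝ, 0 < δ ∧ Function.Bijective D ∧
      (∀ u v, gM.inner x u v = gN.inner y (b 0) (D u) * gN.inner y (b 0) (D v) +
        (gN.inner y (b 1) (D u) * gN.inner y (b 1) (D v) +
          gN.inner y (b 2) (D u) * gN.inner y (b 2) (D v)) / δ) ∧
      (∀ u v, 3 * c * F u v = (1 - δ) / δ * (gN.inner y (b 1) (D u) * gN.inner y (b 2) (D v) -
        gN.inner y (b 2) (D u) * gN.inner y (b 1) (D v))) ∧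
      ∀ u v w, VN y ![D u, D v, D w] = δ * VM x ![u, v, w] := by
  obtain ⟨a, ha⟩ := exists_isFrame hVM x
  have hrel : ∀ v w i, gN.inner y (b i) (D (Sig gM VM x v w)) =
      gN.inner y (b i) (Sig gN VN y (D v) (D w)) + 3 * F v w * gN.inner y (b i) m := by
    intro v w i
    have h1 := congrArg (gN.inner y (b i)) (sub_eq_zero.1 (h v w))
    simp only [map_add, map_smul, smul_eq_mul] at h1
    rw [h1]; ring
  have hm0 : gN.inner y (b 0) m = c := by simp [hm, hb.inner_eq]
  have hm1 : gN.inner y (b 1) m = 0 := by simp [hm, hb.inner_eq]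
  have hm2 : gN.inner y (b 2) m = 0 := by simp [hm, hb.inner_eq]
  have hDv : ∀ i v, gN.inner y (b i) (D v) = gN.inner y (b i) (D (a 0)) * gM.inner x (a 0) v +
      gN.inner y (b i) (D (a 1)) * gM.inner x (a 1) v +
      gN.inner y (b i) (D (a 2)) * gM.inner x (a 2) v := by
    intro i v
    conv_lhs => rw [ha.expand v]
    simp only [map_add, map_smul, smul_eq_mul]
    ring
  have hFv : ∀ u v, F u v = F (a 1) (a 2) * (gM.inner x (a 1) u * gM.inner x (a 2) v -
        gM.inner x (a 2) u * gM.inner x (a 1) v) +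
      F (a 2) (a 0) * (gM.inner x (a 2) u * gM.inner x (a 0) v -
        gM.inner x (a 0) u * gM.inner x (a 2) v) +
      F (a 0) (a 1) * (gM.inner x (a 0) u * gM.inner x (a 1) v -
        gM.inner x (a 1) u * gM.inner x (a 0) v) := by
    intro u v
    conv_lhs => rw [ha.expand u, ha.expand v]
    exact hF.expand a _ _ _ _ _ _
  have e0 := fun i => hrel (a 1) (a 2) i
  have e1 := fun i => hrel (a 2) (a 0) i
  have e2 := fun i => hrel (a 0) (a 1) i
  simp only [ha.sig_one_two] at e0
  simp only [ha.sig_two_zero] at e1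
  simp only [ha.sig_zero_one] at e2
  have p0 := e0 0
  have p1 := e1 0
  have p2 := e2 0
  have q0 := e0 1
  have q1 := e1 1
  have q2 := e2 1
  have r0 := e0 2
  have r1 := e1 2
  have r2 := e2 2
  rw [hb.sig_coord_zero, hm0] at p0 p1 p2
  rw [hb.sig_coord_one, hm1] at q0 q1 q2
  rw [hb.sig_coord_two, hm2] at r0 r1 r2
  -- `P`, `Q`, `R` are the rows of `D` in the frames `a` and `b`. Because `m` is a multiple of `b
  -- 0`, only the row `P` feels the two-form.
  generalize hP0 : gN.inner y (b 0) (D (a 0)) = P0 at *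
  generalize hP1 : gN.inner y (b 0) (D (a 1)) = P1 at *
  generalize hP2 : gN.inner y (b 0) (D (a 2)) = P2 at *
  generalize hQ0 : gN.inner y (b 1) (D (a 0)) = Q0 at *
  generalize hQ1 : gN.inner y (b 1) (D (a 1)) = Q1 at *
  generalize hQ2 : gN.inner y (b 1) (D (a 2)) = Q2 at *
  generalize hR0 : gN.inner y (b 2) (D (a 0)) = R0 at *
  generalize hR1 : gN.inner y (b 2) (D (a 1)) = R1 at *
  generalize hR2 : gN.inner y (b 2) (D (a 2)) = R2 at *
  rcases cofactor_dichotomy (p0 := P0) (p1 := P1) (p2 := P2) (q0 := Q0) (q1 := Q1) (q2 := Q2)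
    (r0 := R0) (r1 := R1) (r2 := R2) (k0 := 3 * F (a 1) (a 2) * c) (k1 := 3 * F (a 2) (a 0) * c)
    (k2 := 3 * F (a 0) (a 1) * c) (by linarith) (by linarith) (by linarith) (by linarith)
    (by linarith) (by linarith) (by linarith) (by linarith) (by linarith) with
    ⟨z1, z2, z3, z4, z5, z6, k0, k1, k2⟩ | ⟨δ, hδ, hpp, hqq, hrr, hpq, hpr, hqr, k0, k1, k2⟩
  · left
    have hD : ∀ v, D v = gN.inner y (b 0) (D v) • b 0 := by
      intro v
      conv_lhs => rw [hb.expand (D v)]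
      have h1 := hDv 1 v
      have h2 := hDv 2 v
      rw [hQ0, hQ1, hQ2, z1, z2, z3] at h1
      rw [hR0, hR1, hR2, z4, z5, z6] at h2
      rw [h1, h2]; simp
    refine ⟨fun v => ⟨_, hD v⟩, fun hF0 v => ?_⟩
    have h0 := hDv 0 v
    rw [hP0, hP1, hP2, k0, k1, k2, hF0, hF0, hF0] at h0
    rw [hD v, h0]; simp
  · right
    have hcol := columns_of_rows hδ.ne' hpp hqq hrr hpq hpr hqr
    have hd0 : ∀ v, gN.inner y (b 0) (D v) = P0 * gM.inner x (a 0) v + P1 * gM.inner x (a 1) v +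
      P2 * gM.inner x (a 2) v := fun v => by rw [hDv 0 v, hP0, hP1, hP2]
    have hd1 : ∀ v, gN.inner y (b 1) (D v) = Q0 * gM.inner x (a 0) v + Q1 * gM.inner x (a 1) v +
      Q2 * gM.inner x (a 2) v := fun v => by rw [hDv 1 v, hQ0, hQ1, hQ2]
    have hd2 : ∀ v, gN.inner y (b 2) (D v) = R0 * gM.inner x (a 0) v + R1 * gM.inner x (a 1) v +
      R2 * gM.inner x (a 2) v := fun v => by rw [hDv 2 v, hR0, hR1, hR2]
    obtain ⟨⟨c00, c11, c22⟩, c01, c02, c12⟩ := hcol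
    have hmet : ∀ u v, gM.inner x u v = gN.inner y (b 0) (D u) * gN.inner y (b 0) (D v) +
        (gN.inner y (b 1) (D u) * gN.inner y (b 1) (D v) +
          gN.inner y (b 2) (D u) * gN.inner y (b 2) (D v)) / δ := by
      intro u v
      rw [ha.inner_coord, hd0, hd0, hd1, hd1, hd2, hd2]
      generalize gM.inner x (a 0) u = u0
      generalize gM.inner x (a 1) u = u1
      generalize gM.inner x (a 2) u = u2
      generalize gM.inner x (a 0) v = v0
      generalize gM.inner x (a 1) v = v1
      generalize gM.inner x (a 2) v = v2
      linear_combination -(u0 * v0) * c00 - u1 * v1 * c11 - u2 * v2 * c22 -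
        (u0 * v1 + u1 * v0) * c01 - (u0 * v2 + u2 * v0) * c02 - (u1 * v2 + u2 * v1) * c12
    have hinj : Function.Injective D := by
      rw [injective_iff_map_eq_zero]
      intro v hv
      by_contra hne
      have h1 := gM.pos x v hne
      rw [hmet, hv] at h1
      simp at h1
    have hbij : Function.Bijective D := by
      refine ⟨hinj, ?_⟩
      have := LinearMap.injective_iff_surjective_of_finrank_eq_finrank
        (f := (D : TangentSpace (𝓡 3) x →ₗ[ℝ] TangentSpace (𝓡 3) y))
        (by rw [finrank_tangent, finrank_tangent])
      exact this.1 hinj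
    -- `q × r = p - k` and `k = (1 - δ) p`. This identifies the pullback of `b₁ ∧ b₂` with `δ` times
    -- the Hodge dual of `p`, and hence `F` with a multiple of that pullback.
    have x0 : Q1 * R2 - Q2 * R1 = δ * P0 := by linarith
    have x1 : Q2 * R0 - Q0 * R2 = δ * P1 := by linarith
    have x2 : Q0 * R1 - Q1 * R0 = δ * P2 := by linarith
    refine ⟨δ, hδ, hbij, hmet, ?_, ?_⟩
    · intro u v
      rw [hFv, hd1, hd1, hd2, hd2]
      have hne := hδ.ne'
      generalize gM.inner x (a 0) u = u0
      generalize gM.inner x (a 1) u = u1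
      generalize gM.inner x (a 2) u = u2
      generalize gM.inner x (a 0) v = v0
      generalize gM.inner x (a 1) v = v1
      generalize gM.inner x (a 2) v = v2
      rw [div_mul_eq_mul_div, eq_div_iff hne]
      linear_combination δ * (u1 * v2 - u2 * v1) * k0 + δ * (u2 * v0 - u0 * v2) * k1 +
        δ * (u0 * v1 - u1 * v0) * k2 - (1 - δ) * (u1 * v2 - u2 * v1) * x0 -
        (1 - δ) * (u2 * v0 - u0 * v2) * x1 - (1 - δ) * (u0 * v1 - u1 * v0) * x2
    · intro u v w
      rw [hb.vol_coord, ha.vol_coord, hd0, hd0, hd0, hd1, hd1, hd1, hd2, hd2, hd2]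
      have hdet : P0 * (Q1 * R2 - Q2 * R1) + P1 * (Q2 * R0 - Q0 * R2) +
          P2 * (Q0 * R1 - Q1 * R0) = δ := by
        rw [x0, x1, x2]; linear_combination δ * hpp
      rw [← hdet]
      ring

/-- The converse of `BPSRel.cases`. -/
theorem bpsRel_of_metric (hVM : IsVolumeForm gM VM) {b : Fin 3 → TangentSpace (𝓡 3) y}
    (hb : IsFrame gN VN y b) {c κ : ℝ} (hm : m = c • b 0) (hD : Function.Bijective D)
    (hmet : ∀ u v, gM.inner x u v = gN.inner y (b 0) (D u) * gN.inner y (b 0) (D v) +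
        κ * (gN.inner y (b 1) (D u) * gN.inner y (b 1) (D v) +
          gN.inner y (b 2) (D u) * gN.inner y (b 2) (D v)))
    (hF : ∀ u v, 3 * c * F u v = (κ - 1) * (gN.inner y (b 1) (D u) * gN.inner y (b 2) (D v) -
        gN.inner y (b 2) (D u) * gN.inner y (b 1) (D v)))
    (hor : ∀ u : Fin 3 → TangentSpace (𝓡 3) x, 0 < VM x u → 0 < VN y (fun i => D (u i))) :
    BPSRel gM VM gN VN x y D F m := by
  obtain ⟨u0, hu0⟩ := hD.2 (b 0)
  obtain ⟨u1, hu1⟩ := hD.2 (b 1)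
  obtain ⟨u2, hu2⟩ := hD.2 (b 2)
  -- The sign of `κ` is not assumed: it is the squared length, in the metric of the source, of the
  -- preimage of `b 1`.
  have hκ : 0 < κ := by
    have hne : u1 ≠ 0 := by
      rintro rfl
      have := hb.inner_eq 1 1
      rw [← hu1] at this
      simp at this
    have := gM.pos x u1 hne
    rw [hmet, hu1] at this
    simpa [hb.inner_eq] using this
  obtain ⟨s, hs, hsκ⟩ : ∃ s : ℝ, 0 < s ∧ s * s = κ :=
    ⟨Real.sqrt κ, Real.sqrt_pos.2 hκ, Real.mul_self_sqrt hκ.le⟩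
  -- The preimages of the frame `b`, rescaled by `κ^{-1/2}` in the last two directions, are
  -- orthonormal for `gM`. In these frames `D` is diagonal with entries `1, s⁻¹, s⁻¹`.
  set a : Fin 3 → TangentSpace (𝓡 3) x := ![u0, s⁻¹ • u1, s⁻¹ • u2] with ha_def
  have horth : ∀ i j, gM.inner x (a i) (a j) = if i = j then 1 else 0 := by
    intro i j
    have hss : s⁻¹ * (s⁻¹ * κ) = 1 := by rw [← hsκ]; field_simp
    fin_cases i <;> fin_cases j <;> simp [ha_def, hmet, hu0, hu1, hu2, hb.inner_eq, hss]
  have ha : IsFrame gM VM x a := by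
    refine ⟨horth, ?_⟩
    rcases abs_eq (zero_le_one' ℝ) |>.1 (hVM.unit x a horth) with h | h
    · exact h
    -- If `a` were negatively oriented, exchanging its first two vectors would give a positive
    -- triple whose image under `D` is negative, since that image is a rescaling of `b` with two
    -- vectors exchanged.
    · exfalso
      have h1 : VM x ![s⁻¹ • u1, u0, s⁻¹ • u2] = 1 := by
        have h2 := (VM x).toAlternatingMap.map_swap a (show (0 : Fin 3) ≠ 1 by decide)
        have h3 : a ∘ Equiv.swap (0 : Fin 3) 1 = ![s⁻¹ • u1, u0, s⁻¹ • u2] := by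
          funext i; fin_cases i <;> simp [ha_def, Equiv.swap_apply_def]
        rw [h3] at h2
        exact h2.trans (neg_eq_iff_eq_neg.2 h)
      have h4 := hor ![s⁻¹ • u1, u0, s⁻¹ • u2] (by rw [h1]; exact one_pos)
      have h5 : (fun i => D (![s⁻¹ • u1, u0, s⁻¹ • u2] i)) =
          ![s⁻¹ • b 1, b 0, s⁻¹ • b 2] := by
        funext i; fin_cases i <;> simp [hu0, hu1, hu2]
      rw [h5, hb.vol_coord] at h4
      simp [hb.inner_eq] at h4
      have : 0 < s⁻¹ * s⁻¹ := by positivity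
      linarith
  have hc0 : ∀ v, gM.inner x (a 0) v = gN.inner y (b 0) (D v) := by
    intro v; simp [ha_def, hmet, hu0, hb.inner_eq]
  have hc1 : ∀ v, gM.inner x (a 1) v = s * gN.inner y (b 1) (D v) := by
    intro v
    simp [ha_def, hmet, hu1, hb.inner_eq, ← hsκ]
    field_simp
  have hc2 : ∀ v, gM.inner x (a 2) v = s * gN.inner y (b 2) (D v) := by
    intro v
    simp [ha_def, hmet, hu2, hb.inner_eq, ← hsκ]
    field_simp
  intro v w
  rw [sub_eq_zero]
  refine hb.ext fun i => ?_
  have hi : i = 0 ∨ i = 1 ∨ i = 2 := by fin_cases i <;> simp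
  rcases hi with rfl | rfl | rfl
  · rw [← hc0, ha.sig_coord_zero, hc1, hc1, hc2, hc2, map_add, hb.sig_coord_zero, hm]
    simp only [map_smul, smul_eq_mul, hb.inner_eq, if_true]
    linear_combination (gN.inner y (b 1) (D v) * gN.inner y (b 2) (D w) -
        gN.inner y (b 2) (D v) * gN.inner y (b 1) (D w)) * hsκ - hF v w
  · have h1 := hc1 (Sig gM VM x v w)
    rw [ha.sig_coord_one, hc0, hc0, hc2, hc2] at h1
    rw [map_add, hb.sig_coord_one, hm]
    simp only [map_smul, smul_eq_mul, hb.inner_eq]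
    refine mul_left_cancel₀ hs.ne' (h1.symm.trans ?_)
    simp
    ring
  · have h1 := hc2 (Sig gM VM x v w)
    rw [ha.sig_coord_two, hc0, hc0, hc1, hc1] at h1
    rw [map_add, hb.sig_coord_two, hm]
    simp only [map_smul, smul_eq_mul, hb.inner_eq]
    refine mul_left_cancel₀ hs.ne' (h1.symm.trans ?_)
    simp
    ring

end Pointwise

end

section

open Set Filter Topology Module

/-! ### Comparison of the algebraic form of the equation with the metric `solutionMetric`. -/

section SolutionMetric

variable {N : Type*} [TopologicalSpace N] [ChartedSpace (EuclideanSpace ℝ (Fin 3)) N]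
  [IsManifold (𝓡 3) ∞ N]

theorem inner_muSharp (g : Metric N) (μ : OneForm 3 N) (y : N) (v : TangentSpace (𝓡 3) y) :
    g.inner y (muSharp g μ y) v = μ y v := inner_sharp g y _ v

theorem hodgeThree_wedge {g : Metric N} {V : ThreeForm 3 N} {y : N}
    {b : Fin 3 → TangentSpace (𝓡 3) y} (hb : IsFrame g V y b)
    {β : TangentSpace (𝓡 3) y → TangentSpace (𝓡 3) y → ℝ} {η : TangentSpace (𝓡 3) y → ℝ} {c d : ℝ}
    (hβ : ∀ u v, β u v = d * (g.inner y (b 1) u * g.inner y (b 2) v -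
      g.inner y (b 2) u * g.inner y (b 1) v)) (hη : ∀ u, η u = c * g.inner y (b 0) u) :
    hodgeThree V y (wedgeTwoOne β η) = c * d := by
  rw [hodgeThree, div_eq_iff hb.vol_coordVec_ne_zero, hb.vol_coord]
  simp only [wedgeTwoOne, hβ, hη]
  ring

variable [MulAction Circle N]
  {M : Type*} [TopologicalSpace M] [ChartedSpace (EuclideanSpace ℝ (Fin 3)) M]
  [IsManifold (𝓡 3) ∞ M]
  {gM : Metric M} {VM : ThreeForm 3 M} {gN : Metric N} {VN : ThreeForm 3 N} {x : M} {y : N}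
  {μ B : OneForm 3 N}
  {T D : TangentSpace (𝓡 3) x →L[ℝ] TangentSpace (𝓡 3) y}
  {F : TangentSpace (𝓡 3) x → TangentSpace (𝓡 3) x → ℝ}

/-- The coordinates of `covId B` in a frame adapted to `muSharp` and `nu`. -/
theorem covId_coord {b : Fin 3 → TangentSpace (𝓡 3) y} (hb : IsFrame gN VN y b) {c ρ : ℝ}
    (hc : c ≠ 0) (hρ : ρ ≠ 0) (hm : muSharp gN μ y = c • b 0) (hn : nu y = ρ • b 1)
    (hBn : B y (nu y) = 0) (hBm : B y (muSharp gN μ y) = 0) (v : TangentSpace (𝓡 3) y) :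
    gN.inner y (b 0) (covId B y v) = gN.inner y (b 0) v ∧
    gN.inner y (b 1) (covId B y v) =
      gN.inner y (b 1) v - ρ * B y (b 2) * gN.inner y (b 2) v ∧
    gN.inner y (b 2) (covId B y v) = gN.inner y (b 2) v := by
  have h0 : B y (b 0) = 0 := by
    rw [hm, map_smul, smul_eq_mul] at hBm
    exact (mul_eq_zero.1 hBm).resolve_left hc
  have h1 : B y (b 1) = 0 := by
    rw [hn, map_smul, smul_eq_mul] at hBn
    exact (mul_eq_zero.1 hBn).resolve_left hρ
  have hBv : B y v = B y (b 2) * gN.inner y (b 2) v := by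
    conv_lhs => rw [hb.expand v]
    simp only [map_add, map_smul, smul_eq_mul, h0, h1]
    ring
  simp only [covId, hn, hBv, map_sub, map_smul, smul_eq_mul, hb.inner_eq]
  refine ⟨?_, ?_, ?_⟩ <;> (simp; try ring)

/-- In an adapted frame `μ = c b⁰`, hence `g_μ = (b⁰)²`. Since `ι_{μ♯} dB = 0`, the curvature is a
multiple of `b¹ ∧ b²`, and so `⋆(dB ∧ μ)` is `c` times its coefficient. -/
theorem solutionMetric_coord {b : Fin 3 → TangentSpace (𝓡 3) y} (hb : IsFrame gN VN y b) {c : ℝ}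
    (hc : c ≠ 0) (hm : muSharp gN μ y = c • b 0)
    (hB0 : ∀ v, gN.inner y (b 0) (covId B y v) = gN.inner y (b 0) v)
    (hβ : ∀ v, extD B y (muSharp gN μ y) v = 0) (u v : TangentSpace (𝓡 3) y) :
    solutionMetric gN VN μ B y u v =
      gN.inner y (b 0) (covId B y u) * gN.inner y (b 0) (covId B y v) +
      (1 + 3 * c * extD B y (b 1) (b 2)) *
        (gN.inner y (b 1) (covId B y u) * gN.inner y (b 1) (covId B y v) +
          gN.inner y (b 2) (covId B y u) * gN.inner y (b 2) (covId B y v)) ∧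
    extD B y u v = extD B y (b 1) (b 2) * (gN.inner y (b 1) u * gN.inner y (b 2) v -
      gN.inner y (b 2) u * gN.inner y (b 1) v) := by
  have hF := isTwoForm_extD B y
  have hμ : ∀ w, μ y w = c * gN.inner y (b 0) w := by
    intro w
    rw [← inner_muSharp gN μ, hm]; simp
  have h0 : ∀ w, extD B y (b 0) w = 0 := by
    intro w
    have := hβ w
    rw [hm, hF.smul_left] at this
    exact (mul_eq_zero.1 this).resolve_left hc
  have hβ' : ∀ u v, extD B y u v = extD B y (b 1) (b 2) * (gN.inner y (b 1) u * gN.inner y (b 2) v -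
      gN.inner y (b 2) u * gN.inner y (b 1) v) := by
    intro u v
    conv_lhs => rw [hb.expand u, hb.expand v]
    refine (hF.expand b _ _ _ _ _ _).trans ?_
    rw [h0, hF.swap (b 2) (b 0), h0]
    ring
  refine ⟨?_, hβ' u v⟩
  have hh : hodgeThree VN y (wedgeTwoOne (extD B y) (μ y)) = c * extD B y (b 1) (b 2) :=
    hodgeThree_wedge hb hβ' hμ
  have hg : ∀ u v, gMu gN μ y u v = gN.inner y (b 0) u * gN.inner y (b 0) v := by
    intro u v
    rw [gMu, hμ, hμ, hμ, hm]
    simp only [map_smul, smul_eq_mul, hb.inner_eq, if_true]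
    field_simp
  rw [solutionMetric, hh, hg, hb.inner_coord (covId B y u), hB0, hB0]
  ring

/-- A form that kills `ν` and `μ♯` is a multiple of `b²`, so `covId B` is a shear along `b 1` and
has determinant one. This lets orientation statements pass between `de` and the covariant
differential. -/
theorem vol_covId {b : Fin 3 → TangentSpace (𝓡 3) y} (hb : IsFrame gN VN y b) {c ρ : ℝ}
    (hc : c ≠ 0) (hρ : ρ ≠ 0) (hm : muSharp gN μ y = c • b 0) (hn : nu y = ρ • b 1)
    (hBn : B y (nu y) = 0) (hBm : B y (muSharp gN μ y) = 0) (u v w : TangentSpace (𝓡 3) y) :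
    VN y ![covId B y u, covId B y v, covId B y w] = VN y ![u, v, w] := by
  rw [hb.vol_coord, hb.vol_coord]
  simp only [covId_coord hb hc hρ hm hn hBn hBm]
  ring

theorem exists_frame_of_linearIndependent (hVN : IsVolumeForm gN VN) (hμn : μ y (nu y) = 0)
    (hind : LinearIndependent ℝ ![nu y, muSharp gN μ y]) :
    ∃ (b : Fin 3 → TangentSpace (𝓡 3) y) (c ρ : ℝ), IsFrame gN VN y b ∧
      muSharp gN μ y = c • b 0 ∧ nu y = ρ • b 1 ∧ 0 < ρ ∧ 0 < c := by
  have hn : nu y ≠ 0 := hind.ne_zero 0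
  have hm : muSharp gN μ y ≠ 0 := hind.ne_zero 1
  obtain ⟨b, c, ρ, h1, h2, h3, h4, h5⟩ := exists_adapted_frame hVN (m := muSharp gN μ y) hn
    (by rw [inner_muSharp]; exact hμn)
  exact ⟨b, c, ρ, h1, h2, h3, h4, h5 hm⟩

theorem vec3_eq {E : Type*} (f : Fin 3 → E) : f = ![f 0, f 1, f 2] := by
  funext i; fin_cases i <;> rfl

/-- The two-form of a regular solution annihilates the preimage of `muSharp`. -/
theorem BPSRel.twoForm_eq_zero {m n : TangentSpace (𝓡 3) y}
    (h : BPSRel gM VM gN VN x y D F m) (hF : IsTwoForm F) (hVM : IsVolumeForm gM VM)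
    (hVN : IsVolumeForm gN VN) (hm0 : m ≠ 0) (hn0 : n ≠ 0) (hmn : gN.inner y m n = 0)
    (hD : Function.Surjective D) {u : TangentSpace (𝓡 3) x} (hu : D u = m)
    (v : TangentSpace (𝓡 3) x) : F u v = 0 := by
  obtain ⟨b, c, ρ, hb, hm, hn, hρ, hc⟩ := exists_adapted_frame hVN hn0 hmn
  have hc := hc hm0
  rcases h.cases hF hVM hb hm with ⟨h1, -⟩ | ⟨δ, hδ, hbij, hmet, hF', hvol⟩
  · obtain ⟨w, hw⟩ := hD (b 1)
    obtain ⟨l, hl⟩ := h1 w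
    have := congrArg (gN.inner y (b 1)) (hw.symm.trans hl)
    simp [hb.inner_eq] at this
  · have h2 := hF' u v
    rw [hu, hm] at h2
    simp only [map_smul, smul_eq_mul, hb.inner_eq] at h2
    simp at h2
    exact h2.resolve_left hc.ne'

/-- Here `T` stands for the differential of the field read as a diffeomorphism, and `D` for its
covariant differential. The alternative `δ > 0` of `BPSRel.cases` is the asserted metric once `1/δ`
is recognised as `1 + 3⋆(dB ∧ μ)`. -/
theorem solutionMetric_of_bpsRel (hVM : IsVolumeForm gM VM) (hVN : IsVolumeForm gN VN)
    (hμn : μ y (nu y) = 0) (hind : LinearIndependent ℝ ![nu y, muSharp gN μ y])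
    (hT : Function.Bijective T) (hDT : ∀ v, D v = covId B y (T v)) (hBn : B y (nu y) = 0)
    (hBm : B y (muSharp gN μ y) = 0) (hF : ∀ u v, F u v = extD B y (T u) (T v))
    (hF2 : IsTwoForm F)
    (h : BPSRel gM VM gN VN x y D F (muSharp gN μ y)) (hD : Function.Bijective D) :
    (∀ u v, gM.inner x u v = solutionMetric gN VN μ B y (T u) (T v)) ∧
    (∀ v, extD B y (muSharp gN μ y) v = 0) ∧
    ∀ u : Fin 3 → TangentSpace (𝓡 3) x, 0 < VM x u → 0 < VN y (fun i => T (u i)) := by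
  obtain ⟨b, c, ρ, hb, hm, hn, hρ, hc⟩ := exists_frame_of_linearIndependent hVN hμn hind
  have hDu := hD.2
  have hext : ∀ v, extD B y (muSharp gN μ y) v = 0 := by
    intro v
    obtain ⟨u, hu⟩ := hD.2 (muSharp gN μ y)
    obtain ⟨w, rfl⟩ := hT.2 v
    -- `T u` and `muSharp` differ by `B (T u) • nu`. Applying `B`, which kills both fields, shows
    -- that the coefficient vanishes.
    have hTu : T u = muSharp gN μ y := by
      have h1 : T u = muSharp gN μ y + B y (T u) • nu y := by
        rw [← hu, hDT, covId]; abel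
      have h2 : B y (T u) = 0 := by
        have := congrArg (B y) h1
        simpa [hBm, hBn] using this
      rw [h1, h2]; simp
    rw [← hTu, ← hF]
    exact h.twoForm_eq_zero hF2 hVM hVN (hind.ne_zero 1) (hind.ne_zero 0)
      (by rw [inner_muSharp]; exact hμn) hD.2 hu w
  have hcov := fun v => covId_coord (B := B) hb hc.ne' hρ.ne' hm hn hBn hBm v
  have hsol := solutionMetric_coord (B := B) hb hc.ne' hm (fun v => (hcov v).1) hext
  rcases h.cases hF2 hVM hb hm with ⟨h1, -⟩ | ⟨δ, hδ, hbij, hmet, hF', hvol⟩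
  · obtain ⟨w, hw⟩ := hD.2 (b 1)
    obtain ⟨l, hl⟩ := h1 w
    have := congrArg (gN.inner y (b 1)) (hw.symm.trans hl)
    simp [hb.inner_eq] at this
  -- The formula for `F` is evaluated on the preimages of `b 1` and `b 2`, where it reads `3c dB(b₁,
  -- b₂) = (1 - δ)/δ`; the shear `covId` does not change this value.
  · have hκ : 1 + 3 * c * extD B y (b 1) (b 2) = 1 / δ := by
      obtain ⟨u1, hu1⟩ := hD.2 (b 1)
      obtain ⟨u2, hu2⟩ := hD.2 (b 2)
      have h1 := hF' u1 u2
      rw [hF, (hsol (T u1) (T u2)).2] at h1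
      have h2 := hcov (T u1)
      have h3 := hcov (T u2)
      rw [← hDT, hu1] at h2
      rw [← hDT, hu2] at h3
      rw [hu1, hu2] at h1
      simp only [hb.inner_eq] at h1 h2 h3
      simp at h1 h2 h3
      rw [← h2.2.2, ← h3.2.2] at h1
      rw [← h2.2.2] at h2
      have h4 : gN.inner y (b 1) (T u1) = 1 := by linarith [h2.2.1]
      rw [h4] at h1
      field_simp at h1 ⊢
      linarith
    refine ⟨fun u v => ?_, hext, fun u hu => ?_⟩
    · rw [hmet, (hsol (T u) (T v)).1, hκ, ← hDT, ← hDT]; ring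
    · rw [vec3_eq (fun i => T (u i)), ← vol_covId (B := B) hb hc.ne' hρ.ne' hm hn hBn hBm,
        ← hDT, ← hDT, ← hDT, hvol, ← vec3_eq u]
      positivity

/-- `bpsRel_of_metric` applies with `κ = 1 + 3⋆(dB ∧ μ)`. Bijectivity of `D` comes from that of `T`:
a vector with `T v = B(T v) ν` has `B(T v) = 0`, because `B(ν) = 0`. -/
theorem bpsRel_of_solutionMetric (hVM : IsVolumeForm gM VM) (hVN : IsVolumeForm gN VN)
    (hμn : μ y (nu y) = 0) (hind : LinearIndependent ℝ ![nu y, muSharp gN μ y])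
    (hT : Function.Bijective T) (hDT : ∀ v, D v = covId B y (T v)) (hBn : B y (nu y) = 0)
    (hBm : B y (muSharp gN μ y) = 0) (hF : ∀ u v, F u v = extD B y (T u) (T v))
    (hext : ∀ v, extD B y (muSharp gN μ y) v = 0)
    (hmet : ∀ u v, gM.inner x u v = solutionMetric gN VN μ B y (T u) (T v))
    (hor : ∀ u : Fin 3 → TangentSpace (𝓡 3) x, 0 < VM x u → 0 < VN y (fun i => T (u i))) :
    BPSRel gM VM gN VN x y D F (muSharp gN μ y) := by
  obtain ⟨b, c, ρ, hb, hm, hn, hρ, hc⟩ := exists_frame_of_linearIndependent hVN hμn hind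
  have hcov := fun v => covId_coord (B := B) hb hc.ne' hρ.ne' hm hn hBn hBm v
  have hsol := solutionMetric_coord (B := B) hb hc.ne' hm (fun v => (hcov v).1) hext
  have hinj : Function.Injective D := by
    rw [injective_iff_map_eq_zero]
    intro v hv
    have h1 : T v = B y (T v) • nu y := by
      rw [hDT, covId, sub_eq_zero] at hv; exact hv
    have h2 : B y (T v) = 0 := by
      have := congrArg (B y) h1
      simpa [hBn] using this
    rw [h2, zero_smul] at h1
    exact (injective_iff_map_eq_zero T).1 hT.1 v h1
  have hbij : Function.Bijective D := by
    refine ⟨hinj, ?_⟩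
    have := LinearMap.injective_iff_surjective_of_finrank_eq_finrank
      (f := (D : TangentSpace (𝓡 3) x →ₗ[ℝ] TangentSpace (𝓡 3) y))
      (by rw [finrank_tangent, finrank_tangent])
    exact this.1 hinj
  refine bpsRel_of_metric hVM hb (κ := 1 + 3 * c * extD B y (b 1) (b 2)) hm hbij ?_ ?_ ?_
  · intro u v
    rw [hmet, (hsol _ _).1, hDT, hDT]
  · intro u v
    have h1 := hcov (T u)
    have h2 := hcov (T v)
    rw [hF, (hsol _ _).2, hDT, hDT, h1.2.1, h1.2.2, h2.2.1, h2.2.2]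
    ring
  · intro u hu
    have h1 := hor u hu
    rw [vec3_eq (fun i => T (u i)), ← vol_covId (B := B) hb hc.ne' hρ.ne' hm hn hBn hBm,
        ← hDT, ← hDT, ← hDT] at h1
    rw [vec3_eq (fun i => D (u i))]
    exact h1

end SolutionMetric

end

section

open Set Filter Topology Module

/-! ### Smoothness of the fields `nu`, `muSharp` and of the form `thetaForm`. -/

section SmoothFields

variable {n : ℕ} {X : Type*} [TopologicalSpace X] [ChartedSpace (EuclideanSpace ℝ (Fin n)) X]
  [IsManifold (𝓡 n) ∞ X]

/-- A vector field is smooth: its components in every chart are. -/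
def VecField.Smooth (Z : VecField n X) : Prop :=
  ∀ x₀ : X, ContDiffOn ℝ ∞ (Z.inChart x₀) (extChartAt (𝓡 n) x₀).target

theorem VecField.Smooth.contDiffAt {Z : VecField n X} (hZ : Z.Smooth) {x₀ : X}
    {z : EuclideanSpace ℝ (Fin n)} (hz : z ∈ (extChartAt (𝓡 n) x₀).target) :
    ContDiffAt ℝ ∞ (Z.inChart x₀) z :=
  (hZ x₀).contDiffAt ((isOpen_extChartAt_target x₀).mem_nhds hz)

theorem VecField.inChart_chart (Z : VecField n X) {x₀ x : X}
    (hx : x ∈ (extChartAt (𝓡 n) x₀).source) :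
    Z.inChart x₀ (extChartAt (𝓡 n) x₀ x) =
      mfderiv (𝓡 n) 𝓘(ℝ, EuclideanSpace ℝ (Fin n)) (extChartAt (𝓡 n) x₀) x (Z x) := by
  have key : ∀ y, y = x →
      (mfderiv (𝓡 n) 𝓘(ℝ, EuclideanSpace ℝ (Fin n)) (extChartAt (𝓡 n) x₀) y (Z y) :
        EuclideanSpace ℝ (Fin n)) =
      mfderiv (𝓡 n) 𝓘(ℝ, EuclideanSpace ℝ (Fin n)) (extChartAt (𝓡 n) x₀) x (Z x) := by
    rintro y rfl; rfl
  exact key _ ((extChartAt (𝓡 n) x₀).left_inv hx)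

theorem coordFrame_inChart (Z : VecField n X) {x₀ : X} {z : EuclideanSpace ℝ (Fin n)}
    (hz : z ∈ (extChartAt (𝓡 n) x₀).target) :
    coordFrame x₀ z (Z.inChart x₀ z) = Z ((extChartAt (𝓡 n) x₀).symm z) :=
  congrArg (fun T => T (Z ((extChartAt (𝓡 n) x₀).symm z))) (coordFrame_comp_mfderiv_chart hz)

theorem VecField.Smooth.isOpen_ne_zero {Z : VecField n X} (hZ : Z.Smooth) :
    IsOpen {x | Z x ≠ 0} := by
  rw [isOpen_iff_mem_nhds]
  intro x hx
  have h1 : ContinuousAt (fun y => Z.inChart x (extChartAt (𝓡 n) x y)) x :=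
    ContinuousAt.comp (g := Z.inChart x) (hZ.contDiffAt (mem_extChartAt_target x)).continuousAt
      (continuousAt_extChartAt x)
  have h2 : Z.inChart x (extChartAt (𝓡 n) x x) ≠ 0 := by
    intro h
    exact hx ((GaugedSkyrme.inChart_self Z x).symm.trans h)
  filter_upwards [h1.eventually_ne h2, (isOpen_extChartAt_source (I := 𝓡 n) x).mem_nhds
    (mem_extChartAt_source x)] with y hy hy'
  intro h
  refine hy ?_
  rw [Z.inChart_chart hy', h]
  exact map_zero _

/-- The generator of a smooth flow is smooth. -/
theorem smooth_generator {ψ : ℝ × X → X} (hψ : ContMDiff (𝓘(ℝ, ℝ).prod (𝓡 n)) (𝓡 n) ∞ ψ)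
    (hψ0 : ∀ y, ψ (0, y) = y) {Z : VecField n X}
    (hZ : ∀ y, mfderiv 𝓘(ℝ, ℝ) (𝓡 n) (fun t => ψ (t, y)) 0 (1 : ℝ) = Z (ψ (0, y))) :
    Z.Smooth := by
  intro y
  set c := extChartAt (𝓡 n) y with hc
  set h : ℝ × EuclideanSpace ℝ (Fin n) → X := fun q => ψ (q.1, c.symm q.2) with hh
  set O₁ : Set (ℝ × EuclideanSpace ℝ (Fin n)) := univ ×ˢ c.target with hO₁
  have hO₁o : IsOpen O₁ := isOpen_univ.prod (isOpen_extChartAt_target y)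
  have hsm : ContMDiffOn 𝓘(ℝ, ℝ × EuclideanSpace ℝ (Fin n)) (𝓡 n) ∞ h O₁ := by
    have h1 : ContMDiffOn 𝓘(ℝ, ℝ × EuclideanSpace ℝ (Fin n)) (𝓡 n) ∞
        (fun q : ℝ × EuclideanSpace ℝ (Fin n) => c.symm q.2) O₁ :=
      (contMDiffOn_chart_symm y).comp (contDiff_snd.contMDiff.contMDiffOn) (fun q hq => hq.2)
    have h2 : ContMDiffOn 𝓘(ℝ, ℝ × EuclideanSpace ℝ (Fin n)) 𝓘(ℝ, ℝ) ∞
        (fun q : ℝ × EuclideanSpace ℝ (Fin n) => q.1) O₁ :=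
      contDiff_fst.contMDiff.contMDiffOn
    exact hψ.comp_contMDiffOn (h2.prodMk h1)
  set O := O₁ ∩ h ⁻¹' c.source with hO
  have hOo : IsOpen O :=
    hsm.continuousOn.isOpen_inter_preimage hO₁o (isOpen_extChartAt_source y)
  have hsm' := hsm.mono (inter_subset_left : O ⊆ O₁)
  have hk : ContDiffOn ℝ ∞ (fun q => c (h q)) O := contDiffOn_chart_comp (fun q hq => hq.2) hsm'
  have hk' : ContDiffOn ℝ ∞ (fderiv ℝ (fun q => c (h q))) O := hk.fderiv_of_isOpen hOo (by simp)
  have hmem : ∀ z ∈ c.target, ((0 : ℝ), z) ∈ O := by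
    intro z hz
    refine ⟨⟨mem_univ _, hz⟩, ?_⟩
    simp only [hh, mem_preimage, hψ0]
    exact c.map_target hz
  have h3 : ContDiffOn ℝ ∞ (fun z : EuclideanSpace ℝ (Fin n) =>
      fderiv ℝ (fun q => c (h q)) ((0 : ℝ), z) ((1 : ℝ), (0 : EuclideanSpace ℝ (Fin n))))
      c.target := by
    have h4 : ContDiffOn ℝ ∞ (fun z : EuclideanSpace ℝ (Fin n) =>
      fderiv ℝ (fun q => c (h q)) ((0 : ℝ), z)) c.target :=
      hk'.comp (contDiff_const.prodMk contDiff_id).contDiffOn hmem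
    exact h4.clm_apply contDiffOn_const
  refine h3.congr ?_
  intro z hz
  have hmd : MDifferentiableAt 𝓘(ℝ, ℝ × EuclideanSpace ℝ (Fin n)) (𝓡 n) h ((0 : ℝ), z) :=
    (hsm'.contMDiffAt (hOo.mem_nhds (hmem z hz))).mdifferentiableAt (by simp)
  rw [fderiv_chart_comp (hmem z hz).2 hmd]
  have e1 : HasFDerivAt (fun t : ℝ => (t, z)) (ContinuousLinearMap.inl ℝ ℝ _) (0 : ℝ) :=
    hasFDerivAt_prodMk_left 0 z
  have e2 := mfderiv_comp (I := 𝓘(ℝ, ℝ)) (I' := 𝓘(ℝ, ℝ × EuclideanSpace ℝ (Fin n)))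
    (I'' := 𝓡 n) (0 : ℝ) (f := fun t : ℝ => (t, z)) (g := h) hmd
    e1.differentiableAt.mdifferentiableAt
  rw [mfderiv_eq_fderiv, e1.fderiv] at e2
  have e3 : mfderiv 𝓘(ℝ, ℝ × EuclideanSpace ℝ (Fin n)) (𝓡 n) h ((0 : ℝ), z)
      ((1 : ℝ), (0 : EuclideanSpace ℝ (Fin n))) = Z (h (0, z)) := by
    rw [← hZ (c.symm z)]
    exact (congrArg (fun T => T (1 : ℝ)) e2).symm
  have key : ∀ y', y' = c.symm z →
      (mfderiv (𝓡 n) 𝓘(ℝ, EuclideanSpace ℝ (Fin n)) c y' (Z y') : EuclideanSpace ℝ (Fin n)) =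
        Z.inChart y z := by
    rintro y' rfl; rfl
  refine Eq.trans ?_ (congrArg (fun v => mfderiv (𝓡 n) 𝓘(ℝ, EuclideanSpace ℝ (Fin n)) c (h (0, z)) v)
    e3).symm
  exact (key _ (hψ0 _)).symm

end SmoothFields

section MetricSmooth

variable {X : Type*} [TopologicalSpace X] [ChartedSpace (EuclideanSpace ℝ (Fin 3)) X]
  [IsManifold (𝓡 3) ∞ X]

/-- The pullback of a bilinear form. -/
def bilinPullback {E : Type*} [NormedAddCommGroup E] [NormedSpace ℝ E] (B : E →L[ℝ] E →L[ℝ] ℝ)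
    (T : E →L[ℝ] E) : E →L[ℝ] E →L[ℝ] ℝ := B.bilinearComp T T

/-- The metric in the preferred chart at `x₀`. -/
def metricInChart (g : Metric X) (x₀ : X) (z : EuclideanSpace ℝ (Fin 3)) :
    EuclideanSpace ℝ (Fin 3) →L[ℝ] EuclideanSpace ℝ (Fin 3) →L[ℝ] ℝ :=
  bilinPullback (E := EuclideanSpace ℝ (Fin 3)) (g.inner ((extChartAt (𝓡 3) x₀).symm z))
    (coordFrame x₀ z)

theorem metricInChart_apply (g : Metric X) (x₀ : X) (z u v : EuclideanSpace ℝ (Fin 3)) :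
    metricInChart g x₀ z u v =
      g.inner ((extChartAt (𝓡 3) x₀).symm z) (coordFrame x₀ z u) (coordFrame x₀ z v) := rfl

theorem contDiffOn_metricInChart (g : Metric X) (x₀ : X) :
    ContDiffOn ℝ ∞ (metricInChart g x₀) (extChartAt (𝓡 3) x₀).target := by
  rw [contDiffOn_clm_apply]
  intro u
  rw [contDiffOn_clm_apply]
  intro v
  set c := extChartAt (𝓡 3) x₀
  have hfr : ∀ u : EuclideanSpace ℝ (Fin 3),
      ContMDiffOn 𝓘(ℝ, EuclideanSpace ℝ (Fin 3)) ((𝓡 3).prod 𝓘(ℝ, EuclideanSpace ℝ (Fin 3))) ∞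
      (fun z => (Bundle.TotalSpace.mk' (EuclideanSpace ℝ (Fin 3)) (c.symm z) (coordFrame x₀ z u) :
        TangentBundle (𝓡 3) X)) c.target := by
    intro u
    have h1 := (contMDiffOn_chart_symm (n := 3) x₀).contMDiffOn_tangentMapWithin
      (m := ∞) (by simp) (isOpen_extChartAt_target x₀).uniqueMDiffOn
    have h2 : ContMDiffOn 𝓘(ℝ, EuclideanSpace ℝ (Fin 3))
        (𝓘(ℝ, EuclideanSpace ℝ (Fin 3)).prod 𝓘(ℝ, EuclideanSpace ℝ (Fin 3))) ∞
        (fun z : EuclideanSpace ℝ (Fin 3) =>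
          (Bundle.TotalSpace.mk' (EuclideanSpace ℝ (Fin 3)) z u :
            TangentBundle 𝓘(ℝ, EuclideanSpace ℝ (Fin 3)) (EuclideanSpace ℝ (Fin 3)))) c.target := by
      intro z hz
      rw [Bundle.contMDiffWithinAt_totalSpace]
      refine ⟨contMDiffWithinAt_id, ?_⟩
      simpa using contMDiffWithinAt_const
    refine (h1.comp h2 (fun z hz => hz)).congr ?_
    intro z hz
    simp only [Function.comp_apply, tangentMapWithin, Bundle.TotalSpace.mk']
    rw [mfderivWithin_of_mem_nhds ((isOpen_extChartAt_target x₀).mem_nhds hz)]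
    rfl
  have hg : ContMDiffOn 𝓘(ℝ, EuclideanSpace ℝ (Fin 3)) ((𝓡 3).prod
      𝓘(ℝ, EuclideanSpace ℝ (Fin 3) →L[ℝ] EuclideanSpace ℝ (Fin 3) →L[ℝ] ℝ)) ∞
      (fun z => Bundle.TotalSpace.mk' (EuclideanSpace ℝ (Fin 3) →L[ℝ] EuclideanSpace ℝ (Fin 3) →L[ℝ] ℝ)
        (E := fun x : X => (TangentSpace (𝓡 3) x →L[ℝ] TangentSpace (𝓡 3) x →L[ℝ] ℝ))
        (c.symm z) (g.inner (c.symm z))) c.target :=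
    g.contMDiff.comp_contMDiffOn (contMDiffOn_chart_symm x₀)
  have h3 := ContMDiffOn.clm_bundle_apply₂ (E₃ := fun _ : X => ℝ) (F₃ := ℝ) hg (hfr u) (hfr v)
  intro z hz
  have h4 := h3 z hz
  rw [Bundle.contMDiffWithinAt_totalSpace] at h4
  exact h4.2.contDiffWithinAt

theorem coordFrame_injective {x₀ : X} {z : EuclideanSpace ℝ (Fin 3)}
    (hz : z ∈ (extChartAt (𝓡 3) x₀).target) : Function.Injective (coordFrame x₀ z) := by
  intro u v h
  have h1 := mfderiv_chart_comp_coordFrame hz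
  have h2 := fun w : EuclideanSpace ℝ (Fin 3) => congrArg (fun T => T w) h1
  exact (h2 u).symm.trans ((congrArg _ h).trans (h2 v))

theorem metricInChart_pos (g : Metric X) {x₀ : X} {z : EuclideanSpace ℝ (Fin 3)}
    (hz : z ∈ (extChartAt (𝓡 3) x₀).target) {v : EuclideanSpace ℝ (Fin 3)} (hv : v ≠ 0) :
    0 < metricInChart g x₀ z v v := by
  refine g.pos _ _ fun h => hv (coordFrame_injective hz (Eq.trans h (map_zero _).symm))

theorem metricInChart_invertible (g : Metric X) {x₀ : X} {z : EuclideanSpace ℝ (Fin 3)}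
    (hz : z ∈ (extChartAt (𝓡 3) x₀).target) :
    ∃ e : EuclideanSpace ℝ (Fin 3) ≃L[ℝ] (EuclideanSpace ℝ (Fin 3) →L[ℝ] ℝ),
      (e : EuclideanSpace ℝ (Fin 3) →L[ℝ] (EuclideanSpace ℝ (Fin 3) →L[ℝ] ℝ)) =
        metricInChart g x₀ z := by
  have hinj : Function.Injective (metricInChart g x₀ z) := by
    rw [injective_iff_map_eq_zero]
    intro v hv
    by_contra h
    have h1 := metricInChart_pos g hz h
    rw [hv] at h1
    exact lt_irrefl _ h1
  have hfin : finrank ℝ (EuclideanSpace ℝ (Fin 3)) =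
      finrank ℝ (EuclideanSpace ℝ (Fin 3) →L[ℝ] ℝ) := by
    rw [← LinearEquiv.finrank_eq
      (LinearMap.toContinuousLinearMap (𝕜 := ℝ) (E := EuclideanSpace ℝ (Fin 3)) (F' := ℝ))]
    exact Subspace.dual_finrank_eq.symm
  refine ⟨(LinearEquiv.ofInjectiveOfFinrankEq
    (metricInChart g x₀ z).toLinearMap hinj hfin).toContinuousLinearEquiv, ?_⟩
  ext v w
  rfl

/-- In a chart the field is the inverse of the metric tensor applied to the form, and inversion is
smooth at invertible operators. -/
theorem smooth_muSharp (g : Metric X) {μ : OneForm 3 X} (hμ : μ.SmoothOn univ) :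
    (muSharp g μ).Smooth := by
  intro x₀
  have h1 : ContDiffOn ℝ ∞ (fun z => (metricInChart g x₀ z).inverse (μ.inChart x₀ z))
      (extChartAt (𝓡 3) x₀).target := by
    refine ContDiffOn.clm_apply ?_ ((hμ x₀).mono fun z hz => ⟨hz, mem_univ _⟩)
    intro z hz
    obtain ⟨e, he⟩ := metricInChart_invertible g hz
    exact ContDiffAt.comp_contDiffWithinAt (g := ContinuousLinearMap.inverse) z
      (he ▸ contDiffAt_map_inverse e) (contDiffOn_metricInChart g x₀ z hz)
  refine h1.congr ?_
  intro z hz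
  obtain ⟨e, he⟩ := metricInChart_invertible g hz
  rw [← he, ContinuousLinearMap.inverse_equiv, ContinuousLinearEquiv.coe_coe,
    ContinuousLinearEquiv.eq_symm_apply]
  ext w
  have h2 : e (VecField.inChart (muSharp g μ) x₀ z) =
    metricInChart g x₀ z (VecField.inChart (muSharp g μ) x₀ z) := by rw [← he]; rfl
  rw [h2, metricInChart_apply, coordFrame_inChart _ hz, inner_muSharp]
  rfl

variable [MulAction Circle X]

/-- The normalised dual of the generator `nu`. -/
def thetaForm (g : Metric X) : OneForm 3 X := fun y => (g.inner y (nu y) (nu y))⁻¹ • g.inner y (nu y)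

theorem thetaForm_apply (g : Metric X) (y : X) (v : TangentSpace (𝓡 3) y) :
    thetaForm g y v = (g.inner y (nu y) (nu y))⁻¹ * g.inner y (nu y) v := rfl

theorem thetaForm_smoothOn (g : Metric X) (hν : VecField.Smooth (nu (N := X))) :
    (thetaForm g).SmoothOn {y | nu y ≠ 0} := by
  intro x₀
  have h0 : (extChartAt (𝓡 3) x₀).target ∩ (extChartAt (𝓡 3) x₀).symm ⁻¹' {y | nu y ≠ 0} ⊆
    (extChartAt (𝓡 3) x₀).target := inter_subset_left
  have h1 : ContDiffOn ℝ ∞ (fun z => metricInChart g x₀ z (VecField.inChart nu x₀ z))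
      ((extChartAt (𝓡 3) x₀).target ∩ (extChartAt (𝓡 3) x₀).symm ⁻¹' {y | nu y ≠ 0}) :=
    ((contDiffOn_metricInChart g x₀).mono h0).clm_apply ((hν x₀).mono h0)
  have h2 := h1.clm_apply ((hν x₀).mono h0)
  have h3 : ∀ z ∈ (extChartAt (𝓡 3) x₀).target ∩
      (extChartAt (𝓡 3) x₀).symm ⁻¹' {y | nu y ≠ 0},
      metricInChart g x₀ z (VecField.inChart nu x₀ z) (VecField.inChart nu x₀ z) =
        g.inner _ (nu ((extChartAt (𝓡 3) x₀).symm z)) (nu ((extChartAt (𝓡 3) x₀).symm z)) := by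
    intro z hz
    rw [metricInChart_apply, coordFrame_inChart _ hz.1]
  refine ((h2.inv fun z hz => ?_).smul h1).congr ?_
  · rw [h3 z hz]; exact (g.pos _ _ hz.2).ne'
  · intro z hz
    ext w
    have : (thetaForm g).inChart x₀ z w = thetaForm g _ (coordFrame x₀ z w) := rfl
    rw [this, thetaForm_apply]
    change _ = (metricInChart g x₀ z (VecField.inChart nu x₀ z) (VecField.inChart nu x₀ z))⁻¹ *
      metricInChart g x₀ z (VecField.inChart nu x₀ z) w
    rw [h3 z hz, metricInChart_apply, coordFrame_inChart _ hz.1]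

end MetricSmooth

end

section

open Set Filter Topology Module

theorem bijective_of_injective {n : ℕ} (T : EuclideanSpace ℝ (Fin n) →L[ℝ] EuclideanSpace ℝ (Fin n))
    (h : Function.Injective T) : Function.Bijective T :=
  ⟨h, LinearMap.surjective_of_injective (f := T.toLinearMap) h⟩

/-! ### Circle actions: the generating field, and equivariance of the structures on the target. -/

section CircleAction

variable {n : ℕ} {X : Type*} [TopologicalSpace X] [ChartedSpace (EuclideanSpace ℝ (Fin n)) X]
  [IsManifold (𝓡 n) ∞ X] [MulAction Circle X]

/-- The vector field `d/dt|₀ exp(t) · x` that generates a circle action. -/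
def circleGen : VecField n X := fun y =>
  mfderiv 𝓘(ℝ, ℝ) (𝓡 n) (fun t : ℝ => Circle.exp t • y) 0 (1 : ℝ)

variable (hs : ContMDiff ((𝓡 1).prod (𝓡 n)) (𝓡 n) ∞ (fun q : Circle × X => q.1 • q.2))
include hs

theorem contMDiff_smul_const (z : Circle) : ContMDiff (𝓡 n) (𝓡 n) ∞ (fun y : X => z • y) :=
  hs.comp (contMDiff_const.prodMk contMDiff_id)

theorem mdifferentiable_smul_const (z : Circle) : MDifferentiable (𝓡 n) (𝓡 n) (fun y : X => z • y) :=
  (contMDiff_smul_const hs z).mdifferentiable (by simp)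

theorem contMDiff_circleFlow :
    ContMDiff (𝓘(ℝ, ℝ).prod (𝓡 n)) (𝓡 n) ∞ (fun q : ℝ × X => Circle.exp q.1 • q.2) :=
  hs.comp ((contMDiff_circleExp.comp contMDiff_fst).prodMk contMDiff_snd)

theorem contMDiff_exp_smul (y : X) :
    ContMDiff 𝓘(ℝ, ℝ) (𝓡 n) ∞ (fun t : ℝ => Circle.exp t • y) :=
  (contMDiff_circleFlow hs).comp (contMDiff_id.prodMk contMDiff_const)

theorem mfderiv_circleFlow (t : ℝ) (y : X) :
    mfderiv 𝓘(ℝ, ℝ) (𝓡 n) (fun t : ℝ => Circle.exp t • y) t (1 : ℝ) =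
      circleGen (Circle.exp t • y) := by
  have h1 : (fun u : ℝ => Circle.exp u • y) =
      (fun u : ℝ => Circle.exp u • (Circle.exp t • y)) ∘ (fun u => u - t) := by
    funext u
    simp only [Function.comp_apply]
    rw [← mul_smul, ← Circle.exp_add, sub_add_cancel]
  have h2 : HasFDerivAt (fun u : ℝ => u - t) (ContinuousLinearMap.id ℝ ℝ) t :=
    (hasFDerivAt_id t).sub_const t
  have h4 : MDifferentiable 𝓘(ℝ, ℝ) (𝓡 n) (fun u : ℝ => Circle.exp u • (Circle.exp t • y)) :=
    (contMDiff_exp_smul hs _).mdifferentiable (by simp)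
  have h3 := mfderiv_comp (I := 𝓘(ℝ, ℝ)) (I' := 𝓘(ℝ, ℝ)) (I'' := 𝓡 n) t
    (f := fun u : ℝ => u - t) (g := fun u : ℝ => Circle.exp u • (Circle.exp t • y)) (h4 _)
    h2.differentiableAt.mdifferentiableAt
  rw [← h1, mfderiv_eq_fderiv, h2.fderiv] at h3
  have key : ∀ t' : ℝ, t' = 0 → (mfderiv 𝓘(ℝ, ℝ) (𝓡 n)
      (fun u : ℝ => Circle.exp u • (Circle.exp t • y)) t' (1 : ℝ) : EuclideanSpace ℝ (Fin n)) =
      circleGen (Circle.exp t • y) := by rintro t' rfl; rfl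
  exact (congrArg (fun T => T (1 : ℝ)) h3).trans (key _ (sub_self t))

theorem smooth_circleGen : VecField.Smooth (circleGen (n := n) (X := X)) :=
  smooth_generator (contMDiff_circleFlow hs) (fun y => by simp) (fun y => by
    simp only
    rw [mfderiv_circleFlow hs])

theorem smul_inv_comp (z : Circle) (y : X) :
    (mfderiv (𝓡 n) (𝓡 n) (fun y : X => z⁻¹ • y) (z • y)).comp
      (mfderiv (𝓡 n) (𝓡 n) (fun y : X => z • y) y) =
      (ContinuousLinearMap.id ℝ (EuclideanSpace ℝ (Fin n))) := by
  have h := mfderiv_comp y (mdifferentiable_smul_const hs z⁻¹ (z • y))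
    (mdifferentiable_smul_const hs z y)
  have h1 : (fun y : X => z⁻¹ • y) ∘ (fun y : X => z • y) = id := by funext y; simp
  rw [h1, mfderiv_id] at h
  exact h.symm

theorem smul_mfderiv_injective (z : Circle) (y : X) :
    Function.Injective (mfderiv (𝓡 n) (𝓡 n) (fun y : X => z • y) y) := by
  intro u v h
  have h1 := fun w : EuclideanSpace ℝ (Fin n) => congrArg (fun T => T w) (smul_inv_comp hs z y)
  exact (h1 u).symm.trans ((congrArg _ h).trans (h1 v))

theorem smul_mfderiv_bijective (z : Circle) (y : X) :
    Function.Bijective (mfderiv (𝓡 n) (𝓡 n) (fun y : X => z • y) y) :=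
  bijective_of_injective _ (smul_mfderiv_injective hs z y)

theorem circleGen_smul (z : Circle) (y : X) :
    circleGen (z • y) = mfderiv (𝓡 n) (𝓡 n) (fun y : X => z • y) y (circleGen y) := by
  have h1 : (fun u : ℝ => Circle.exp u • (z • y)) =
      (fun y => z • y) ∘ (fun u : ℝ => Circle.exp u • y) := by
    funext u
    simp only [Function.comp_apply]
    rw [← mul_smul, ← mul_smul, mul_comm]
  have h3 := mfderiv_comp (I := 𝓘(ℝ, ℝ)) (I' := 𝓡 n) (I'' := 𝓡 n) (0 : ℝ)
    (f := fun u : ℝ => Circle.exp u • y) (g := fun y => z • y)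
    (mdifferentiable_smul_const hs z _)
    ((contMDiff_exp_smul hs y).mdifferentiable (by simp) _)
  rw [← h1] at h3
  have key : ∀ y', y' = y → (mfderiv (𝓡 n) (𝓡 n) (fun y : X => z • y) y' (circleGen (n := n) y) :
      EuclideanSpace ℝ (Fin n)) = mfderiv (𝓡 n) (𝓡 n) (fun y : X => z • y) y (circleGen y) := by
    rintro y' rfl; rfl
  exact (congrArg (fun T => T (1 : ℝ)) h3).trans (key _ (by simp))

/-- An invariant one-form with constant value on the generator has `ι dη = 0`. -/
theorem extD_circleGen_eq_zero {η : OneForm n X} {W : Set X} (hη : η.SmoothOn W) (hWo : IsOpen W)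
    (hinv : ∀ (z : Circle) (y : X),
      (η (z • y)).comp (mfderiv (𝓡 n) (𝓡 n) (fun y' : X => z • y') y) = η y)
    {C : ℝ} (hC : ∀ y ∈ W, η y (circleGen y) = C) {y : X} (hy : y ∈ W)
    (v : TangentSpace (𝓡 n) y) : extD η y (circleGen y) v = 0 :=
  extD_generator_eq_zero hη hWo (contMDiff_circleFlow hs) (fun y => by simp)
    (fun t y => mfderiv_circleFlow hs t y) (fun t y => hinv _ y) hC hy v

end CircleAction

section Target

variable {N : Type*} [TopologicalSpace N] [ChartedSpace (EuclideanSpace ℝ (Fin 3)) N]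
  [IsManifold (𝓡 3) ∞ N] [MulAction Circle N]
  (hs : ContMDiff ((𝓡 1).prod (𝓡 3)) (𝓡 3) ∞ (fun q : Circle × N => q.1 • q.2))
  {gN : Metric N} {VN : ThreeForm 3 N} {μ : OneForm 3 N}

include hs

theorem mfderiv_nuFlow (t : ℝ) (y : N) :
    mfderiv 𝓘(ℝ, ℝ) (𝓡 3) (fun t : ℝ => Circle.exp (-t) • y) t (1 : ℝ) =
      -circleGen (Circle.exp (-t) • y) := by
  have h2 : HasFDerivAt (fun u : ℝ => -u) (-ContinuousLinearMap.id ℝ ℝ) t :=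
    (hasFDerivAt_id t).neg
  have h3 := mfderiv_comp (I := 𝓘(ℝ, ℝ)) (I' := 𝓘(ℝ, ℝ)) (I'' := 𝓡 3) t
    (f := fun u : ℝ => -u) (g := fun u : ℝ => Circle.exp u • y)
    ((contMDiff_exp_smul hs y).mdifferentiable (by simp) _)
    h2.differentiableAt.mdifferentiableAt
  rw [mfderiv_eq_fderiv, h2.fderiv] at h3
  refine (congrArg (fun T => T (1 : ℝ)) h3).trans ?_
  rw [← mfderiv_circleFlow hs]
  exact map_neg (mfderiv 𝓘(ℝ, ℝ) (𝓡 3) (fun t : ℝ => Circle.exp t • y) (-t)) (1 : ℝ)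

theorem nu_eq_neg (y : N) : nu y = -circleGen y := by
  have h := mfderiv_nuFlow hs 0 y
  have key : ∀ y', y' = y → (-circleGen (n := 3) y' : EuclideanSpace ℝ (Fin 3)) = -circleGen y := by
    rintro y' rfl; rfl
  exact h.trans (key _ (by simp))

theorem smooth_nu : VecField.Smooth (nu (N := N)) := by
  intro x₀
  refine (smooth_circleGen hs x₀).neg.congr ?_
  intro z hz
  simp only [VecField.inChart]
  rw [nu_eq_neg hs]
  exact map_neg _ _

theorem nu_smul (z : Circle) (y : N) :
    nu (z • y) = mfderiv (𝓡 3) (𝓡 3) (fun y : N => z • y) y (nu y) := by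
  rw [nu_eq_neg hs, nu_eq_neg hs, circleGen_smul hs]
  exact (map_neg _ _).symm

theorem isOpen_nu_ne_zero : IsOpen {y : N | nu y ≠ 0} := (smooth_nu hs).isOpen_ne_zero

theorem muSharp_smul (hact : IsIsometricAction gN VN) (hμ : IsMomentMap VN μ) (z : Circle) (y : N) :
    muSharp gN μ (z • y) = mfderiv (𝓡 3) (𝓡 3) (fun y : N => z • y) y (muSharp gN μ y) := by
  refine flat_injective gN _ ?_
  ext w
  obtain ⟨w, rfl⟩ := (smul_mfderiv_bijective hs z y).2 w
  change gN.inner _ _ _ = gN.inner _ _ _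
  rw [hact.isometry, inner_muSharp, inner_muSharp]
  exact congrArg (fun T => T w) (hμ.invariant z y)

theorem Sig_smul (hact : IsIsometricAction gN VN) (z : Circle) (y : N)
    (v w : TangentSpace (𝓡 3) y) :
    Sig gN VN (z • y) (mfderiv (𝓡 3) (𝓡 3) (fun y : N => z • y) y v)
      (mfderiv (𝓡 3) (𝓡 3) (fun y : N => z • y) y w) =
      mfderiv (𝓡 3) (𝓡 3) (fun y : N => z • y) y (Sig gN VN y v w) := by
  refine flat_injective gN _ ?_
  ext u
  obtain ⟨u, rfl⟩ := (smul_mfderiv_bijective hs z y).2 u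
  change gN.inner _ _ _ = gN.inner _ _ _
  rw [hact.isometry, gN.symm, gN.symm y, inner_Sig, inner_Sig]
  have h := congrArg (fun T => T ![u, v, w]) (hact.orientation z y)
  simp only [ContinuousAlternatingMap.compContinuousLinearMap_apply] at h
  rw [← h]
  congr 1
  ext1 i
  fin_cases i <;> rfl

theorem linearIndependent_smul (hact : IsIsometricAction gN VN) (hμ : IsMomentMap VN μ)
    (z : Circle) (y : N) : LinearIndependent ℝ ![nu (z • y), muSharp gN μ (z • y)] ↔
      LinearIndependent ℝ ![nu y, muSharp gN μ y] := by
  rw [nu_smul hs, muSharp_smul hs hact hμ]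
  rw [LinearIndependent.pair_iff, LinearIndependent.pair_iff]
  refine forall₂_congr fun a b => ?_
  rw [← map_smul, ← map_smul, ← map_add]
  refine imp_congr_left ⟨fun h => ?_, fun h => by rw [h, map_zero]⟩
  exact smul_mfderiv_injective hs z y (h.trans (map_zero _).symm)

theorem bpsRel_smul {M : Type*} [TopologicalSpace M] [ChartedSpace (EuclideanSpace ℝ (Fin 3)) M]
    [IsManifold (𝓡 3) ∞ M] {gM : Metric M} {VM : ThreeForm 3 M}
    (hact : IsIsometricAction gN VN) (z : Circle) {x : M} {y : N}
    {D : TangentSpace (𝓡 3) x →L[ℝ] TangentSpace (𝓡 3) y}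
    {F : TangentSpace (𝓡 3) x → TangentSpace (𝓡 3) x → ℝ} {m : TangentSpace (𝓡 3) y}
    (h : BPSRel gM VM gN VN x y D F m) :
    BPSRel gM VM gN VN x (z • y) ((mfderiv (𝓡 3) (𝓡 3) (fun y : N => z • y) y).comp D) F
      (mfderiv (𝓡 3) (𝓡 3) (fun y : N => z • y) y m) := by
  intro v w
  simp only [ContinuousLinearMap.comp_apply]
  rw [Sig_smul hs hact, ← map_smul, ← map_smul, ← map_add, ← map_sub, h v w, map_zero]

end Target

end

section

open Set Filter Topology Module

/-! ### Gauge-free description on the bundle: horizontal lift, covariant differential, curvature. -/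

section Bundle

variable {M : Type*} [TopologicalSpace M] [ChartedSpace (EuclideanSpace ℝ (Fin 3)) M]
  [IsManifold (𝓡 3) ∞ M]
  {N : Type*} [TopologicalSpace N] [ChartedSpace (EuclideanSpace ℝ (Fin 3)) N]
  [IsManifold (𝓡 3) ∞ N] [MulAction Circle N]
  {P : Type*} [TopologicalSpace P] [ChartedSpace (EuclideanSpace ℝ (Fin 4)) P]
  [IsManifold (𝓡 4) ∞ P] [MulAction Circle P]
  {π : P → M} {A : OneForm 4 P} {Φ : P → N}

theorem IsConnection.apply_circleGen (hA : IsConnection A) (p : P) : A p (circleGen p) = 1 :=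
  hA.apply_vertical p

theorem IsConnection.extD_circleGen (hA : IsConnection A) (hπ : IsPrincipalBundle π) (p : P)
    (w : TangentSpace (𝓡 4) p) : extD A p (circleGen p) w = 0 :=
  extD_circleGen_eq_zero hπ.smooth_smul hA.smooth isOpen_univ hA.invariant
    (fun p _ => hA.apply_circleGen p) (mem_univ p) w

theorem IsConnection.pullM_smul (hA : IsConnection A) (z : Circle) :
    pullM A (fun p : P => z • p) = A := funext fun p => hA.invariant z p

theorem IsPrincipalBundle.mdifferentiableAt (hπ : IsPrincipalBundle π) (p : P) :
    MDifferentiableAt (𝓡 4) (𝓡 3) π p := hπ.smooth_proj.mdifferentiable (by simp) p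

theorem IsSkyrmeField.mdifferentiableAt (hΦ : IsSkyrmeField Φ) (p : P) :
    MDifferentiableAt (𝓡 4) (𝓡 3) Φ p := hΦ.smooth.mdifferentiable (by simp) p

theorem IsPrincipalBundle.mfderiv_circleGen (hπ : IsPrincipalBundle π) (p : P) :
    mfderiv (𝓡 4) (𝓡 3) π p (circleGen p) = 0 := by
  have h1 := mfderiv_comp (I := 𝓘(ℝ, ℝ)) (I' := 𝓡 4) (I'' := 𝓡 3) (0 : ℝ)
    (f := fun t : ℝ => Circle.exp t • p) (g := π) (hπ.mdifferentiableAt _)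
    ((contMDiff_exp_smul hπ.smooth_smul p).mdifferentiable (by simp) _)
  have h2 : π ∘ (fun t : ℝ => Circle.exp t • p) = fun _ => π p := by
    funext t; exact hπ.proj_smul _ p
  rw [h2, mfderiv_const] at h1
  have key : ∀ p', p' = p → (mfderiv (𝓡 4) (𝓡 3) π p' (circleGen (n := 4) p) :
      EuclideanSpace ℝ (Fin 3)) = mfderiv (𝓡 4) (𝓡 3) π p (circleGen p) := by
    rintro p' rfl; rfl
  exact (key (Circle.exp 0 • p) (by simp)).symm.trans (congrArg (fun T => T (1 : ℝ)) h1).symm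

/-- Equivariance carries `z` to `z⁻¹`, so the orbit `exp(t) · p` goes to `exp(-t) · Φ p`. This is
the source of the sign in the definition of `nu`. -/
theorem IsSkyrmeField.mfderiv_circleGen (hΦ : IsSkyrmeField Φ) (hπ : IsPrincipalBundle π) (p : P) :
    mfderiv (𝓡 4) (𝓡 3) Φ p (circleGen p) = nu (Φ p) := by
  have h1 := mfderiv_comp (I := 𝓘(ℝ, ℝ)) (I' := 𝓡 4) (I'' := 𝓡 3) (0 : ℝ)
    (f := fun t : ℝ => Circle.exp t • p) (g := Φ) (hΦ.mdifferentiableAt _)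
    ((contMDiff_exp_smul hπ.smooth_smul p).mdifferentiable (by simp) _)
  have h2 : Φ ∘ (fun t : ℝ => Circle.exp t • p) = fun t : ℝ => Circle.exp (-t) • Φ p := by
    funext t
    rw [Function.comp_apply, hΦ.equivariant, Circle.exp_neg]
  rw [h2] at h1
  have key : ∀ p', p' = p → (mfderiv (𝓡 4) (𝓡 3) Φ p' (circleGen (n := 4) p) :
      EuclideanSpace ℝ (Fin 3)) = mfderiv (𝓡 4) (𝓡 3) Φ p (circleGen p) := by
    rintro p' rfl; rfl
  exact (key (Circle.exp 0 • p) (by simp)).symm.trans (congrArg (fun T => T (1 : ℝ)) h1).symm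

theorem IsLocalSection.smul {U : Set M} {s : M → P} (hs : IsLocalSection π U s)
    (hπ : IsPrincipalBundle π) (z : Circle) : IsLocalSection π U (fun x => z • s x) :=
  ⟨hs.isOpen, (contMDiff_smul_const hπ.smooth_smul z).comp_contMDiffOn hs.smooth,
    fun x hx => (hπ.proj_smul z _).trans (hs.proj x hx)⟩

theorem IsLocalSection.mdifferentiableAt {U : Set M} {s : M → P} (hs : IsLocalSection π U s)
    {x : M} (hx : x ∈ U) : MDifferentiableAt (𝓡 3) (𝓡 4) s x :=
  (hs.smooth.contMDiffAt (hs.isOpen.mem_nhds hx)).mdifferentiableAt (by simp)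

theorem IsPrincipalBundle.exists_section (hπ : IsPrincipalBundle π) (p : P) :
    ∃ (U : Set M) (s : M → P), IsLocalSection π U s ∧ π p ∈ U ∧ s (π p) = p := by
  obtain ⟨U, s, τ, hx, hs, -, hτ, -⟩ := hπ.locally_trivial (π p)
  exact ⟨U, _, hs.smul hπ (τ p), hx, hτ p hx⟩

theorem IsPrincipalBundle.exists_smul_eq (hπ : IsPrincipalBundle π) {p q : P} (h : π p = π q) :
    ∃ z : Circle, q = z • p := by
  obtain ⟨U, s, τ, hx, hs, -, hτ, -⟩ := hπ.locally_trivial (π p)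
  refine ⟨τ q * (τ p)⁻¹, ?_⟩
  have h1 := hτ p hx
  have h2 := hτ q (show π q ∈ U from h ▸ hx)
  rw [← h] at h2
  have h3 : (τ p)⁻¹ • p = s (π p) := by
    conv_lhs => rw [← h1]
    rw [h1, inv_smul_eq_iff, h1]
  rw [mul_smul, h3, h2]

theorem IsPrincipalBundle.surjective (hπ : IsPrincipalBundle π) (x : M) : ∃ p, π p = x := by
  obtain ⟨U, s, τ, hx, hs, -⟩ := hπ.locally_trivial x
  exact ⟨s x, hs.proj x hx⟩

theorem IsLocalSection.mfderiv_proj {U : Set M} {s : M → P} (hs : IsLocalSection π U s)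
    (hπ : IsPrincipalBundle π) {x : M} (hx : x ∈ U) (v : EuclideanSpace ℝ (Fin 3)) :
    (mfderiv (𝓡 4) (𝓡 3) π (s x) (mfderiv (𝓡 3) (𝓡 4) s x v) : EuclideanSpace ℝ (Fin 3)) = v := by
  have h1 := mfderiv_comp x (hπ.mdifferentiableAt (s x)) (hs.mdifferentiableAt hx)
  have h2 : π ∘ s =ᶠ[𝓝 x] id := by
    filter_upwards [hs.isOpen.mem_nhds hx] with y hy using hs.proj y hy
  have h3 := h2.mfderiv_eq (I := 𝓡 3) (I' := 𝓡 3)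
  rw [mfderiv_id] at h3
  exact (congrArg (fun T : EuclideanSpace ℝ (Fin 3) →L[ℝ] EuclideanSpace ℝ (Fin 3) => T v)
    h1).symm.trans
      (congrArg (fun T : EuclideanSpace ℝ (Fin 3) →L[ℝ] EuclideanSpace ℝ (Fin 3) => T v) h3)

/-- The projection and the connection form together, as a map on the tangent space of `P`. -/
def projConn (π : P → M) (A : OneForm 4 P) (p : P) :
    EuclideanSpace ℝ (Fin 4) →L[ℝ] EuclideanSpace ℝ (Fin 3) × ℝ :=
  ContinuousLinearMap.prod (M₂ := EuclideanSpace ℝ (Fin 3)) (mfderiv (𝓡 4) (𝓡 3) π p) (A p)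

/-- A section through `p` lifts any tangent vector of the base, and a multiple of the generator,
which is vertical with `A = 1`, corrects the value of `A`. Dimensions agree. -/
theorem projConn_bijective (hπ : IsPrincipalBundle π) (hA : IsConnection A) (p : P) :
    Function.Bijective (projConn π A p) := by
  have hsurj : Function.Surjective (projConn π A p) := by
    rintro ⟨u, a⟩
    obtain ⟨U, s, hs, hx, hsp⟩ := hπ.exists_section p
    have hw : ∃ w : TangentSpace (𝓡 4) p, mfderiv (𝓡 4) (𝓡 3) π p w = u := by
      have key : ∀ p', p' = p → ∀ w : EuclideanSpace ℝ (Fin 4),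
          (mfderiv (𝓡 4) (𝓡 3) π p' w : EuclideanSpace ℝ (Fin 3)) = u →
          ∃ w : TangentSpace (𝓡 4) p, mfderiv (𝓡 4) (𝓡 3) π p w = u := by
        rintro p' rfl w hw
        exact ⟨w, hw⟩
      exact key _ hsp _ (hs.mfderiv_proj hπ hx u)
    obtain ⟨w, hw⟩ := hw
    refine ⟨w + (a - A p w) • circleGen p, Prod.ext ?_ ?_⟩
    · change mfderiv (𝓡 4) (𝓡 3) π p (w + (a - A p w) • circleGen p) = u
      rw [map_add, map_smul, hπ.mfderiv_circleGen, hw, smul_zero]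
      exact add_zero u
    · change A p (w + (a - A p w) • circleGen p) = a
      rw [map_add, map_smul, hA.apply_circleGen]
      simp
  refine ⟨?_, hsurj⟩
  refine (LinearMap.injective_iff_surjective_of_finrank_eq_finrank
    (f := (projConn π A p).toLinearMap) ?_).2 hsurj
  simp

theorem eq_zero_of_projConn (hπ : IsPrincipalBundle π) (hA : IsConnection A) {p : P}
    {w : TangentSpace (𝓡 4) p} (h1 : mfderiv (𝓡 4) (𝓡 3) π p w = 0) (h2 : A p w = 0) : w = 0 := by
  refine (projConn_bijective hπ hA p).1 ((Prod.ext ?_ ?_).trans (map_zero (projConn π A p)).symm)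
  · exact h1
  · exact h2

open scoped Classical in
/-- The horizontal lift of tangent vectors. -/
def horizLift (π : P → M) (A : OneForm 4 P) (p : P) :
    TangentSpace (𝓡 3) (π p) →L[ℝ] TangentSpace (𝓡 4) p :=
  if h : ∃ T : TangentSpace (𝓡 3) (π p) →L[ℝ] TangentSpace (𝓡 4) p,
    ∀ u, mfderiv (𝓡 4) (𝓡 3) π p (T u) = u ∧ A p (T u) = 0 then h.choose else 0

theorem horizLift_spec (hπ : IsPrincipalBundle π) (hA : IsConnection A) (p : P)
    (u : TangentSpace (𝓡 3) (π p)) :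
    mfderiv (𝓡 4) (𝓡 3) π p (horizLift π A p u) = u ∧ A p (horizLift π A p u) = 0 := by
  have h : ∃ T : TangentSpace (𝓡 3) (π p) →L[ℝ] TangentSpace (𝓡 4) p,
      ∀ u, mfderiv (𝓡 4) (𝓡 3) π p (T u) = u ∧ A p (T u) = 0 := by
    let e := (LinearEquiv.ofBijective (projConn π A p).toLinearMap
      (projConn_bijective hπ hA p)).toContinuousLinearEquiv
    refine ⟨e.symm.toContinuousLinearMap.comp (ContinuousLinearMap.inl ℝ (EuclideanSpace ℝ (Fin 3)) ℝ),
      fun u => ?_⟩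
    have h1 : e (e.symm (u, (0 : ℝ))) = (u, (0 : ℝ)) := e.apply_symm_apply _
    exact ⟨congrArg Prod.fst h1, congrArg Prod.snd h1⟩
  rw [horizLift, dif_pos h]
  exact h.choose_spec u

theorem eq_horizLift_add (hπ : IsPrincipalBundle π) (hA : IsConnection A) {p : P}
    (w : TangentSpace (𝓡 4) p) :
    w = horizLift π A p (mfderiv (𝓡 4) (𝓡 3) π p w) + A p w • circleGen p := by
  have h := horizLift_spec hπ hA p (mfderiv (𝓡 4) (𝓡 3) π p w)
  refine sub_eq_zero.1 (eq_zero_of_projConn hπ hA ?_ ?_)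
  · rw [map_sub, map_add, map_smul, h.1, hπ.mfderiv_circleGen]; simp
  · rw [map_sub, map_add, map_smul, h.2, hA.apply_circleGen]; simp

/-- The covariant differential of the equivariant map `Φ`. -/
def covP (π : P → M) (A : OneForm 4 P) (Φ : P → N) (p : P) :
    TangentSpace (𝓡 3) (π p) →L[ℝ] TangentSpace (𝓡 3) (Φ p) :=
  (mfderiv (𝓡 4) (𝓡 3) Φ p).comp (horizLift π A p)

/-- The curvature at a point of the bundle. -/
def curvP (π : P → M) (A : OneForm 4 P) (p : P) (v w : TangentSpace (𝓡 3) (π p)) : ℝ :=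
  extD A p (horizLift π A p v) (horizLift π A p w)

theorem isTwoForm_curvP (p : P) : IsTwoForm (curvP π A p) := by
  obtain ⟨b, hb⟩ := isTwoForm_extD A p
  exact ⟨b.compl₁₂ (horizLift π A p).toLinearMap (horizLift π A p).toLinearMap,
    fun u v => hb _ _⟩

theorem covP_proj (hπ : IsPrincipalBundle π) (hA : IsConnection A) (hΦ : IsSkyrmeField Φ) {p : P}
    (w : TangentSpace (𝓡 4) p) : covP π A Φ p (mfderiv (𝓡 4) (𝓡 3) π p w) =
      mfderiv (𝓡 4) (𝓡 3) Φ p w - A p w • nu (Φ p) := by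
  rw [eq_sub_iff_add_eq, ← hΦ.mfderiv_circleGen hπ]
  conv_rhs => rw [eq_horizLift_add hπ hA w, map_add, map_smul]
  rfl

/-- A vector differs from the horizontal lift of its projection by a multiple of the generator, and
`ι dA = 0` on the generator. -/
theorem curvP_proj (hπ : IsPrincipalBundle π) (hA : IsConnection A) {p : P}
    (w w' : TangentSpace (𝓡 4) p) :
    curvP π A p (mfderiv (𝓡 4) (𝓡 3) π p w) (mfderiv (𝓡 4) (𝓡 3) π p w') = extD A p w w' := by
  have h2 := isTwoForm_extD A p
  have h3 : ∀ u, extD A p u (circleGen p) = 0 := fun u => by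
    rw [h2.swap, hA.extD_circleGen hπ, neg_zero]
  conv_rhs => rw [eq_horizLift_add hπ hA w, eq_horizLift_add hπ hA w']
  rw [h2.add_left, h2.add_right, h2.smul_left, h2.smul_right, hA.extD_circleGen hπ, h3, curvP]
  ring

theorem IsLocalSection.covD_eq {U : Set M} {s : M → P} (hs : IsLocalSection π U s)
    (hπ : IsPrincipalBundle π) (hA : IsConnection A) (hΦ : IsSkyrmeField Φ) {x : M} (hx : x ∈ U) :
    (covD (Φ ∘ s) (potential A s) x : EuclideanSpace ℝ (Fin 3) →L[ℝ] EuclideanSpace ℝ (Fin 3)) =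
      covP π A Φ (s x) := by
  ext1 v
  have h1 := congrArg (covP π A Φ (s x)) (hs.mfderiv_proj hπ hx v)
  refine Eq.trans ?_ ((covP_proj hπ hA hΦ (mfderiv (𝓡 3) (𝓡 4) s x v)).symm.trans h1)
  have h2 := mfderiv_comp x (hΦ.mdifferentiableAt (s x)) (hs.mdifferentiableAt hx)
  have key : ∀ (T T' : EuclideanSpace ℝ (Fin 3) →L[ℝ] EuclideanSpace ℝ (Fin 3))
    (c : EuclideanSpace ℝ (Fin 3)), T = T' → T v - c = T' v - c := by rintro T T' c rfl; rfl
  exact key _ _ _ h2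

theorem IsLocalSection.extD_eq {U : Set M} {s : M → P} (hs : IsLocalSection π U s)
    (hπ : IsPrincipalBundle π) (hA : IsConnection A) {x : M} (hx : x ∈ U)
    (v w : EuclideanSpace ℝ (Fin 3)) :
    extD (potential A s) x v w = curvP π A (s x) v w := by
  have h1 := extD_pullM (n := 4) (m := 3) hA.smooth isOpen_univ hs.isOpen hs.smooth hx
    (mem_univ (s x)) v w
  refine h1.trans ((curvP_proj hπ hA _ _).symm.trans ?_)
  have h2 := hs.mfderiv_proj hπ hx
  have key : ∀ v' w' : EuclideanSpace ℝ (Fin 3), v' = v → w' = w →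
    curvP π A (s x) v' w' = curvP π A (s x) v w := by rintro v' w' rfl rfl; rfl
  exact key _ _ (h2 v) (h2 w)

/-! ### Gauge covariance -/

theorem mfderiv_proj_smul (hπ : IsPrincipalBundle π) (z : Circle) (p : P)
    (w : EuclideanSpace ℝ (Fin 4)) :
    (mfderiv (𝓡 4) (𝓡 3) π (z • p) (mfderiv (𝓡 4) (𝓡 4) (fun p : P => z • p) p w) :
      EuclideanSpace ℝ (Fin 3)) = mfderiv (𝓡 4) (𝓡 3) π p w := by
  have h1 := mfderiv_comp p (hπ.mdifferentiableAt (z • p))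
    (mdifferentiable_smul_const hπ.smooth_smul z p)
  have h2 : π ∘ (fun p : P => z • p) = π := funext fun p => hπ.proj_smul z p
  rw [h2] at h1
  exact (congrArg (fun T : EuclideanSpace ℝ (Fin 4) →L[ℝ] EuclideanSpace ℝ (Fin 3) => T w) h1).symm

theorem mfderiv_field_smul (hπ : IsPrincipalBundle π) (hΦ : IsSkyrmeField Φ)
    (hs : ContMDiff ((𝓡 1).prod (𝓡 3)) (𝓡 3) ∞ (fun q : Circle × N => q.1 • q.2))
    (z : Circle) (p : P) (w : EuclideanSpace ℝ (Fin 4)) :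
    (mfderiv (𝓡 4) (𝓡 3) Φ (z • p) (mfderiv (𝓡 4) (𝓡 4) (fun p : P => z • p) p w) :
      EuclideanSpace ℝ (Fin 3)) = mfderiv (𝓡 3) (𝓡 3) (fun y : N => z⁻¹ • y) (Φ p)
        (mfderiv (𝓡 4) (𝓡 3) Φ p w) := by
  have h1 := mfderiv_comp p (hΦ.mdifferentiableAt (z • p))
    (mdifferentiable_smul_const hπ.smooth_smul z p)
  have h2 : Φ ∘ (fun p : P => z • p) = (fun y : N => z⁻¹ • y) ∘ Φ :=
    funext fun p => hΦ.equivariant z p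
  have h3 := mfderiv_comp p (mdifferentiable_smul_const hs z⁻¹ (Φ p)) (hΦ.mdifferentiableAt p)
  rw [h2] at h1
  exact (congrArg (fun T : EuclideanSpace ℝ (Fin 4) →L[ℝ] EuclideanSpace ℝ (Fin 3) => T w)
    (h1.symm.trans h3))

theorem horizLift_smul (hπ : IsPrincipalBundle π) (hA : IsConnection A) (z : Circle) (p : P)
    (u : EuclideanSpace ℝ (Fin 3)) :
    (horizLift π A (z • p) u : EuclideanSpace ℝ (Fin 4)) =
      mfderiv (𝓡 4) (𝓡 4) (fun p : P => z • p) p (horizLift π A p u) := by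
  have h1 := horizLift_spec hπ hA p u
  have h2 := eq_horizLift_add hπ hA
    (mfderiv (𝓡 4) (𝓡 4) (fun p : P => z • p) p (horizLift π A p u))
  have h3 : A (z • p) (mfderiv (𝓡 4) (𝓡 4) (fun p : P => z • p) p (horizLift π A p u)) = 0 :=
    (congrArg (fun T => T (horizLift π A p u)) (hA.invariant z p)).trans h1.2
  rw [h3, zero_smul, add_zero] at h2
  refine Eq.trans ?_ h2.symm
  exact congrArg (horizLift π A (z • p)) ((mfderiv_proj_smul hπ z p _).trans h1.1).symm

theorem covP_smul (hπ : IsPrincipalBundle π) (hA : IsConnection A) (hΦ : IsSkyrmeField Φ)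
    (hs : ContMDiff ((𝓡 1).prod (𝓡 3)) (𝓡 3) ∞ (fun q : Circle × N => q.1 • q.2))
    (z : Circle) (p : P) :
    (covP π A Φ (z • p) : EuclideanSpace ℝ (Fin 3) →L[ℝ] EuclideanSpace ℝ (Fin 3)) =
      (mfderiv (𝓡 3) (𝓡 3) (fun y : N => z⁻¹ • y) (Φ p)).comp (covP π A Φ p) := by
  ext1 u
  refine Eq.trans ?_ (mfderiv_field_smul hπ hΦ hs z p (horizLift π A p u))
  exact congrArg (mfderiv (𝓡 4) (𝓡 3) Φ (z • p)) (horizLift_smul hπ hA z p u)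

theorem curvP_smul (hπ : IsPrincipalBundle π) (hA : IsConnection A) (z : Circle) (p : P)
    (u v : EuclideanSpace ℝ (Fin 3)) : curvP π A (z • p) u v = curvP π A p u v := by
  have h1 := extD_pullM (n := 4) (m := 4) hA.smooth isOpen_univ isOpen_univ
    (contMDiff_smul_const hπ.smooth_smul z).contMDiffOn (mem_univ p) (mem_univ (z • p))
    (horizLift π A p u) (horizLift π A p v)
  rw [hA.pullM_smul] at h1
  refine Eq.trans ?_ h1.symm
  have key : ∀ a b a' b' : EuclideanSpace ℝ (Fin 4), a = a' → b = b' →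
    extD A (z • p) a b = extD A (z • p) a' b' := by rintro _ _ _ _ rfl rfl; rfl
  exact key _ _ _ _ (horizLift_smul hπ hA z p u) (horizLift_smul hπ hA z p v)

section Transfer

variable {gM : Metric M} {VM : ThreeForm 3 M} {gN : Metric N} {VN : ThreeForm 3 N}
  {μ : OneForm 3 N}

theorem BPSRel.congr {x x' : M} {y y' : N} (hx : x = x') (hy : y = y')
    {D D' : EuclideanSpace ℝ (Fin 3) →L[ℝ] EuclideanSpace ℝ (Fin 3)} (hD : D = D')
    {F F' : EuclideanSpace ℝ (Fin 3) → EuclideanSpace ℝ (Fin 3) → ℝ} (hF : ∀ u v, F u v = F' u v)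
    {m m' : EuclideanSpace ℝ (Fin 3)} (hm : m = m') (h : BPSRel gM VM gN VN x y D F m) :
    BPSRel gM VM gN VN x' y' D' F' m' := by
  obtain rfl : F = F' := funext fun u => funext fun v => hF u v
  subst hx hy hD hm
  exact h

/-- The action on the target is isometric and preserves orientation and `muSharp`, so moving along a
fibre transports the whole relation by the differential of `z⁻¹`. -/
theorem bpsRel_smul_iff (hπ : IsPrincipalBundle π) (hA : IsConnection A) (hΦ : IsSkyrmeField Φ)
    (hs : ContMDiff ((𝓡 1).prod (𝓡 3)) (𝓡 3) ∞ (fun q : Circle × N => q.1 • q.2))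
    (hact : IsIsometricAction gN VN) (hμ : IsMomentMap VN μ) (z : Circle) {p : P}
    (h : BPSRel gM VM gN VN (π p) (Φ p) (covP π A Φ p) (curvP π A p) (muSharp gN μ (Φ p))) :
    BPSRel gM VM gN VN (π (z • p)) (Φ (z • p)) (covP π A Φ (z • p)) (curvP π A (z • p))
      (muSharp gN μ (Φ (z • p))) := by
  have h1 := bpsRel_smul hs hact z⁻¹ h
  refine h1.congr (hπ.proj_smul z p).symm (hΦ.equivariant z p).symm
    (covP_smul hπ hA hΦ hs z p).symm (fun u v => (curvP_smul hπ hA z p u v).symm) ?_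
  have key : ∀ y, y = z⁻¹ • Φ p → (muSharp gN μ (z⁻¹ • Φ p) : EuclideanSpace ℝ (Fin 3)) =
    muSharp gN μ y := by rintro y rfl; rfl
  exact (muSharp_smul hs hact hμ z⁻¹ (Φ p)).symm.trans (key _ (hΦ.equivariant z p))

theorem SolvesBPSAt.bpsRel {α β γ : ℝ} {p : P}
    (h : SolvesBPSAt gM VM gN VN μ α β γ π A Φ (π p)) (hπ : IsPrincipalBundle π)
    (hA : IsConnection A) (hΦ : IsSkyrmeField Φ) :
    BPSRel gM VM gN VN (π p) (Φ p) (covP π A Φ p) (curvP π A p) (muSharp gN μ (Φ p)) ∧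
    ∀ v w, α • Sig gN VN (Φ p) (covP π A Φ p v) (covP π A Φ p w) +
      β • (curvP π A p v w • muSharp gN μ (Φ p)) + γ • (curvP π A p v w • nu (Φ p)) = 0 := by
  obtain ⟨U, s, hs, hx, hsp⟩ := hπ.exists_section p
  obtain ⟨h1, h2⟩ := h U s hs hx
  have hD := hs.covD_eq hπ hA hΦ hx
  have hF := hs.extD_eq hπ hA hx
  have key : ∀ (p' : P) (D : EuclideanSpace ℝ (Fin 3) →L[ℝ] EuclideanSpace ℝ (Fin 3))
      (F : EuclideanSpace ℝ (Fin 3) → EuclideanSpace ℝ (Fin 3) → ℝ), p' = p →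
      D = covP π A Φ p' → (∀ u v, F u v = curvP π A p' u v) →
      BPSRel gM VM gN VN (π p) (Φ p') D F (muSharp gN μ (Φ p')) →
      (∀ v w, α • Sig gN VN (Φ p') (D v) (D w) +
        β • (F v w • muSharp gN μ (Φ p')) + γ • (F v w • nu (Φ p')) = 0) →
      BPSRel gM VM gN VN (π p) (Φ p) (covP π A Φ p) (curvP π A p) (muSharp gN μ (Φ p)) ∧
      ∀ v w, α • Sig gN VN (Φ p) (covP π A Φ p v) (covP π A Φ p w) +
        β • (curvP π A p v w • muSharp gN μ (Φ p)) + γ • (curvP π A p v w • nu (Φ p)) = 0 := by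
    rintro p' D F rfl rfl hF h1 h2
    obtain rfl : F = curvP π A p' := funext fun u => funext fun v => hF u v
    exact ⟨h1, h2⟩
  exact key _ _ _ hsp hD hF h1 h2

/-- A gauge meets the fibre of `p` in some `z • p`, so validity of the relation at one point of the
fibre gives it in every gauge. With zero coefficients the second equation is empty. -/
theorem solvesBPSAt_of_bpsRel {p : P} (hπ : IsPrincipalBundle π) (hA : IsConnection A)
    (hΦ : IsSkyrmeField Φ)
    (hs : ContMDiff ((𝓡 1).prod (𝓡 3)) (𝓡 3) ∞ (fun q : Circle × N => q.1 • q.2))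
    (hact : IsIsometricAction gN VN) (hμ : IsMomentMap VN μ)
    (h : BPSRel gM VM gN VN (π p) (Φ p) (covP π A Φ p) (curvP π A p) (muSharp gN μ (Φ p))) :
    SolvesBPSAt gM VM gN VN μ 0 0 0 π A Φ (π p) := by
  intro U s hsec hx
  refine ⟨?_, fun v w => by simp⟩
  obtain ⟨z, hz⟩ := hπ.exists_smul_eq (hsec.proj _ hx).symm
  have h1 := bpsRel_smul_iff hπ hA hΦ hs hact hμ z h
  rw [← hz] at h1
  exact h1.congr (hsec.proj _ hx) rfl (hsec.covD_eq hπ hA hΦ hx).symm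
    (fun u v => (hsec.extD_eq hπ hA hx u v).symm) rfl

theorem regularAt_iff (hπ : IsPrincipalBundle π) (hA : IsConnection A)
    (hΦ : IsSkyrmeField Φ)
    (hs : ContMDiff ((𝓡 1).prod (𝓡 3)) (𝓡 3) ∞ (fun q : Circle × N => q.1 • q.2))
    (hact : IsIsometricAction gN VN) (hμ : IsMomentMap VN μ) (p : P) :
    RegularAt gN μ π A Φ (π p) ↔ Function.Bijective (covP π A Φ p) ∧
      LinearIndependent ℝ ![nu (Φ p), muSharp gN μ (Φ p)] := by
  constructor
  · rintro ⟨U, s, hsec, hx, hb, hl⟩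
    obtain ⟨z, hz⟩ := hπ.exists_smul_eq (hsec.proj _ hx)
    have h1 : Function.Bijective (covP π A Φ (s (π p))) := by
      have := hsec.covD_eq hπ hA hΦ hx
      have key : ∀ D D' : EuclideanSpace ℝ (Fin 3) →L[ℝ] EuclideanSpace ℝ (Fin 3), D = D' →
        Function.Bijective D → Function.Bijective D' := by rintro D D' rfl h; exact h
      exact key _ _ this hb
    generalize s (π p) = q at *
    subst hz
    constructor
    · have key : ∀ D D' : EuclideanSpace ℝ (Fin 3) →L[ℝ] EuclideanSpace ℝ (Fin 3), D = D' →
        Function.Bijective D' → Function.Bijective D := by rintro D D' rfl h; exact h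
      exact key _ _ (covP_smul hπ hA hΦ hs z q)
        ((smul_mfderiv_bijective hs z⁻¹ (Φ q)).comp h1)
    · rw [hΦ.equivariant]
      exact (linearIndependent_smul hs hact hμ z⁻¹ (Φ q)).2 hl
  · rintro ⟨h1, h2⟩
    obtain ⟨U, s, hsec, hx, hsp⟩ := hπ.exists_section p
    refine ⟨U, s, hsec, hx, ?_, ?_⟩
    · have := hsec.covD_eq hπ hA hΦ hx
      have key : ∀ (p' : P) (D : EuclideanSpace ℝ (Fin 3) →L[ℝ] EuclideanSpace ℝ (Fin 3)),
        p' = p → D = covP π A Φ p' → Function.Bijective D := by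
        rintro p' D rfl rfl; exact h1
      exact key _ _ hsp this
    · rw [hsp]; exact h2

theorem CurvatureNeZeroAt.exists_ne_zero (hπ : IsPrincipalBundle π) (hA : IsConnection A) {p : P}
    (h : CurvatureNeZeroAt π A (π p)) : ∃ v w, curvP π A p v w ≠ 0 := by
  obtain ⟨U, s, hsec, hx, v, w, hvw⟩ := h
  obtain ⟨z, hz⟩ := hπ.exists_smul_eq (hsec.proj _ hx).symm
  have h1 := hsec.extD_eq hπ hA hx v w
  have key : ∀ q, q = z • p → curvP π A q v w = curvP π A p v w := by
    rintro q rfl; exact curvP_smul hπ hA z p v w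
  exact ⟨v, w, fun h0 => hvw (h1.trans ((key _ hz).trans h0))⟩

end Transfer
end Bundle

end

section

open Set Filter Topology Module

/-! ### Open conditions on the bundle, proved by continuity in charts. -/

section MapInChart

variable {m n : ℕ} {Y : Type*} [TopologicalSpace Y] [ChartedSpace (EuclideanSpace ℝ (Fin m)) Y]
  [IsManifold (𝓡 m) ∞ Y]
  {X : Type*} [TopologicalSpace X] [ChartedSpace (EuclideanSpace ℝ (Fin n)) X]
  [IsManifold (𝓡 n) ∞ X]

theorem eventually_of_chart {y : Y} {Q : Y → Prop}
    (h : ∀ᶠ z in 𝓝 (extChartAt (𝓡 m) y y), Q ((extChartAt (𝓡 m) y).symm z)) :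
    ∀ᶠ q in 𝓝 y, Q q := by
  filter_upwards [(continuousAt_extChartAt (I := 𝓡 m) y).eventually h,
    (isOpen_extChartAt_source (I := 𝓡 m) y).mem_nhds (mem_extChartAt_source y)] with q hq hq'
  rwa [(extChartAt (𝓡 m) y).left_inv hq'] at hq

/-- A map in the preferred charts at `y` and its image. -/
def mapInChart (f : Y → X) (y : Y) (z : EuclideanSpace ℝ (Fin m)) : EuclideanSpace ℝ (Fin n) :=
  extChartAt (𝓡 n) (f y) (f ((extChartAt (𝓡 m) y).symm z))

/-- The domain on which `mapInChart` expresses the map. -/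
def mapChartDomain (n : ℕ) {X : Type*} [TopologicalSpace X]
    [ChartedSpace (EuclideanSpace ℝ (Fin n)) X] (f : Y → X) (y : Y) :
    Set (EuclideanSpace ℝ (Fin m)) :=
  (extChartAt (𝓡 m) y).target ∩ (extChartAt (𝓡 m) y).symm ⁻¹'
    (f ⁻¹' (extChartAt (𝓡 n) (f y)).source)

variable {f : Y → X}

theorem mem_mapChartDomain (y : Y) :
    extChartAt (𝓡 m) y y ∈ mapChartDomain (m := m) n f y :=
  mem_chart_preimage (mem_extChartAt_source y) (mem_extChartAt_source (I := 𝓡 n) (f y))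

theorem chart_mfderiv_injective {x₀ x : X} (hx : x ∈ (extChartAt (𝓡 n) x₀).source) :
    Function.Injective (mfderiv (𝓡 n) 𝓘(ℝ, EuclideanSpace ℝ (Fin n)) (extChartAt (𝓡 n) x₀) x) := by
  have key : ∀ x', x' = x → ((coordFrame x₀ (extChartAt (𝓡 n) x₀ x) :
      EuclideanSpace ℝ (Fin n) →L[ℝ] EuclideanSpace ℝ (Fin n)).comp
      (mfderiv (𝓡 n) 𝓘(ℝ, EuclideanSpace ℝ (Fin n)) (extChartAt (𝓡 n) x₀) x') =
        ContinuousLinearMap.id ℝ (EuclideanSpace ℝ (Fin n))) → Function.Injective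
        (mfderiv (𝓡 n) 𝓘(ℝ, EuclideanSpace ℝ (Fin n)) (extChartAt (𝓡 n) x₀) x) := by
    rintro x' rfl h u v huv
    have h2 := fun w : EuclideanSpace ℝ (Fin n) => congrArg (fun T => T w) h
    exact (h2 u).symm.trans ((congrArg _ huv).trans (h2 v))
  exact key _ ((extChartAt (𝓡 n) x₀).left_inv hx)
    (coordFrame_comp_mfderiv_chart ((extChartAt (𝓡 n) x₀).map_source hx))

theorem coordFrame_bijective {y : Y} {z : EuclideanSpace ℝ (Fin m)}
    (hz : z ∈ (extChartAt (𝓡 m) y).target) : Function.Bijective (coordFrame y z) := by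
  refine bijective_of_injective (coordFrame y z) fun u v h => ?_
  have h2 := fun w : EuclideanSpace ℝ (Fin m) =>
    congrArg (fun T => T w) (mfderiv_chart_comp_coordFrame hz)
  exact (h2 u).symm.trans ((congrArg _ h).trans (h2 v))

variable (hf : ContMDiff (𝓡 m) (𝓡 n) ∞ f)
include hf

theorem isOpen_mapChartDomain (y : Y) : IsOpen (mapChartDomain (m := m) n f y) :=
  isOpen_chart_preimage y ((isOpen_extChartAt_source (f y)).preimage hf.continuous)

theorem mapChartDomain_mem_nhds (y : Y) :
    mapChartDomain (m := m) n f y ∈ 𝓝 (extChartAt (𝓡 m) y y) :=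
  (isOpen_mapChartDomain hf y).mem_nhds (mem_mapChartDomain y)

theorem contDiffOn_mapInChart (y : Y) :
    ContDiffOn ℝ ∞ (mapInChart (m := m) (n := n) f y) (mapChartDomain (m := m) n f y) :=
  contDiffOn_chart_comp (fun _ hz => hz.2) (hf.comp_contMDiffOn
    ((contMDiffOn_chart_symm y).mono inter_subset_left))

theorem contDiffOn_fderiv_mapInChart (y : Y) :
    ContDiffOn ℝ ∞ (fderiv ℝ (mapInChart (m := m) (n := n) f y)) (mapChartDomain (m := m) n f y) :=
  (contDiffOn_mapInChart hf y).fderiv_of_isOpen (isOpen_mapChartDomain hf y) (by simp)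

theorem fderiv_mapInChart {y : Y} {z : EuclideanSpace ℝ (Fin m)}
    (hz : z ∈ mapChartDomain (m := m) n f y) (w : EuclideanSpace ℝ (Fin m)) :
    fderiv ℝ (mapInChart (m := m) (n := n) f y) z w =
      mfderiv (𝓡 n) 𝓘(ℝ, EuclideanSpace ℝ (Fin n)) (extChartAt (𝓡 n) (f y))
        (f ((extChartAt (𝓡 m) y).symm z))
        (mfderiv (𝓡 m) (𝓡 n) f ((extChartAt (𝓡 m) y).symm z) (coordFrame y z w)) := by
  have h1 : MDifferentiableAt 𝓘(ℝ, EuclideanSpace ℝ (Fin m)) (𝓡 m) (extChartAt (𝓡 m) y).symm z :=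
    (contMDiffAt_chart_symm hz.1).mdifferentiableAt (by simp)
  have h2 : MDifferentiableAt (𝓡 m) (𝓡 n) f ((extChartAt (𝓡 m) y).symm z) :=
    hf.mdifferentiable (by simp) _
  have h3 := fderiv_chart_comp (h := f ∘ (extChartAt (𝓡 m) y).symm) (x₀ := f y) (q := z) hz.2
    (h2.comp z h1)
  rw [mfderiv_comp z h2 h1] at h3
  exact congrArg (fun T => T w) h3

end MapInChart

section PosDef

variable {E Z : Type*} [NormedAddCommGroup E] [NormedSpace ℝ E] [FiniteDimensional ℝ E]
  [TopologicalSpace Z]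

/-- Compactness of the unit sphere gives `S z₀ v v ≥ c |v|²` with `c > 0`, which survives
perturbations of norm less than `c`. The neighbourhood is thus uniform in `v`. -/
theorem eventually_posDef {S : Z → E →L[ℝ] E →L[ℝ] ℝ} {z₀ : Z} (hS : ContinuousAt S z₀)
    (h₀ : ∀ v, v ≠ 0 → 0 < S z₀ v v) : ∀ᶠ z in 𝓝 z₀, ∀ v, v ≠ 0 → 0 < S z v v := by
  obtain ⟨c, hc, hcS⟩ : ∃ c > 0, ∀ v, c * ‖v‖ ^ 2 ≤ S z₀ v v := by
    rcases subsingleton_or_nontrivial E with hE | hE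
    · exact ⟨1, one_pos, fun v => by simp [Subsingleton.elim v 0]⟩
    · have hne : (Metric.sphere (0 : E) 1).Nonempty := by simp
      obtain ⟨u, hu, hmin⟩ := (isCompact_sphere (0 : E) 1).exists_isMinOn hne
        (f := fun v => S z₀ v v) (by fun_prop)
      have hu0 : u ≠ 0 := fun h => by simp [h] at hu
      refine ⟨S z₀ u u, h₀ u hu0, fun v => ?_⟩
      rcases eq_or_ne v 0 with rfl | hv
      · simp
      · have hv' := norm_pos_iff.2 hv
        have h1 := hmin (show ‖v‖⁻¹ • v ∈ Metric.sphere (0 : E) 1 by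
          simp [norm_smul, hv'.ne'])
        simp only [mem_ofPred_eq, map_smul, smul_apply, smul_eq_mul] at h1
        have h2 : ‖v‖⁻¹ * (‖v‖⁻¹ * S z₀ v v) * ‖v‖ ^ 2 = S z₀ v v := by field_simp
        rw [← h2]
        gcongr
  have h1 : ∀ᶠ z in 𝓝 z₀, ‖S z - S z₀‖ < c := by
    filter_upwards [hS.eventually (Metric.ball_mem_nhds (S z₀) hc)] with z hz
    exact (dist_eq_norm (S z) (S z₀)).symm.trans_lt hz
  filter_upwards [h1] with z hz v hv
  have hv' := norm_pos_iff.2 hv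
  have h2 : |(S z - S z₀) v v| ≤ ‖S z - S z₀‖ * ‖v‖ * ‖v‖ := by
    rw [← Real.norm_eq_abs]; exact ContinuousLinearMap.le_opNorm₂ _ _ _
  have h3 : (S z - S z₀) v v = S z v v - S z₀ v v := by simp
  rw [h3] at h2
  have h4 := (abs_le.1 h2).1
  have h5 := hcS v
  have h6 : ‖S z - S z₀‖ * ‖v‖ * ‖v‖ < c * ‖v‖ ^ 2 := by
    rw [mul_assoc, ← sq]; exact mul_lt_mul_of_pos_right hz (by positivity)
  linarith

end PosDef

theorem contDiffOn_inChart_conn {n : ℕ} {P : Type*} [TopologicalSpace P]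
    [ChartedSpace (EuclideanSpace ℝ (Fin n)) P] {A : OneForm n P} (hA : A.SmoothOn univ) (p : P) :
    ContDiffOn ℝ ∞ (A.inChart p) (extChartAt (𝓡 n) p).target :=
  (hA p).mono fun _ hz => ⟨hz, mem_univ _⟩

theorem metricInChart_chart {X : Type*} [TopologicalSpace X]
    [ChartedSpace (EuclideanSpace ℝ (Fin 3)) X] [IsManifold (𝓡 3) ∞ X] (g : Metric X) {x₀ x : X}
    (hx : x ∈ (extChartAt (𝓡 3) x₀).source) (u v : TangentSpace (𝓡 3) x) :
    metricInChart g x₀ (extChartAt (𝓡 3) x₀ x)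
      (mfderiv (𝓡 3) 𝓘(ℝ, EuclideanSpace ℝ (Fin 3)) (extChartAt (𝓡 3) x₀) x u)
      (mfderiv (𝓡 3) 𝓘(ℝ, EuclideanSpace ℝ (Fin 3)) (extChartAt (𝓡 3) x₀) x v) =
      g.inner x u v := by
  have key : ∀ (x' : X) (T : EuclideanSpace ℝ (Fin 3) →L[ℝ] EuclideanSpace ℝ (Fin 3)), x' = x →
      T.comp (mfderiv (𝓡 3) 𝓘(ℝ, EuclideanSpace ℝ (Fin 3)) (extChartAt (𝓡 3) x₀) x') =
        ContinuousLinearMap.id ℝ (EuclideanSpace ℝ (Fin 3)) →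
      g.inner x' (T (mfderiv (𝓡 3) 𝓘(ℝ, EuclideanSpace ℝ (Fin 3)) (extChartAt (𝓡 3) x₀) x u))
        (T (mfderiv (𝓡 3) 𝓘(ℝ, EuclideanSpace ℝ (Fin 3)) (extChartAt (𝓡 3) x₀) x v)) =
      g.inner x u v := by
    rintro x' T rfl h
    have h2 := fun w : EuclideanSpace ℝ (Fin 3) => congrArg (fun T => T w) h
    have h3 : ∀ a b a' b' : EuclideanSpace ℝ (Fin 3), a = a' → b = b' →
      g.inner x' a b = g.inner x' a' b' := by rintro _ _ _ _ rfl rfl; rfl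
    exact h3 _ _ _ _ (h2 u) (h2 v)
  exact key _ _ ((extChartAt (𝓡 3) x₀).left_inv hx)
    (coordFrame_comp_mfderiv_chart ((extChartAt (𝓡 3) x₀).map_source hx))

section ContinuityOnBundle

variable {M : Type*} [TopologicalSpace M] [ChartedSpace (EuclideanSpace ℝ (Fin 3)) M]
  [IsManifold (𝓡 3) ∞ M]
  {N : Type*} [TopologicalSpace N] [ChartedSpace (EuclideanSpace ℝ (Fin 3)) N]
  [IsManifold (𝓡 3) ∞ N] [MulAction Circle N]
  {P : Type*} [TopologicalSpace P] [ChartedSpace (EuclideanSpace ℝ (Fin 4)) P]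
  [IsManifold (𝓡 4) ∞ P] [MulAction Circle P]
  {π : P → M} {A : OneForm 4 P} {Φ : P → N}
  (hπ : IsPrincipalBundle π) (hA : IsConnection A) (hΦ : IsSkyrmeField Φ)
include hπ hA hΦ

theorem covP_injective_iff (p : P) : Function.Injective (covP π A Φ p) ↔
    ∀ w : TangentSpace (𝓡 4) p, mfderiv (𝓡 4) (𝓡 3) Φ p w = 0 → A p w = 0 → w = 0 := by
  rw [injective_iff_map_eq_zero]
  constructor
  · intro h w h1 h2
    refine eq_zero_of_projConn hπ hA (h _ ?_) h2
    rw [covP_proj hπ hA hΦ, h1, h2]; simp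
  · intro h u hu
    have h1 := horizLift_spec hπ hA p u
    have h2 := h _ hu h1.2
    exact h1.1.symm.trans ((congrArg _ h2).trans (map_zero _))

theorem covP_bijective_iff (p : P) : Function.Bijective (covP π A Φ p) ↔
    ∀ w : TangentSpace (𝓡 4) p, mfderiv (𝓡 4) (𝓡 3) Φ p w = 0 → A p w = 0 → w = 0 := by
  rw [← covP_injective_iff hπ hA hΦ]
  exact ⟨fun h => h.1, fun h => bijective_of_injective (covP π A Φ p) h⟩

/-- The differential of the field and the connection form together, in charts. -/
def fieldConn (A : OneForm 4 P) (Φ : P → N) (p : P) (z : EuclideanSpace ℝ (Fin 4)) :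
    EuclideanSpace ℝ (Fin 4) →L[ℝ] EuclideanSpace ℝ (Fin 3) × ℝ :=
  (fderiv ℝ (mapInChart Φ p) z).prod (A.inChart p z)

theorem contDiffOn_fieldConn (p : P) :
    ContDiffOn ℝ ∞ (fieldConn A Φ p) (mapChartDomain (m := 4) 3 Φ p) := by
  have h1 := contDiffOn_fderiv_mapInChart hΦ.smooth p
  have h2 := (contDiffOn_inChart_conn hA.smooth p).mono
    (inter_subset_left : mapChartDomain (m := 4) 3 Φ p ⊆ _)
  rw [contDiffOn_clm_apply]
  intro w
  exact (h1.clm_apply contDiffOn_const).prodMk (h2.clm_apply contDiffOn_const)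

/-- The kernel of `(dΦ, A)` consists of the horizontal vectors killed by `dΦ`, which are the
horizontal lifts of the kernel of `covP`. The right-hand side concerns a continuous family on a
fixed space. -/
theorem fieldConn_bijective {p : P} {z : EuclideanSpace ℝ (Fin 4)}
    (hz : z ∈ mapChartDomain (m := 4) 3 Φ p) :
    Function.Bijective (covP π A Φ ((extChartAt (𝓡 4) p).symm z)) ↔
      Function.Injective (fieldConn A Φ p z) := by
  rw [covP_bijective_iff hπ hA hΦ, injective_iff_map_eq_zero]
  have h0 : ∀ w, fieldConn A Φ p z w = 0 ↔
      mfderiv (𝓡 4) (𝓡 3) Φ ((extChartAt (𝓡 4) p).symm z) (coordFrame p z w) = 0 ∧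
      A ((extChartAt (𝓡 4) p).symm z) (coordFrame p z w) = 0 := by
    intro w
    rw [Prod.ext_iff]
    refine and_congr ?_ Iff.rfl
    change fderiv ℝ (mapInChart Φ p) z w = 0 ↔ _
    rw [fderiv_mapInChart hΦ.smooth hz]
    exact map_eq_zero_iff _ (chart_mfderiv_injective hz.2)
  constructor
  · intro h w hw
    have := h _ ((h0 w).1 hw).1 ((h0 w).1 hw).2
    exact (coordFrame_bijective hz.1).1 (Eq.trans this (map_zero (coordFrame p z)).symm)
  · intro h w h1 h2
    obtain ⟨w, rfl⟩ := (coordFrame_bijective hz.1).2 w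
    rw [h w ((h0 w).2 ⟨h1, h2⟩)]
    exact map_zero (coordFrame p z)

theorem isOpen_bijective_covP : IsOpen {p | Function.Bijective (covP π A Φ p)} := by
  rw [isOpen_iff_mem_nhds]
  intro p hp
  refine eventually_of_chart (m := 4) (Q := fun p => Function.Bijective (covP π A Φ p)) ?_
  have hz := mem_mapChartDomain (m := 4) (n := 3) (f := Φ) p
  have hp' : Function.Bijective (covP π A Φ
      ((extChartAt (𝓡 4) p).symm (extChartAt (𝓡 4) p p))) := by
    rw [extChartAt_to_inv]; exact hp
  have h1 := (fieldConn_bijective hπ hA hΦ hz).1 hp'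
  have h2 : ∃ e : EuclideanSpace ℝ (Fin 4) ≃L[ℝ] EuclideanSpace ℝ (Fin 3) × ℝ,
      (e : EuclideanSpace ℝ (Fin 4) →L[ℝ] EuclideanSpace ℝ (Fin 3) × ℝ) =
        fieldConn A Φ p (extChartAt (𝓡 4) p p) :=
    ⟨(LinearEquiv.ofInjectiveOfFinrankEq (fieldConn A Φ p (extChartAt (𝓡 4) p p)).toLinearMap h1
      (by simp)).toContinuousLinearEquiv, by ext1 v; rfl⟩
  obtain ⟨e, he⟩ := h2
  have h3 : ContinuousAt (fieldConn A Φ p) (extChartAt (𝓡 4) p p) :=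
    (contDiffOn_fieldConn hπ hA hΦ p).continuousOn.continuousAt
      (mapChartDomain_mem_nhds hΦ.smooth p)
  have h4 := h3.eventually (p := fun T => T ∈ range
    ((↑) : (EuclideanSpace ℝ (Fin 4) ≃L[ℝ] EuclideanSpace ℝ (Fin 3) × ℝ) →
      EuclideanSpace ℝ (Fin 4) →L[ℝ] EuclideanSpace ℝ (Fin 3) × ℝ))
    (he ▸ ContinuousLinearEquiv.nhds e)
  filter_upwards [h4, mapChartDomain_mem_nhds hΦ.smooth p] with z ⟨e', he'⟩ hz'
  rw [fieldConn_bijective hπ hA hΦ hz', ← he']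
  exact e'.injective

theorem isOpen_curvP_ne_zero : IsOpen {p | ∃ v w, curvP π A p v w ≠ 0} := by
  rw [isOpen_iff_mem_nhds]
  rintro p ⟨v, w, hvw⟩
  refine eventually_of_chart (m := 4) (Q := fun p => ∃ v w, curvP π A p v w ≠ 0) ?_
  have h1 : ContDiffOn ℝ ∞ (fderiv ℝ (A.inChart p)) (extChartAt (𝓡 4) p).target :=
    (contDiffOn_inChart_conn hA.smooth p).fderiv_of_isOpen (isOpen_extChartAt_target p) (by simp)
  have h2 : ContinuousAt (fderiv ℝ (A.inChart p)) (extChartAt (𝓡 4) p p) :=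
    h1.continuousOn.continuousAt ((isOpen_extChartAt_target p).mem_nhds (mem_extChartAt_target p))
  set u₁ : EuclideanSpace ℝ (Fin 4) := horizLift π A p v
  set u₂ : EuclideanSpace ℝ (Fin 4) := horizLift π A p w
  have h3 : ContinuousAt (fun z => fderiv ℝ (A.inChart p) z u₁ u₂ - fderiv ℝ (A.inChart p) z u₂ u₁)
      (extChartAt (𝓡 4) p p) := by
    have e1 := (h2.clm_apply (continuousAt_const (y := u₁))).clm_apply
      (continuousAt_const (y := u₂))
    have e2 := (h2.clm_apply (continuousAt_const (y := u₂))).clm_apply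
      (continuousAt_const (y := u₁))
    exact e1.sub e2
  filter_upwards [h3.eventually_ne hvw,
    (isOpen_extChartAt_target (I := 𝓡 4) p).mem_nhds (mem_extChartAt_target p)] with z hz hz'
  rw [fderiv_inChart_sub hA.smooth isOpen_univ hz' (mem_univ _), ← curvP_proj hπ hA] at hz
  exact ⟨_, _, hz⟩

/-- The covariant differential in charts. -/
def covInChart (A : OneForm 4 P) (Φ : P → N) (p : P) (z : EuclideanSpace ℝ (Fin 4)) :
    EuclideanSpace ℝ (Fin 4) →L[ℝ] EuclideanSpace ℝ (Fin 3) :=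
  fderiv ℝ (mapInChart Φ p) z -
    (A.inChart p z).smulRight (VecField.inChart nu (Φ p) (mapInChart Φ p z))

theorem covInChart_apply {p : P} {z : EuclideanSpace ℝ (Fin 4)}
    (hz : z ∈ mapChartDomain (m := 4) 3 Φ p) (w : EuclideanSpace ℝ (Fin 4)) :
    covInChart A Φ p z w = mfderiv (𝓡 3) 𝓘(ℝ, EuclideanSpace ℝ (Fin 3)) (extChartAt (𝓡 3) (Φ p))
      (Φ ((extChartAt (𝓡 4) p).symm z)) (covP π A Φ ((extChartAt (𝓡 4) p).symm z)
        (mfderiv (𝓡 4) (𝓡 3) π ((extChartAt (𝓡 4) p).symm z) (coordFrame p z w))) := by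
  rw [covP_proj hπ hA hΦ, map_sub, map_smul]
  change fderiv ℝ (mapInChart Φ p) z w - A _ (coordFrame p z w) •
    VecField.inChart nu (Φ p) (mapInChart Φ p z) = _
  rw [fderiv_mapInChart hΦ.smooth hz, mapInChart, VecField.inChart_chart _ hz.2]
  rfl

theorem continuousAt_covInChart (hν : VecField.Smooth (nu (N := N))) (p : P) :
    ContinuousAt (covInChart A Φ p) (extChartAt (𝓡 4) p p) := by
  have hO := mapChartDomain_mem_nhds (m := 4) (n := 3) hΦ.smooth p
  have h1 := (contDiffOn_fderiv_mapInChart hΦ.smooth p).continuousOn.continuousAt hO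
  have h2 := (contDiffOn_inChart_conn hA.smooth p).continuousOn.continuousAt
    ((isOpen_extChartAt_target p).mem_nhds (mem_extChartAt_target p))
  have h3 := (contDiffOn_mapInChart hΦ.smooth p).continuousOn.continuousAt hO
  have h5 : mapInChart (m := 4) (n := 3) Φ p (extChartAt (𝓡 4) p p) ∈
      (extChartAt (𝓡 3) (Φ p)).target :=
    (extChartAt (𝓡 3) (Φ p)).map_source (mem_mapChartDomain p).2
  have h4 : ContinuousAt (fun z => VecField.inChart nu (Φ p) (mapInChart Φ p z))
      (extChartAt (𝓡 4) p p) :=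
    ContinuousAt.comp (g := VecField.inChart nu (Φ p)) (hν.contDiffAt h5).continuousAt h3
  have h6 : ContinuousAt (fun z => (A.inChart p z).smulRight
      (VecField.inChart nu (Φ p) (mapInChart Φ p z))) (extChartAt (𝓡 4) p p) := by
    have := (ContinuousLinearMap.smulRightL ℝ (EuclideanSpace ℝ (Fin 4))
      (EuclideanSpace ℝ (Fin 3))).continuous.continuousAt.comp h2
    exact this.clm_apply h4
  exact h1.sub h6

theorem covInChart_eq_zero_iff {p : P} {z : EuclideanSpace ℝ (Fin 4)}
    (hz : z ∈ mapChartDomain (m := 4) 3 Φ p) :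
    covInChart A Φ p z = 0 ↔ covP π A Φ ((extChartAt (𝓡 4) p).symm z) = 0 := by
  constructor
  · intro h
    ext1 u
    have h1 := horizLift_spec hπ hA ((extChartAt (𝓡 4) p).symm z) u
    obtain ⟨w, hw⟩ := (coordFrame_bijective hz.1).2
      (horizLift π A ((extChartAt (𝓡 4) p).symm z) u)
    have h2 := covInChart_apply hπ hA hΦ hz w
    rw [h, hw, h1.1] at h2
    exact (map_eq_zero_iff _ (chart_mfderiv_injective hz.2)).1 h2.symm
  · intro h
    ext1 w
    rw [covInChart_apply hπ hA hΦ hz w, h]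
    exact map_zero _

theorem isOpen_covP_ne_zero (hν : VecField.Smooth (nu (N := N))) :
    IsOpen {p | covP π A Φ p ≠ 0} := by
  rw [isOpen_iff_mem_nhds]
  intro p hp
  refine eventually_of_chart (m := 4) (Q := fun p => covP π A Φ p ≠ 0) ?_
  have h1 : covInChart A Φ p (extChartAt (𝓡 4) p p) ≠ 0 := by
    rw [Ne, covInChart_eq_zero_iff hπ hA hΦ (mem_mapChartDomain p), extChartAt_to_inv]
    exact hp
  filter_upwards [(continuousAt_covInChart hπ hA hΦ hν p).eventually_ne h1,
    mapChartDomain_mem_nhds hΦ.smooth p] with z hz hz'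
  rwa [Ne, covInChart_eq_zero_iff hπ hA hΦ hz'] at hz

/-- Near a zero of the covariant differential, it shortens all vectors. -/
theorem eventually_shortens (hν : VecField.Smooth (nu (N := N))) (gM : Metric M) (gN : Metric N)
    {p : P} (hp : covP π A Φ p = 0) : ∀ᶠ q in 𝓝 p, ∀ u : TangentSpace (𝓡 3) (π q), u ≠ 0 →
      gN.inner (Φ q) (covP π A Φ q u) (covP π A Φ q u) < gM.inner (π q) u u := by
  refine eventually_of_chart (m := 4) (Q := fun q => ∀ u : TangentSpace (𝓡 3) (π q), u ≠ 0 →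
      gN.inner (Φ q) (covP π A Φ q u) (covP π A Φ q u) < gM.inner (π q) u u) ?_
  set c := extChartAt (𝓡 4) p with hc
  have hOΦ := mapChartDomain_mem_nhds (m := 4) (n := 3) hΦ.smooth p
  have hOπ := mapChartDomain_mem_nhds (m := 4) (n := 3) hπ.smooth_proj p
  have hOA := (isOpen_extChartAt_target (I := 𝓡 4) p).mem_nhds (mem_extChartAt_target p)
  -- `S = π^* g_M + A² - |d^A φ|²` on tangent vectors of `P`. The term `A²` makes the form positive
  -- definite in the vertical direction too, and on horizontal lifts `S` is the difference of
  -- squared lengths to be shown positive.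
  set S : EuclideanSpace ℝ (Fin 4) →
      EuclideanSpace ℝ (Fin 4) →L[ℝ] EuclideanSpace ℝ (Fin 4) →L[ℝ] ℝ := fun z =>
    ((metricInChart gM (π p) (mapInChart π p z)).bilinearComp
        (fderiv ℝ (mapInChart π p) z) (fderiv ℝ (mapInChart π p) z) +
      (A.inChart p z).smulRight (A.inChart p z)) -
      (metricInChart gN (Φ p) (mapInChart Φ p z)).bilinearComp
        (covInChart A Φ p z) (covInChart A Φ p z) with hS
  have hS_apply : ∀ z u v, S z u v = metricInChart gM (π p) (mapInChart π p z)
      (fderiv ℝ (mapInChart π p) z u) (fderiv ℝ (mapInChart π p) z v) +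
      A.inChart p z u * A.inChart p z v - metricInChart gN (Φ p) (mapInChart Φ p z)
      (covInChart A Φ p z u) (covInChart A Φ p z v) := fun z u v => rfl
  have hcont : ContinuousAt S (c p) := by
    rw [continuousAt_clm_apply]
    intro u
    rw [continuousAt_clm_apply]
    intro v
    simp only [hS_apply]
    have aux : ∀ {F : Type} [NormedAddCommGroup F] [NormedSpace ℝ F]
        {B : EuclideanSpace ℝ (Fin 4) → F →L[ℝ] F →L[ℝ] ℝ}
        {T : EuclideanSpace ℝ (Fin 4) → EuclideanSpace ℝ (Fin 4) →L[ℝ] F},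
        ContinuousAt B (c p) → ContinuousAt T (c p) →
        ContinuousAt (fun z => B z (T z u) (T z v)) (c p) := by
      intro F _ _ B T hB hT
      exact (hB.clm_apply (hT.clm_apply continuousAt_const)).clm_apply
        (hT.clm_apply continuousAt_const)
    have h1 := (contDiffOn_inChart_conn hA.smooth p).continuousOn.continuousAt hOA
    have h2 : ContinuousAt (fun z => metricInChart gM (π p) (mapInChart π p z)) (c p) :=
      ContinuousAt.comp (g := metricInChart gM (π p))
        ((contDiffOn_metricInChart gM (π p)).continuousOn.continuousAt
          ((isOpen_extChartAt_target _).mem_nhds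
            ((extChartAt (𝓡 3) (π p)).map_source (mem_mapChartDomain p).2)))
        ((contDiffOn_mapInChart hπ.smooth_proj p).continuousOn.continuousAt hOπ)
    have h3 : ContinuousAt (fun z => metricInChart gN (Φ p) (mapInChart Φ p z)) (c p) :=
      ContinuousAt.comp (g := metricInChart gN (Φ p))
        ((contDiffOn_metricInChart gN (Φ p)).continuousOn.continuousAt
          ((isOpen_extChartAt_target _).mem_nhds
            ((extChartAt (𝓡 3) (Φ p)).map_source (mem_mapChartDomain p).2)))
        ((contDiffOn_mapInChart hΦ.smooth p).continuousOn.continuousAt hOΦ)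
    exact ((aux h2 ((contDiffOn_fderiv_mapInChart hπ.smooth_proj p).continuousOn.continuousAt
      hOπ)).add ((h1.clm_apply continuousAt_const).mul (h1.clm_apply continuousAt_const))).sub
      (aux h3 (continuousAt_covInChart hπ hA hΦ hν p))
  have hval : ∀ z ∈ mapChartDomain (m := 4) 3 π p, z ∈ mapChartDomain (m := 4) 3 Φ p → ∀ w,
      S z w w = gM.inner (π (c.symm z)) (mfderiv (𝓡 4) (𝓡 3) π (c.symm z) (coordFrame p z w))
        (mfderiv (𝓡 4) (𝓡 3) π (c.symm z) (coordFrame p z w)) +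
        A (c.symm z) (coordFrame p z w) * A (c.symm z) (coordFrame p z w) -
        gN.inner (Φ (c.symm z)) (covP π A Φ (c.symm z)
          (mfderiv (𝓡 4) (𝓡 3) π (c.symm z) (coordFrame p z w)))
          (covP π A Φ (c.symm z) (mfderiv (𝓡 4) (𝓡 3) π (c.symm z) (coordFrame p z w))) := by
    intro z hz hz' w
    rw [hS_apply, covInChart_apply hπ hA hΦ hz', fderiv_mapInChart hπ.smooth_proj hz]
    rw [mapInChart, mapInChart, metricInChart_chart gM hz.2, metricInChart_chart gN hz'.2]
    rfl
  have hpos : ∀ w, w ≠ 0 → 0 < S (c p) w w := by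
    intro w hw
    have hz := mem_mapChartDomain (m := 4) (n := 3) (f := π) p
    have hz' := mem_mapChartDomain (m := 4) (n := 3) (f := Φ) p
    have h0 : covP π A Φ (c.symm (c p)) = 0 := by rw [hc, extChartAt_to_inv]; exact hp
    rw [hval _ hz hz', h0]
    have hw' : coordFrame p (c p) w ≠ 0 := fun h =>
      hw ((coordFrame_bijective hz.1).1 (Eq.trans h (map_zero (coordFrame p (c p))).symm))
    simp only [zero_apply, map_zero, sub_zero]
    rcases eq_or_ne (mfderiv (𝓡 4) (𝓡 3) π (c.symm (c p)) (coordFrame p (c p) w)) 0 with h1 | h1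
    · have h2 : A (c.symm (c p)) (coordFrame p (c p) w) ≠ 0 := fun h2 =>
        hw' (eq_zero_of_projConn hπ hA h1 h2)
      rw [h1, map_zero, zero_add]
      exact mul_self_pos.2 h2
    · exact add_pos_of_pos_of_nonneg (gM.pos _ _ h1) (mul_self_nonneg _)
  filter_upwards [eventually_posDef hcont hpos, hOπ, hOΦ] with z hz hz1 hz2 u hu
  have h1 := horizLift_spec hπ hA (c.symm z) u
  obtain ⟨w, hw⟩ := (coordFrame_bijective hz1.1).2 (horizLift π A (c.symm z) u)
  have hw0 : w ≠ 0 := by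
    rintro rfl
    have h2 : horizLift π A (c.symm z) u = 0 := hw.symm.trans (map_zero (coordFrame p z))
    exact hu (h1.1.symm.trans ((congrArg _ h2).trans (map_zero _)))
  have h2 := hz w hw0
  rw [hval z hz1 hz2, hw, h1.1, h1.2] at h2
  linarith

end ContinuityOnBundle

end

section

open Set Filter Topology Module

/-! ### Degenerate points, vanishing of the coefficients, and density of the regular points. -/

section Algebra

variable {M : Type*} [TopologicalSpace M] [ChartedSpace (EuclideanSpace ℝ (Fin 3)) M]
  [IsManifold (𝓡 3) ∞ M]
  {N : Type*} [TopologicalSpace N] [ChartedSpace (EuclideanSpace ℝ (Fin 3)) N]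
  [IsManifold (𝓡 3) ∞ N]
  {gM : Metric M} {VM : ThreeForm 3 M} {gN : Metric N} {VN : ThreeForm 3 N} {x : M} {y : N}
  {D : TangentSpace (𝓡 3) x →L[ℝ] TangentSpace (𝓡 3) y}
  {F : TangentSpace (𝓡 3) x → TangentSpace (𝓡 3) x → ℝ} {m n : TangentSpace (𝓡 3) y}

theorem BPSRel.of_not_bijective (h : BPSRel gM VM gN VN x y D F m) (hF : IsTwoForm F)
    (hVM : IsVolumeForm gM VM) (hVN : IsVolumeForm gN VN) (hn : n ≠ 0)
    (hmn : gN.inner y m n = 0) (hD : ¬ Function.Bijective D) :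
    (∀ v, gN.inner y n (D v) = 0) ∧ (∃ b, ∀ v, ∃ l : ℝ, D v = l • b) ∧
      ((∀ v w, F v w = 0) → ∀ v, D v = 0) := by
  obtain ⟨b, c, ρ, hb, hm, hn', hρ, hc⟩ := exists_adapted_frame hVN hn hmn
  rcases h.cases hF hVM hb hm with ⟨h1, h2⟩ | ⟨δ, hδ, hbij, -⟩
  · refine ⟨fun v => ?_, ⟨_, h1⟩, h2⟩
    obtain ⟨l, hl⟩ := h1 v
    simp [hl, hn', hb.inner_eq]
  · exact absurd hbij hD

/-- The row `p` has unit length in the bijective case, and so the preimage of `b 0` is a unit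
vector. This bounds `D` away from zero uniformly near the closure of the regular points. -/
theorem BPSRel.exists_isometric_vector (h : BPSRel gM VM gN VN x y D F m) (hF : IsTwoForm F)
    (hVM : IsVolumeForm gM VM) (hVN : IsVolumeForm gN VN) (hn : n ≠ 0)
    (hmn : gN.inner y m n = 0) (hD : Function.Bijective D) :
    ∃ w, w ≠ 0 ∧ gN.inner y (D w) (D w) = gM.inner x w w := by
  obtain ⟨b, c, ρ, hb, hm, hn', hρ, hc⟩ := exists_adapted_frame hVN hn hmn
  obtain ⟨w, hw⟩ := hD.2 (b 0)
  have hw0 : w ≠ 0 := by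
    rintro rfl
    have := congrArg (gN.inner y (b 0)) hw
    simp [hb.inner_eq] at this
  rcases h.cases hF hVM hb hm with ⟨h1, -⟩ | ⟨δ, hδ, hbij, hmet, -⟩
  · exfalso
    obtain ⟨u, hu⟩ := hD.2 (b 1)
    obtain ⟨l, hl⟩ := h1 u
    have := congrArg (gN.inner y (b 1)) (hu.symm.trans hl)
    simp [hb.inner_eq] at this
  · refine ⟨w, hw0, ?_⟩
    rw [hmet, hw]
    simp [hb.inner_eq]

/-- The second BPS equation is incompatible with a bijective differential, unless `α = 0`. -/
theorem not_bijective_of_bps2 (hVN : IsVolumeForm gN VN) (hn : n ≠ 0)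
    (hmn : gN.inner y m n = 0) {α β γ : ℝ} (hα : α ≠ 0)
    (h : ∀ v w, α • Sig gN VN y (D v) (D w) + β • (F v w • m) + γ • (F v w • n) = 0) :
    ¬ Function.Bijective D := by
  intro hD
  obtain ⟨b, c, ρ, hb, hm, hn', hρ, hc⟩ := exists_adapted_frame hVN hn hmn
  obtain ⟨v, hv⟩ := hD.2 (b 0)
  obtain ⟨w, hw⟩ := hD.2 (b 1)
  -- On vectors sent to `b 0` and `b 1` the cross product is `b 2`, orthogonal to both `m` and `n`,
  -- so only the `α` term survives.
  have h1 := congrArg (gN.inner y (b 2)) (h v w)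
  rw [hv, hw, hb.sig_zero_one, hm, hn'] at h1
  simp [hb.inner_eq] at h1
  exact hα h1

end Algebra

section Analysis

variable {M : Type*} [TopologicalSpace M] [ChartedSpace (EuclideanSpace ℝ (Fin 3)) M]
  [IsManifold (𝓡 3) ∞ M]
  {N : Type*} [TopologicalSpace N] [ChartedSpace (EuclideanSpace ℝ (Fin 3)) N]
  [IsManifold (𝓡 3) ∞ N] [MulAction Circle N]
  {P : Type*} [TopologicalSpace P] [ChartedSpace (EuclideanSpace ℝ (Fin 4)) P]
  [IsManifold (𝓡 4) ∞ P] [MulAction Circle P]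
  {π : P → M} {A : OneForm 4 P} {Φ : P → N}
  {gM : Metric M} {VM : ThreeForm 3 M} {gN : Metric N} {VN : ThreeForm 3 N} {μ : OneForm 3 N}
  (hπ : IsPrincipalBundle π) (hA : IsConnection A) (hΦ : IsSkyrmeField Φ)
  (hs : ContMDiff ((𝓡 1).prod (𝓡 3)) (𝓡 3) ∞ (fun q : Circle × N => q.1 • q.2))
  (hVM : IsVolumeForm gM VM) (hVN : IsVolumeForm gN VN)
  (hact : IsIsometricAction gN VN) (hμ : IsMomentMap VN μ)
theorem linearIndependent_nu_muSharp (hμ : IsMomentMap VN μ) {y : N} (hn : nu y ≠ 0)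
    (hm : muSharp gN μ y ≠ 0) :
    LinearIndependent ℝ ![nu y, muSharp gN μ y] := by
  have hmn : gN.inner y (muSharp gN μ y) (nu y) = 0 := by rw [inner_muSharp, hμ.apply_nu]
  rw [LinearIndependent.pair_iff]
  intro a b hab
  have h1 := congrArg (fun u => gN.inner y u (nu y)) hab
  have h2 := congrArg (fun u => gN.inner y (muSharp gN μ y) u) hab
  simp only [map_add, map_smul, add_apply, smul_apply, hmn, smul_eq_mul, mul_zero, add_zero,
    map_zero, zero_apply, zero_add] at h1 h2
  exact ⟨(mul_eq_zero.1 h1).resolve_right (gN.pos _ _ hn).ne',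
    (mul_eq_zero.1 h2).resolve_right (gN.pos _ _ hm).ne'⟩

include hπ hA hΦ

theorem mfderiv_horizLift (p : P) (v : TangentSpace (𝓡 3) (π p)) :
    mfderiv (𝓡 4) (𝓡 3) Φ p (horizLift π A p v) = covP π A Φ p v := rfl

include hs

/-- If the covariant differential is orthogonal to `nu` near a point, and has rank at most one at
the point, then the curvature vanishes there. -/
theorem curvP_eq_zero {p : P} (hp : nu (Φ p) ≠ 0)
    (h : ∀ᶠ q in 𝓝 p, ∀ v, gN.inner (Φ q) (nu (Φ q)) (covP π A Φ q v) = 0)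
    (hr : ∃ b, ∀ v, ∃ l : ℝ, covP π A Φ p v = l • b) (v w : TangentSpace (𝓡 3) (π p)) :
    curvP π A p v w = 0 := by
  have hν := smooth_nu hs
  -- Orthogonality to `ν` reads `g(ν, dΦ) = A |ν|²`, which solves for `A` as the pullback of `θ`.
  -- Then `dA = Φ^* dθ`, and its value on horizontal lifts is `dθ` on two vectors of one line.
  have h1 : ∀ᶠ q in 𝓝 p, A q = pullM (m := 4) (thetaForm gN) Φ q := by
    have hν' : ∀ᶠ q in 𝓝 p, nu (Φ q) ≠ 0 :=
      hΦ.smooth.continuous.continuousAt.eventually (hν.isOpen_ne_zero.mem_nhds hp)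
    filter_upwards [h, hν'] with q hq hq'
    ext1 w
    have h2 := hq (mfderiv (𝓡 4) (𝓡 3) π q w)
    rw [covP_proj hπ hA hΦ, map_sub, map_smul, smul_eq_mul, sub_eq_zero] at h2
    change _ = thetaForm gN (Φ q) (mfderiv (𝓡 4) (𝓡 3) Φ q w)
    rw [thetaForm_apply, h2]
    have := (gN.pos _ _ hq').ne'
    field_simp
  have h2 := extD_congr h1 (horizLift π A p v) (horizLift π A p w)
  rw [extD_pullM (n := 3) (m := 4) (thetaForm_smoothOn gN hν) (isOpen_nu_ne_zero hs) isOpen_univ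
    hΦ.smooth.contMDiffOn (mem_univ p) hp, mfderiv_horizLift hπ hA hΦ, mfderiv_horizLift hπ hA hΦ]
    at h2
  obtain ⟨b, hb⟩ := hr
  obtain ⟨l, hl⟩ := hb v
  obtain ⟨l', hl'⟩ := hb w
  have h3 := isTwoForm_extD (thetaForm gN) (Φ p)
  rw [curvP, h2, hl, hl', h3.smul_left, h3.smul_right, h3.self]
  ring

include hVN hμ

/-- Where the moment map vanishes, the covariant differential is not bijective. -/
theorem not_bijective_of_muSharp_eq_zero {p : P} (hp : nu (Φ p) ≠ 0)
    (h : ∀ᶠ q in 𝓝 p, muSharp gN μ (Φ q) = 0) : ¬ Function.Bijective (covP π A Φ p) := by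
  intro hD
  -- `Φ^*μ` vanishes near `p`, hence so does `Φ^*dμ = V(ν, dΦ, dΦ)`. On horizontal vectors mapped to
  -- `b 2` and `b 0` its value is `V(ρ b₁, b₂, b₀) = ρ ≠ 0`, a contradiction.
  have h1 : ∀ᶠ q in 𝓝 p, pullM (m := 4) μ Φ q = (fun q => 0 : OneForm 4 P) q := by
    filter_upwards [h] with q hq
    ext1 w
    change μ (Φ q) (mfderiv (𝓡 4) (𝓡 3) Φ q w) = 0
    rw [← inner_muSharp gN, hq]; simp
  have h0 : ∀ u v, extD (fun q => 0 : OneForm 4 P) p u v = 0 := by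
    intro u v
    have : OneForm.inChart (fun q => 0 : OneForm 4 P) p = fun _ => 0 := by
      funext z; ext1 w; rfl
    rw [extD, this, fderiv_const_apply]
    exact sub_self (0 : ℝ)
  obtain ⟨b, c, ρ, hb, hm, hn', hρ, hc⟩ := exists_adapted_frame hVN (m := 0) hp (by simp)
  obtain ⟨v, hv⟩ := hD.2 (b 2)
  obtain ⟨w, hw⟩ := hD.2 (b 0)
  have h2 := extD_congr h1 (horizLift π A p v) (horizLift π A p w)
  rw [h0, extD_pullM (n := 3) (m := 4) hμ.smooth isOpen_univ isOpen_univ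
    hΦ.smooth.contMDiffOn (mem_univ p) (mem_univ _), mfderiv_horizLift hπ hA hΦ,
    mfderiv_horizLift hπ hA hΦ, hv, hw, hμ.extD_eq, hb.vol_coord, hn'] at h2
  simp [hb.inner_eq] at h2
  exact hρ.ne' h2

include hVM

/-- Nonzero curvature forces bijective differentials arbitrarily near `p`, where the second equation
gives `α = 0`. What remains is `F ⊗ (β μ♯ + γ ν) = 0` with `μ♯ ⊥ ν`; this kills `γ` at `p`. If `β ≠
0`, then `μ♯` would vanish on the open set where `F ≠ 0`, again contradicting bijectivity nearby. -/
theorem eq_zero_of_curvature {α β γ : ℝ} (h : ∀ x, SolvesBPSAt gM VM gN VN μ α β γ π A Φ x) {p : P}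
    (hF : CurvatureNeZeroAt π A (π p)) (hp : nu (Φ p) ≠ 0) : α = 0 ∧ β = 0 ∧ γ = 0 := by
  have hrel := fun q : P => ((h (π q)).bpsRel hπ hA hΦ)
  have hmn : ∀ y, gN.inner y (muSharp gN μ y) (nu y) = 0 := fun y => by
    rw [inner_muSharp, hμ.apply_nu]
  have hν : ∀ᶠ q in 𝓝 p, nu (Φ q) ≠ 0 :=
    hΦ.smooth.continuous.continuousAt.eventually ((isOpen_nu_ne_zero hs).mem_nhds hp)
  obtain ⟨v, w, hvw⟩ := hF.exists_ne_zero hπ hA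
  -- Otherwise the differential would be orthogonal to `ν` near `p` and of rank at most one at `p`,
  -- and the curvature would vanish there.
  have hnot : ¬ ∀ᶠ q in 𝓝 p, ¬ Function.Bijective (covP π A Φ q) := by
    intro h1
    refine hvw (curvP_eq_zero (gN := gN) hπ hA hΦ hs hp ?_ ?_ v w)
    · filter_upwards [h1, hν] with q hq hq'
      exact ((hrel q).1.of_not_bijective (isTwoForm_curvP q) hVM hVN hq' (hmn _) hq).1
    · exact ((hrel p).1.of_not_bijective (isTwoForm_curvP p) hVM hVN hp (hmn _)
        h1.self_of_nhds).2.1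
  have hα : α = 0 := by
    by_contra hα
    refine hnot ?_
    filter_upwards [hν] with q hq
    exact not_bijective_of_bps2 hVN hq (hmn _) hα (hrel q).2
  subst hα
  have hlin : ∀ q, (∃ v w, curvP π A q v w ≠ 0) →
      β • muSharp gN μ (Φ q) + γ • nu (Φ q) = 0 := by
    rintro q ⟨v, w, hvw⟩
    have h1 := (hrel q).2 v w
    rw [zero_smul, zero_add, smul_comm β, smul_comm γ, ← smul_add] at h1
    exact (smul_eq_zero.1 h1).resolve_left hvw
  have hγ : γ = 0 := by
    have h1 := congrArg (fun u => gN.inner (Φ p) u (nu (Φ p))) (hlin p ⟨v, w, hvw⟩)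
    simp only [map_add, map_smul, add_apply, smul_apply, hmn, smul_eq_mul, mul_zero, zero_add,
      map_zero, zero_apply] at h1
    exact (mul_eq_zero.1 h1).resolve_right (gN.pos _ _ hp).ne'
  subst hγ
  refine ⟨rfl, ?_, rfl⟩
  by_contra hβ
  have hm : ∀ᶠ q in 𝓝 p, muSharp gN μ (Φ q) = 0 := by
    filter_upwards [(isOpen_curvP_ne_zero hπ hA hΦ).mem_nhds
      (show p ∈ {p | ∃ v w, curvP π A p v w ≠ 0} from ⟨v, w, hvw⟩)] with q hq
    have h1 := hlin q hq
    rw [zero_smul, add_zero] at h1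
    exact (smul_eq_zero.1 h1).resolve_left hβ
  refine hnot ?_
  filter_upwards [hm.eventually_nhds, hν] with q hq hq'
  exact not_bijective_of_muSharp_eq_zero hπ hA hΦ hs hVN hμ hq' hq

include hact

/-- The set `O = Y \ closure R` is open and relatively closed in `Y`, and the curvature vanishes
over it. If it were nonempty it would be all of the connected set `Y`, against the assumption on the
curvature. -/
theorem subset_closure_regular (h : ∀ x, SolvesBPSAt gM VM gN VN μ 0 0 0 π A Φ x) {Y : Set M}
    (hY : IsOpen Y) (hYc : IsPreconnected Y) (hYν : ∀ p : P, π p ∈ Y → nu (Φ p) ≠ 0)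
    (hF : ∃ x ∈ Y, CurvatureNeZeroAt π A x) : Y ⊆ closure {x | RegularAt gN μ π A Φ x} := by
  set R := {x | RegularAt gN μ π A Φ x} with hR
  have hreg : ∀ p, π p ∈ R ↔ Function.Bijective (covP π A Φ p) ∧
      LinearIndependent ℝ ![nu (Φ p), muSharp gN μ (Φ p)] :=
    fun p => regularAt_iff hπ hA hΦ hs hact hμ p
  have hrel := fun q : P => ((h (π q)).bpsRel hπ hA hΦ).1
  have hmn : ∀ y, gN.inner y (muSharp gN μ y) (nu y) = 0 := fun y => by
    rw [inner_muSharp, hμ.apply_nu]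
  have hcont : Continuous π := hπ.smooth_proj.continuous
  set O := Y \ closure R with hO
  have hOo : IsOpen O := hY.sdiff isClosed_closure
  -- Bijectivity is open, so near such a point only the vanishing of `μ♯` could prevent regularity;
  -- but that in turn excludes bijectivity.
  have hbij : ∀ p, π p ∈ O → ¬ Function.Bijective (covP π A Φ p) := by
    intro p hp hD
    refine not_bijective_of_muSharp_eq_zero (gN := gN) hπ hA hΦ hs hVN hμ (hYν p hp.1) ?_ hD
    filter_upwards [(isOpen_bijective_covP hπ hA hΦ).mem_nhds hD,
      (hOo.preimage hcont).mem_nhds hp] with q hq hq'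
    by_contra hm
    refine hq'.2 (subset_closure ((hreg q).2
      ⟨hq, linearIndependent_nu_muSharp hμ (hYν q hq'.1) hm⟩))
  have hflat : ∀ p, π p ∈ O → ∀ v w, curvP π A p v w = 0 := by
    intro p hp
    refine curvP_eq_zero (gN := gN) hπ hA hΦ hs (hYν p hp.1) ?_ ?_
    · filter_upwards [(hOo.preimage hcont).mem_nhds hp] with q hq
      exact ((hrel q).of_not_bijective (isTwoForm_curvP q) hVM hVN (hYν q hq.1) (hmn _)
        (hbij q hq)).1
    · exact ((hrel p).of_not_bijective (isTwoForm_curvP p) hVM hVN (hYν p hp.1) (hmn _)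
        (hbij p hp)).2.1
  have hzero : ∀ p, π p ∈ O → covP π A Φ p = 0 := by
    intro p hp
    ext1 v
    exact ((hrel p).of_not_bijective (isTwoForm_curvP p) hVM hVN (hYν p hp.1) (hmn _)
        (hbij p hp)).2.2 (hflat p hp) v
  -- At a limit point of `O` the covariant differential vanishes by continuity, so it shortens all
  -- nonzero vectors nearby. Regular points accumulating there would carry a nonzero vector of
  -- preserved length.
  have hclos : closure O ∩ Y ⊆ O := by
    rintro x ⟨hx, hxY⟩
    obtain ⟨p, rfl⟩ := hπ.surjective x
    obtain ⟨U, s, hsec, hxU, hsp⟩ := hπ.exists_section p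
    have hsc : Tendsto s (𝓝 (π p)) (𝓝 p) := by
      have := (hsec.smooth.contMDiffAt (hsec.isOpen.mem_nhds hxU)).continuousAt.tendsto
      rwa [hsp] at this
    have hD : covP π A Φ p = 0 := by
      by_contra hne
      have h1 := hsc.eventually ((isOpen_covP_ne_zero hπ hA hΦ (smooth_nu hs)).mem_nhds hne)
      have hUx : ∀ᶠ x in 𝓝 (π p), x ∈ U := hsec.isOpen.mem_nhds hxU
      obtain ⟨x', h4, h2, h3⟩ :=
        ((mem_closure_iff_frequently.1 hx).and_eventually (h1.and hUx)).exists
      exact h2 (hzero _ (by rw [hsec.proj _ h3]; exact h4))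
    refine ⟨hxY, fun hxR => ?_⟩
    have h1 := hsc.eventually (eventually_shortens hπ hA hΦ (smooth_nu hs) gM gN hD)
    have hUx : ∀ᶠ x in 𝓝 (π p), x ∈ U := hsec.isOpen.mem_nhds hxU
    have hYx : ∀ᶠ x in 𝓝 (π p), x ∈ Y := hY.mem_nhds hxY
    obtain ⟨x', hx'R, h2, h3, h4⟩ :=
      ((mem_closure_iff_frequently.1 hxR).and_eventually (h1.and (hUx.and hYx))).exists
    have h5 : π (s x') = x' := hsec.proj _ h3
    have h6 := (hreg (s x')).1 (by rw [h5]; exact hx'R)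
    have h7 := hYν (s x') (by rw [h5]; exact h4)
    obtain ⟨w, hw0, hw⟩ := (hrel (s x')).exists_isometric_vector (isTwoForm_curvP _) hVM hVN h7
      (hmn _) h6.1
    exact (h2 w hw0).ne hw
  intro x hx
  by_contra hxR
  have hYO : Y ⊆ O := hYc.subset_of_closure_inter_subset hOo ⟨x, hx, hx, hxR⟩ hclos
  obtain ⟨x', hx', hF'⟩ := hF
  obtain ⟨p, rfl⟩ := hπ.surjective x'
  obtain ⟨v, w, hvw⟩ := hF'.exists_ne_zero hπ hA
  exact hvw (hflat p (hYO hx') v w)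

end Analysis

end

section

open Set Filter Topology Module

/-! ### The equation for a field that is a local diffeomorphism, and the converse statement. -/

section Identity

variable {M : Type*} [TopologicalSpace M] [ChartedSpace (EuclideanSpace ℝ (Fin 3)) M]
  [IsManifold (𝓡 3) ∞ M]
  {N : Type*} [TopologicalSpace N] [ChartedSpace (EuclideanSpace ℝ (Fin 3)) N]
  [IsManifold (𝓡 3) ∞ N] [MulAction Circle N]
  {P : Type*} [TopologicalSpace P] [ChartedSpace (EuclideanSpace ℝ (Fin 4)) P]
  [IsManifold (𝓡 4) ∞ P] [MulAction Circle P]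
  {π : P → M} {A : OneForm 4 P} {Φ : P → N}
  {gM : Metric M} {VM : ThreeForm 3 M} {gN : Metric N} {VN : ThreeForm 3 N} {μ : OneForm 3 N}
  (hπ : IsPrincipalBundle π) (hA : IsConnection A) (hΦ : IsSkyrmeField Φ)
  (hs : ContMDiff ((𝓡 1).prod (𝓡 3)) (𝓡 3) ∞ (fun q : Circle × N => q.1 • q.2))
  (hVM : IsVolumeForm gM VM) (hVN : IsVolumeForm gN VN)
  (hact : IsIsometricAction gN VN) (hμ : IsMomentMap VN μ)

/-- The covariant differential of a local diffeomorphism `e` with respect to the pullback of `B`. -/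
def covPull (B : OneForm 3 N) (e : M → N) (x : M) :
    TangentSpace (𝓡 3) x →L[ℝ] TangentSpace (𝓡 3) (e x) :=
  mfderiv (𝓡 3) (𝓡 3) e x - ((B (e x)).comp (mfderiv (𝓡 3) (𝓡 3) e x)).smulRight (nu (e x))

theorem covPull_apply (B : OneForm 3 N) (e : M → N) (x : M) (v : TangentSpace (𝓡 3) x) :
    covPull B e x v = covId B (e x) (mfderiv (𝓡 3) (𝓡 3) e x v) := rfl

variable {e : PartialDiffeomorph (𝓡 3) (𝓡 3) M N ∞} {s : M → P} {B : OneForm 3 N}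

theorem covD_eq_covPull (hes : ∀ x ∈ e.source, Φ (s x) = e x)
    (hpot : ∀ x ∈ e.source, potential A s x = (B (e x)).comp (mfderiv (𝓡 3) (𝓡 3) e x)) {x : M}
    (hx : x ∈ e.source) :
    (covD (Φ ∘ s) (potential A s) x : EuclideanSpace ℝ (Fin 3) →L[ℝ] EuclideanSpace ℝ (Fin 3)) =
      covPull B e x := by
  have h1 : Φ ∘ s =ᶠ[𝓝 x] e := by
    filter_upwards [e.open_source.mem_nhds hx] with y hy using hes y hy
  have h2 := h1.mfderiv_eq (I := 𝓡 3) (I' := 𝓡 3)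
  rw [covD, hpot x hx]
  have key : ∀ (y : N) (T : TangentSpace (𝓡 3) x →L[ℝ] TangentSpace (𝓡 3) y), y = e x →
      (T : EuclideanSpace ℝ (Fin 3) →L[ℝ] EuclideanSpace ℝ (Fin 3)) =
        mfderiv (𝓡 3) (𝓡 3) e x →
      ((T - ((B (e x)).comp (mfderiv (𝓡 3) (𝓡 3) e x)).smulRight (nu y) :
        TangentSpace (𝓡 3) x →L[ℝ] TangentSpace (𝓡 3) y) :
        EuclideanSpace ℝ (Fin 3) →L[ℝ] EuclideanSpace ℝ (Fin 3)) = covPull B e x := by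
    rintro y T rfl h
    obtain rfl : T = mfderiv (𝓡 3) (𝓡 3) e x := h
    rfl
  exact key _ _ (hes x hx) h2

theorem extD_potential (hB : B.SmoothOn e.target)
    (hpot : ∀ x ∈ e.source, potential A s x = (B (e x)).comp (mfderiv (𝓡 3) (𝓡 3) e x)) {x : M}
    (hx : x ∈ e.source) (u v : TangentSpace (𝓡 3) x) :
    extD (potential A s) x u v =
      extD B (e x) (mfderiv (𝓡 3) (𝓡 3) e x u) (mfderiv (𝓡 3) (𝓡 3) e x v) := by
  rw [← extD_pullM (n := 3) (m := 3) hB e.open_target e.open_source e.contMDiffOn hx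
    (e.map_source hx)]
  refine extD_congr ?_ u v
  filter_upwards [e.open_source.mem_nhds hx] with y hy using hpot y hy

theorem mfderiv_bijective_of_partialDiffeomorph {x : M} (hx : x ∈ e.source) :
    Function.Bijective (mfderiv (𝓡 3) (𝓡 3) e x) := by
  have h := e.isLocalDiffeomorphAt _ _ _ hx
  exact (h.mfderivToContinuousLinearEquiv (by simp)).bijective

include hπ hA hΦ

theorem bpsRel_iff_covPull (hsec : IsLocalSection π e.source s) (hB : B.SmoothOn e.target)
    (hes : ∀ x ∈ e.source, Φ (s x) = e x)
    (hpot : ∀ x ∈ e.source, potential A s x = (B (e x)).comp (mfderiv (𝓡 3) (𝓡 3) e x)) {x : M}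
    (hx : x ∈ e.source) :
    BPSRel gM VM gN VN (π (s x)) (Φ (s x)) (covP π A Φ (s x)) (curvP π A (s x))
      (muSharp gN μ (Φ (s x))) ↔
    BPSRel gM VM gN VN x (e x) (covPull B e x)
      (fun u v => extD B (e x) (mfderiv (𝓡 3) (𝓡 3) e x u) (mfderiv (𝓡 3) (𝓡 3) e x v))
      (muSharp gN μ (e x)) := by
  have h1 := (hsec.covD_eq hπ hA hΦ hx).symm.trans (covD_eq_covPull hes hpot hx)
  have h2 : ∀ u v : EuclideanSpace ℝ (Fin 3), curvP π A (s x) u v =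
      extD B (e x) (mfderiv (𝓡 3) (𝓡 3) e x u) (mfderiv (𝓡 3) (𝓡 3) e x v) :=
    fun u v => (hsec.extD_eq hπ hA hx u v).symm.trans (extD_potential hB hpot hx u v)
  have h3 : (muSharp gN μ (Φ (s x)) : EuclideanSpace ℝ (Fin 3)) = muSharp gN μ (e x) := by
    have key : ∀ y, y = e x → (muSharp gN μ y : EuclideanSpace ℝ (Fin 3)) = muSharp gN μ (e x) := by
      rintro y rfl; rfl
    exact key _ (hes x hx)
  exact ⟨fun h => h.congr (hsec.proj x hx) (hes x hx) h1 h2 h3,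
    fun h => h.congr (hsec.proj x hx).symm (hes x hx).symm h1.symm (fun u v => (h2 u v).symm)
      h3.symm⟩

include hs hVM hVN hact hμ

/-- Since `ι_{μ♯} B = 0`, Cartan's formula turns `L_{μ♯} B = 0` into `ι_{μ♯} dB = 0`, the form
needed by the pointwise algebra. One gauge suffices, by covariance. -/
theorem LocallyIdentityAt.solvesBPSAt {x : M} (h : LocallyIdentityAt gM VM gN VN μ π A Φ x) :
    SolvesBPSAt gM VM gN VN μ 0 0 0 π A Φ x := by
  obtain ⟨e, s, B, hx, hsec, hB, h1, h2⟩ := h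
  have hy := e.map_source hx
  have hext : ∀ v, extD B (e x) (muSharp gN μ (e x)) v = 0 := by
    intro v
    rw [← lieD_eq_extD hB e.open_target hy
      (((smooth_muSharp gN hμ.smooth).contDiffAt (mem_extChartAt_target _)).differentiableAt
        (by simp)) (fun y hy => (h2 y hy).2.2.1)]
    exact (h2 _ hy).2.2.2 v
  have h3 : BPSRel gM VM gN VN x (e x) (covPull B e x)
      (fun u v => extD B (e x) (mfderiv (𝓡 3) (𝓡 3) e x u) (mfderiv (𝓡 3) (𝓡 3) e x v))
      (muSharp gN μ (e x)) :=
    bpsRel_of_solutionMetric hVM hVN (hμ.apply_nu _) (h2 _ hy).1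
      (mfderiv_bijective_of_partialDiffeomorph hx) (covPull_apply B e x) (h2 _ hy).2.1
      (h2 _ hy).2.2.1 (fun u v => rfl) hext (h1 x hx).2.2.2 (h1 x hx).2.2.1
  have h4 := (bpsRel_iff_covPull hπ hA hΦ hsec hB (fun x hx => (h1 x hx).1)
    (fun x hx => (h1 x hx).2.1) hx).2 h3
  have h5 := solvesBPSAt_of_bpsRel hπ hA hΦ hs hact hμ h4
  rwa [hsec.proj x hx] at h5

/-- A gauge in which the field is a local diffeomorphism and the connection annihilates `nu` and
`muSharp` exhibits a regular solution as locally the identity. -/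
theorem locallyIdentityAt_of_gauge (h : ∀ x, SolvesBPSAt gM VM gN VN μ 0 0 0 π A Φ x) {x : M}
    (hx : x ∈ e.source) (hsec : IsLocalSection π e.source s) (hB : B.SmoothOn e.target)
    (hes : ∀ x ∈ e.source, Φ (s x) = e x)
    (hpot : ∀ x ∈ e.source, potential A s x = (B (e x)).comp (mfderiv (𝓡 3) (𝓡 3) e x))
    (hbij : ∀ x ∈ e.source, Function.Bijective (covP π A Φ (s x)))
    (hind : ∀ y ∈ e.target, LinearIndependent ℝ ![nu y, muSharp gN μ y])
    (hBn : ∀ y ∈ e.target, B y (nu y) = 0) (hBm : ∀ y ∈ e.target, B y (muSharp gN μ y) = 0) :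
    LocallyIdentityAt gM VM gN VN μ π A Φ x := by
  have main : ∀ x ∈ e.source,
      (∀ u v, gM.inner x u v = solutionMetric gN VN μ B (e x) (mfderiv (𝓡 3) (𝓡 3) e x u)
        (mfderiv (𝓡 3) (𝓡 3) e x v)) ∧
      (∀ v, extD B (e x) (muSharp gN μ (e x)) v = 0) ∧
      ∀ u : Fin 3 → TangentSpace (𝓡 3) x, 0 < VM x u →
        0 < VN (e x) (fun i => mfderiv (𝓡 3) (𝓡 3) e x (u i)) := by
    intro x hx
    have hy := e.map_source hx
    have h1 := (bpsRel_iff_covPull (gM := gM) (VM := VM) (gN := gN) (VN := VN) (μ := μ) hπ hA hΦ hsec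
      hB hes hpot hx).1 ((h _).bpsRel hπ hA hΦ).1
    have h2 : Function.Bijective (covPull B e x) := by
      have h3 := (hsec.covD_eq hπ hA hΦ hx).symm.trans (covD_eq_covPull hes hpot hx)
      have key : ∀ D D' : EuclideanSpace ℝ (Fin 3) →L[ℝ] EuclideanSpace ℝ (Fin 3), D = D' →
        Function.Bijective D → Function.Bijective D' := by rintro D D' rfl h; exact h
      exact key _ _ h3 (hbij x hx)
    refine solutionMetric_of_bpsRel hVM hVN (hμ.apply_nu _) (hind _ hy)
      (mfderiv_bijective_of_partialDiffeomorph hx) (covPull_apply B e x) (hBn _ hy)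
      (hBm _ hy) (fun u v => rfl) ?_ h1 h2
    obtain ⟨b, hb⟩ := isTwoForm_extD B (e x)
    exact ⟨b.compl₁₂ (mfderiv (𝓡 3) (𝓡 3) e x).toLinearMap
      (mfderiv (𝓡 3) (𝓡 3) e x).toLinearMap, fun u v => hb _ _⟩
  refine ⟨e, s, B, hx, hsec, hB, fun x' hx' => ⟨hes x' hx', hpot x' hx', (main x' hx').2.2,
    (main x' hx').1⟩, fun y hy => ⟨hind y hy, hBn y hy, hBm y hy, fun v => ?_⟩⟩
  have hx' := e.map_target hy
  have hy' : e (e.symm y) = y := e.right_inv hy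
  rw [lieD_eq_extD hB e.open_target hy
      (((smooth_muSharp gN hμ.smooth).contDiffAt (mem_extChartAt_target _)).differentiableAt
        (by simp)) hBm]
  have key : ∀ y', y' = y → (∀ v, extD B y' (muSharp gN μ y') v = 0) →
      extD B y (muSharp gN μ y) v = 0 := by rintro y' rfl h; exact h v
  exact key _ hy' (main _ hx').2.1

end Identity

end

section

open Set Filter Topology Module

/-! ### A box of coordinates from two flows. -/

section FlowBox

variable {E V : Type*} [NormedAddCommGroup E] [NormedSpace ℝ E] [FiniteDimensional ℝ E]
  [NormedAddCommGroup V] [NormedSpace ℝ V]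

theorem fderiv_fst_line {f : ℝ × ℝ × ℝ → V} {q : ℝ × ℝ × ℝ} (hf : DifferentiableAt ℝ f q) :
    HasDerivAt (fun u => f (u, q.2.1, q.2.2)) (fderiv ℝ f q (1, 0, 0)) q.1 :=
  hf.hasFDerivAt.comp_hasDerivAt q.1
    ((hasDerivAt_id q.1).prodMk ((hasDerivAt_const q.1 q.2.1).prodMk (hasDerivAt_const q.1 q.2.2)))

theorem fderiv_snd_line {f : ℝ × ℝ × ℝ → V} {q : ℝ × ℝ × ℝ} (hf : DifferentiableAt ℝ f q) :
    HasDerivAt (fun u => f (q.1, u, q.2.2)) (fderiv ℝ f q (0, 1, 0)) q.2.1 :=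
  hf.hasFDerivAt.comp_hasDerivAt q.2.1
    ((hasDerivAt_const q.2.1 q.1).prodMk ((hasDerivAt_id q.2.1).prodMk
      (hasDerivAt_const q.2.1 q.2.2)))

theorem fderiv_trd_line {f : ℝ × ℝ × ℝ → V} {q : ℝ × ℝ × ℝ} (hf : DifferentiableAt ℝ f q) :
    HasDerivAt (fun u => f (q.1, q.2.1, u)) (fderiv ℝ f q (0, 0, 1)) q.2.2 :=
  hf.hasFDerivAt.comp_hasDerivAt q.2.2
    ((hasDerivAt_const q.2.2 q.1).prodMk ((hasDerivAt_const q.2.2 q.2.1).prodMk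
      (hasDerivAt_id q.2.2)))

theorem mem_box {δ : ℝ} {q : ℝ × ℝ × ℝ} :
    q ∈ Metric.ball (0 : ℝ × ℝ × ℝ) δ ↔ |q.1| < δ ∧ |q.2.1| < δ ∧ |q.2.2| < δ := by
  rw [mem_ball_zero_iff, Prod.norm_def, Prod.norm_def, max_lt_iff, max_lt_iff]
  rfl

/-- A function on a box whose derivative in the second direction vanishes does not depend on the
second variable. -/
theorem eq_of_fderiv_snd_eq_zero {f : ℝ × ℝ × ℝ → V} {δ : ℝ}
    (hf : DifferentiableOn ℝ f (Metric.ball 0 δ))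
    (h : ∀ q ∈ Metric.ball (0 : ℝ × ℝ × ℝ) δ, fderiv ℝ f q (0, 1, 0) = 0)
    {q : ℝ × ℝ × ℝ} (hq : q ∈ Metric.ball (0 : ℝ × ℝ × ℝ) δ) :
    f q = f (q.1, 0, q.2.2) := by
  obtain ⟨h1, h2, h3⟩ := mem_box.1 hq
  have hd : ∀ u ∈ Metric.ball (0 : ℝ) δ,
      HasDerivAt (fun u => f (q.1, u, q.2.2)) 0 u := by
    intro u hu
    have hu' : (q.1, u, q.2.2) ∈ Metric.ball (0 : ℝ × ℝ × ℝ) δ :=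
      mem_box.2 ⟨h1, mem_ball_zero_iff.1 hu, h3⟩
    have := fderiv_snd_line (hf.differentiableAt (Metric.isOpen_ball.mem_nhds hu'))
    rwa [h _ hu'] at this
  have hδ : 0 < δ := (abs_nonneg _).trans_lt h1
  exact Metric.isOpen_ball.is_const_of_deriv_eq_zero (convex_ball (0 : ℝ) δ).isPreconnected
    (fun u hu => (hd u hu).differentiableAt.differentiableWithinAt) (fun u hu => (hd u hu).deriv)
    (mem_ball_zero_iff.2 h2) (Metric.mem_ball_self hδ)

/-- Coordinates adapted to a vector field `Y` in the kernel of `dφ` and a vector field `X` that is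
`φ`-related to `m`. -/
theorem exists_flow_box {O : Set E} (hO : IsOpen O) {X Y : E → E} (hX : ContDiffOn ℝ ∞ X O)
    (hY : ContDiffOn ℝ ∞ Y O) {φ : E → V} (hφ : ContDiffOn ℝ ∞ φ O) {m : V → V}
    (hφX : ∀ z ∈ O, fderiv ℝ φ z (X z) = m (φ z)) (hφY : ∀ z ∈ O, fderiv ℝ φ z (Y z) = 0)
    {q₀ : E} (hq₀ : q₀ ∈ O) (w : E) :
    ∃ (δ : ℝ) (H : ℝ × ℝ × ℝ → E), 0 < δ ∧ ContDiffOn ℝ ∞ H (Metric.ball 0 δ) ∧ H 0 = q₀ ∧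
      fderiv ℝ H 0 (1, 0, 0) = w ∧ ∀ q ∈ Metric.ball (0 : ℝ × ℝ × ℝ) δ, H q ∈ O ∧
        fderiv ℝ H q (0, 1, 0) = Y (H q) ∧ (q.2.1 = 0 → fderiv ℝ H q (0, 0, 1) = X (H q)) ∧
        fderiv ℝ φ (H q) (fderiv ℝ H q (0, 0, 1)) = m (φ (H q)) := by
  obtain ⟨r₁, Ψ₁, hr₁, hΨ₁, hΨ₁0, hΨ₁'⟩ := exists_smooth_flow hO hX hq₀
  obtain ⟨r₂, Ψ₂, hr₂, hΨ₂, hΨ₂0, hΨ₂'⟩ := exists_smooth_flow hO hY hq₀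
  set D₁ := Metric.ball (0 : ℝ) r₁ ×ˢ Metric.ball q₀ r₁ with hD₁
  set D₂ := Metric.ball (0 : ℝ) r₂ ×ˢ Metric.ball q₀ r₂ with hD₂
  have hD₁o : IsOpen D₁ := Metric.isOpen_ball.prod Metric.isOpen_ball
  have hD₂o : IsOpen D₂ := Metric.isOpen_ball.prod Metric.isOpen_ball
  -- With coordinates `(r, s, t)`, the box map starts at `q₀ + r w`, follows `X` for time `t` and
  -- then `Y` for time `s`. Hence `∂_s = Y` everywhere, but `∂_t = X` is known only on `s = 0`.
  set g₁ : ℝ × ℝ × ℝ → ℝ × E := fun q => (q.2.2, q₀ + q.1 • w) with hg₁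
  have hg₁s : ContDiff ℝ ∞ g₁ := by fun_prop
  set W₁ := g₁ ⁻¹' D₁ with hW₁
  have hW₁o : IsOpen W₁ := hD₁o.preimage hg₁s.continuous
  set g₂ : ℝ × ℝ × ℝ → ℝ × E := fun q => (q.2.1, Ψ₁ (g₁ q)) with hg₂
  have hΨg : ContDiffOn ℝ ∞ (fun q => Ψ₁ (g₁ q)) W₁ := hΨ₁.comp hg₁s.contDiffOn fun q hq => hq
  have hg₂s : ContDiffOn ℝ ∞ g₂ W₁ := by
    have : ContDiff ℝ ∞ (fun q : ℝ × ℝ × ℝ => q.2.1) := by fun_prop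
    exact this.contDiffOn.prodMk hΨg
  set W₂ := W₁ ∩ g₂ ⁻¹' D₂ with hW₂
  have hW₂o : IsOpen W₂ := hg₂s.continuousOn.isOpen_inter_preimage hW₁o hD₂o
  have hg₁0 : g₁ 0 = (0, q₀) := by simp [hg₁]
  have hΨ0 : Ψ₁ (g₁ 0) = q₀ := by rw [hg₁0]; exact hΨ₁0 _ (Metric.mem_ball_self hr₁)
  have hW₂0 : (0 : ℝ × ℝ × ℝ) ∈ W₂ := by
    refine ⟨?_, ?_⟩
    · rw [hW₁, mem_preimage, hg₁0]
      exact ⟨Metric.mem_ball_self hr₁, Metric.mem_ball_self hr₁⟩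
    · rw [mem_preimage]
      refine ⟨Metric.mem_ball_self hr₂, ?_⟩
      change Ψ₁ (g₁ 0) ∈ _
      rw [hΨ0]; exact Metric.mem_ball_self hr₂
  obtain ⟨δ, hδ, hδW⟩ := Metric.isOpen_iff.1 hW₂o 0 hW₂0
  set H : ℝ × ℝ × ℝ → E := fun q => Ψ₂ (g₂ q) with hH
  have hHs : ContDiffOn ℝ ∞ H (Metric.ball 0 δ) :=
    hΨ₂.comp (hg₂s.mono fun q hq => (hδW hq).1) fun q hq => (hδW hq).2
  have hHd : ∀ q ∈ Metric.ball (0 : ℝ × ℝ × ℝ) δ, DifferentiableAt ℝ H q := fun q hq =>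
    (hHs.contDiffAt (Metric.isOpen_ball.mem_nhds hq)).differentiableAt (by simp)
  have hmem : ∀ q ∈ Metric.ball (0 : ℝ × ℝ × ℝ) δ, H q ∈ O := fun q hq =>
    (hΨ₂' _ (hδW hq).2.1 _ (hδW hq).2.2).1
  have hHY : ∀ q ∈ Metric.ball (0 : ℝ × ℝ × ℝ) δ, fderiv ℝ H q (0, 1, 0) = Y (H q) := by
    intro q hq
    exact (fderiv_snd_line (hHd q hq)).unique (hΨ₂' _ (hδW hq).2.1 _ (hδW hq).2.2).2
  have hH0 : ∀ q ∈ Metric.ball (0 : ℝ × ℝ × ℝ) δ, q.2.1 = 0 → H q = Ψ₁ (g₁ q) := by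
    intro q hq h0
    have : g₂ q = (0, Ψ₁ (g₁ q)) := by rw [hg₂]; simp [h0]
    rw [hH]
    change Ψ₂ (g₂ q) = _
    rw [this]
    exact hΨ₂0 _ (hδW hq).2.2
  have hHX : ∀ q ∈ Metric.ball (0 : ℝ × ℝ × ℝ) δ, q.2.1 = 0 →
      fderiv ℝ H q (0, 0, 1) = X (H q) := by
    intro q hq h0
    have h1 := fderiv_trd_line (hHd q hq)
    have h2 := (hΨ₁' _ (hδW hq).1.1 _ (hδW hq).1.2).2
    rw [hH0 q hq h0]
    refine h1.unique (h2.congr_of_eventuallyEq ?_)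
    have h3 : ∀ᶠ u in 𝓝 q.2.2, (q.1, q.2.1, u) ∈ Metric.ball (0 : ℝ × ℝ × ℝ) δ :=
      (Continuous.continuousAt (by fun_prop) : ContinuousAt (fun u : ℝ => (q.1, q.2.1, u)) q.2.2)
        |>.eventually (Metric.isOpen_ball.mem_nhds hq)
    filter_upwards [h3] with u hu
    exact hH0 _ hu h0
  have hφd : ∀ z ∈ O, DifferentiableAt ℝ φ z := fun z hz =>
    (hφ.contDiffAt (hO.mem_nhds hz)).differentiableAt (by simp)
  have hφHd : ∀ q ∈ Metric.ball (0 : ℝ × ℝ × ℝ) δ,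
      HasFDerivAt (fun q => φ (H q)) ((fderiv ℝ φ (H q)).comp (fderiv ℝ H q)) q := fun q hq =>
    (hφd _ (hmem q hq)).hasFDerivAt.comp q (hHd q hq).hasFDerivAt
  -- As `dφ(Y) = 0`, the composite `φ ∘ H` does not depend on `s`. So the identity `dφ(∂_t) = m ∘ φ`
  -- spreads from `s = 0` to the whole box, although `X` and `Y` need not commute.
  have hconst : ∀ q ∈ Metric.ball (0 : ℝ × ℝ × ℝ) δ, φ (H q) = φ (H (q.1, 0, q.2.2)) :=
    fun q hq => eq_of_fderiv_snd_eq_zero (f := fun q => φ (H q))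
      (fun q hq => (hφHd q hq).differentiableAt.differentiableWithinAt)
      (fun q hq => by
        rw [(hφHd q hq).fderiv, ContinuousLinearMap.comp_apply, hHY q hq]
        exact hφY _ (hmem q hq)) hq
  refine ⟨δ, H, hδ, hHs, ?_, ?_, fun q hq => ⟨hmem q hq, hHY q hq, hHX q hq, ?_⟩⟩
  · rw [hH0 0 (Metric.mem_ball_self hδ) rfl, hΨ0]
  · have h0 := Metric.mem_ball_self (x := (0 : ℝ × ℝ × ℝ)) hδ
    have h1 := fderiv_fst_line (hHd 0 h0)
    have h2 : HasDerivAt (fun u : ℝ => q₀ + u • w) w (0 : ℝ) := by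
      simpa using ((hasDerivAt_id (0 : ℝ)).smul_const w).const_add q₀
    refine h1.unique (h2.congr_of_eventuallyEq ?_)
    have h3 : ∀ᶠ u in 𝓝 (0 : ℝ), ((u, 0, 0) : ℝ × ℝ × ℝ) ∈ Metric.ball (0 : ℝ × ℝ × ℝ) δ :=
      (Continuous.continuousAt (by fun_prop) : ContinuousAt (fun u : ℝ => ((u, 0, 0) : ℝ × ℝ × ℝ)) 0)
        |>.eventually (Metric.isOpen_ball.mem_nhds h0)
    filter_upwards [h3] with u hu
    have h4 := hH0 _ hu rfl
    exact h4.trans (hΨ₁0 _ (hδW hu).1.2)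
  · obtain ⟨h1, h2, h3⟩ := mem_box.1 hq
    have hq' : (q.1, 0, q.2.2) ∈ Metric.ball (0 : ℝ × ℝ × ℝ) δ :=
      mem_box.2 ⟨h1, by simpa using hδ, h3⟩
    have e1 := fderiv_trd_line (hφHd q hq).differentiableAt
    have e2 := fderiv_trd_line (hφHd _ hq').differentiableAt
    rw [(hφHd q hq).fderiv] at e1
    rw [(hφHd _ hq').fderiv] at e2
    have e3 : (fun u => φ (H (q.1, q.2.1, u))) =ᶠ[𝓝 q.2.2] fun u => φ (H (q.1, 0, u)) := by
      have h3 : ∀ᶠ u in 𝓝 q.2.2, (q.1, q.2.1, u) ∈ Metric.ball (0 : ℝ × ℝ × ℝ) δ :=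
        (Continuous.continuousAt (by fun_prop) : ContinuousAt (fun u : ℝ => (q.1, q.2.1, u)) q.2.2)
          |>.eventually (Metric.isOpen_ball.mem_nhds hq)
      filter_upwards [h3] with u hu
      exact hconst _ hu
    have e4 := e1.unique (e2.congr_of_eventuallyEq e3)
    simp only [ContinuousLinearMap.comp_apply] at e4
    rw [e4, hHX _ hq' rfl, hφX _ (hmem _ hq'), hconst q hq]

end FlowBox

end

section

open Set Filter Topology Module

/-! ### Construction of the gauge at a regular point. -/

section LocalInverse

variable {n : ℕ} {X : Type*} [TopologicalSpace X] [ChartedSpace (EuclideanSpace ℝ (Fin n)) X]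
  [IsManifold (𝓡 n) ∞ X]
  {E : Type*} [NormedAddCommGroup E] [NormedSpace ℝ E] [FiniteDimensional ℝ E]

theorem exists_partialDiffeomorph {k : E → X} {O : Set E} (hO : IsOpen O)
    (hk : ContMDiffOn 𝓘(ℝ, E) (𝓡 n) ∞ k O) {a : E} (ha : a ∈ O)
    (hb : Function.Bijective (mfderiv 𝓘(ℝ, E) (𝓡 n) k a)) :
    ∃ κ : PartialDiffeomorph 𝓘(ℝ, E) (𝓡 n) E X ∞, a ∈ κ.source ∧ κ.source ⊆ O ∧
      ∀ q, κ q = k q := by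
  have : CompleteSpace E := FiniteDimensional.complete ℝ E
  set c := extChartAt (𝓡 n) (k a) with hc
  set O' := O ∩ k ⁻¹' c.source with hO'
  have hO'o : IsOpen O' :=
    hk.continuousOn.isOpen_inter_preimage hO (isOpen_extChartAt_source (k a))
  have haO' : a ∈ O' := ⟨ha, mem_extChartAt_source (k a)⟩
  have hf : ContDiffOn ℝ ∞ (fun q => c (k q)) O' :=
    contDiffOn_chart_comp (fun q hq => hq.2) (hk.mono inter_subset_left)
  have hkd : MDifferentiableAt 𝓘(ℝ, E) (𝓡 n) k a :=
    (hk.contMDiffAt (hO.mem_nhds ha)).mdifferentiableAt (by simp)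
  have hinj : Function.Injective (fderiv ℝ (fun q => c (k q)) a) := by
    rw [fderiv_chart_comp haO'.2 hkd]
    exact (chart_mfderiv_injective haO'.2).comp hb.1
  have hrank : finrank ℝ E = finrank ℝ (EuclideanSpace ℝ (Fin n)) :=
    (LinearEquiv.ofBijective (mfderiv 𝓘(ℝ, E) (𝓡 n) k a : E →L[ℝ] EuclideanSpace ℝ (Fin n)).toLinearMap
      hb).finrank_eq
  have hequiv : ∃ f' : E ≃L[ℝ] EuclideanSpace ℝ (Fin n),
      (f' : E →L[ℝ] EuclideanSpace ℝ (Fin n)) = fderiv ℝ (fun q => c (k q)) a :=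
    ⟨(LinearEquiv.ofInjectiveOfFinrankEq
      (fderiv ℝ (fun q => c (k q)) a).toLinearMap hinj hrank).toContinuousLinearEquiv,
      by ext1 v; rfl⟩
  obtain ⟨f', hf'⟩ := hequiv
  have hd : HasFDerivAt (fun q => c (k q)) (f' : E →L[ℝ] EuclideanSpace ℝ (Fin n)) a := by
    rw [hf']
    exact ((hf.contDiffAt (hO'o.mem_nhds haO')).differentiableAt (by simp)).hasFDerivAt
  obtain ⟨ê, h1, h2, h3, h4⟩ := exists_smooth_inverse hO'o hf haO' hd
  refine ⟨{ toFun := k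
            invFun := fun x => ê.symm (c x)
            source := ê.source
            target := c.source ∩ c ⁻¹' ê.target
            map_source' := fun q hq => ⟨(h2 hq).2, ?_⟩
            map_target' := fun x hx => ê.map_target hx.2
            left_inv' := fun q hq => ?_
            right_inv' := fun x hx => ?_
            open_source := ê.open_source
            open_target := (continuousOn_extChartAt (I := 𝓡 n) (k a)).isOpen_inter_preimage
              (isOpen_extChartAt_source (k a)) ê.open_target
            contMDiffOn_toFun := hk.mono fun q hq => (h2 hq).1
            contMDiffOn_invFun := ?_ }, h1, fun q hq => (h2 hq).1, fun q => rfl⟩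
  · change c (k q) ∈ ê.target
    rw [← h3]; exact ê.map_source hq
  · rw [← h3]; exact ê.left_inv hq
  · have e1 : c (k (ê.symm (c x))) = c x := by rw [← h3]; exact ê.right_inv hx.2
    exact c.injOn (h2 (ê.map_target hx.2)).2 hx.1 e1
  · have e1 : ContMDiffOn (𝓡 n) 𝓘(ℝ, EuclideanSpace ℝ (Fin n)) ∞ c c.source := fun x hx =>
      (contMDiffAt_chart hx).contMDiffWithinAt
    exact h4.contMDiffOn.comp (e1.mono inter_subset_left) fun x hx => hx.2

end LocalInverse

section Action

variable {n : ℕ} {X : Type*} [TopologicalSpace X] [ChartedSpace (EuclideanSpace ℝ (Fin n)) X]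
  [IsManifold (𝓡 n) ∞ X] [MulAction Circle X]
  {E : Type*} [NormedAddCommGroup E] [NormedSpace ℝ E]

/-- The product rule: the derivative of `(t, q) ↦ exp(t) · h q` is split into its two partial
derivatives along the graph `t = f q`. -/
theorem mfderiv_exp_smul
    (hs : ContMDiff ((𝓡 1).prod (𝓡 n)) (𝓡 n) ∞ (fun q : Circle × X => q.1 • q.2))
    {f : E → ℝ} {h : E → X} {q : E} (hf : DifferentiableAt ℝ f q)
    (hh : MDifferentiableAt 𝓘(ℝ, E) (𝓡 n) h q) (v : E) :
    mfderiv 𝓘(ℝ, E) (𝓡 n) (fun q => Circle.exp (f q) • h q) q v =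
      mfderiv (𝓡 n) (𝓡 n) (fun x : X => Circle.exp (f q) • x) (h q)
        (mfderiv 𝓘(ℝ, E) (𝓡 n) h q v) + fderiv ℝ f q v • circleGen (Circle.exp (f q) • h q) := by
  set G : ℝ × E → X := fun r => Circle.exp r.1 • h r.2 with hG
  have hfst : MDifferentiableAt 𝓘(ℝ, ℝ × E) 𝓘(ℝ, ℝ) (fun r : ℝ × E => r.1) (f q, q) :=
    differentiableAt_fst.mdifferentiableAt
  have hsnd : MDifferentiableAt 𝓘(ℝ, ℝ × E) 𝓘(ℝ, E) (fun r : ℝ × E => r.2) (f q, q) :=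
    differentiableAt_snd.mdifferentiableAt
  have hGd : MDifferentiableAt 𝓘(ℝ, ℝ × E) (𝓡 n) G (f q, q) := by
    have h1 : MDifferentiableAt 𝓘(ℝ, ℝ × E) (𝓘(ℝ, ℝ).prod (𝓡 n)) (fun r : ℝ × E => (r.1, h r.2))
        (f q, q) := hfst.prodMk (MDifferentiableAt.comp (f q, q) (g := h) hh hsnd)
    exact MDifferentiableAt.comp (f q, q) (g := fun r : ℝ × X => Circle.exp r.1 • r.2)
      ((contMDiff_circleFlow hs).mdifferentiable (by simp) _) h1
  have hpair : HasFDerivAt (fun q => (f q, q)) ((fderiv ℝ f q).prod (ContinuousLinearMap.id ℝ E)) q :=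
    hf.hasFDerivAt.prodMk (hasFDerivAt_id q)
  have e1 := mfderiv_comp (I := 𝓘(ℝ, E)) (I' := 𝓘(ℝ, ℝ × E)) (I'' := 𝓡 n) q
    (f := fun q => (f q, q)) (g := G) hGd hpair.differentiableAt.mdifferentiableAt
  rw [mfderiv_eq_fderiv, hpair.fderiv] at e1
  have e2 : HasFDerivAt (fun t : ℝ => (t, q)) (ContinuousLinearMap.inl ℝ ℝ E) (f q) :=
    hasFDerivAt_prodMk_left (f q) q
  have e3 := mfderiv_comp (I := 𝓘(ℝ, ℝ)) (I' := 𝓘(ℝ, ℝ × E)) (I'' := 𝓡 n) (f q)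
    (f := fun t : ℝ => (t, q)) (g := G) hGd e2.differentiableAt.mdifferentiableAt
  rw [mfderiv_eq_fderiv, e2.fderiv] at e3
  have e4 : HasFDerivAt (fun u : E => (f q, u)) (ContinuousLinearMap.inr ℝ ℝ E) q :=
    hasFDerivAt_prodMk_right (f q) q
  have e5 := mfderiv_comp (I := 𝓘(ℝ, E)) (I' := 𝓘(ℝ, ℝ × E)) (I'' := 𝓡 n) q
    (f := fun u : E => (f q, u)) (g := G) hGd e4.differentiableAt.mdifferentiableAt
  rw [mfderiv_eq_fderiv, e4.fderiv] at e5
  have e6 := mfderiv_comp (I := 𝓘(ℝ, E)) (I' := 𝓡 n) (I'' := 𝓡 n) q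
    (f := h) (g := fun x : X => Circle.exp (f q) • x)
    (mdifferentiable_smul_const hs _ _) hh
  have a1 : mfderiv 𝓘(ℝ, E) (𝓡 n) (fun q => Circle.exp (f q) • h q) q v =
      mfderiv 𝓘(ℝ, ℝ × E) (𝓡 n) G (f q, q) ((fderiv ℝ f q v, v) : ℝ × E) :=
    congrArg (fun T => T v) e1
  have a2 : ((fderiv ℝ f q v, v) : ℝ × E) = ((0 : ℝ), v) + fderiv ℝ f q v • ((1 : ℝ), (0 : E)) := by
    simp
  have a3 : mfderiv 𝓘(ℝ, ℝ × E) (𝓡 n) G (f q, q) ((1 : ℝ), (0 : E)) =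
      circleGen (Circle.exp (f q) • h q) := by
    rw [← mfderiv_circleFlow hs]
    exact (congrArg (fun T => T (1 : ℝ)) e3).symm
  have a4 : mfderiv 𝓘(ℝ, ℝ × E) (𝓡 n) G (f q, q) ((0 : ℝ), v) =
      mfderiv (𝓡 n) (𝓡 n) (fun x : X => Circle.exp (f q) • x) (h q)
        (mfderiv 𝓘(ℝ, E) (𝓡 n) h q v) :=
    (congrArg (fun T => T v) e5).symm.trans (congrArg (fun T => T v) e6)
  rw [a1, ← a3, ← a4, a2]
  exact ((mfderiv 𝓘(ℝ, ℝ × E) (𝓡 n) G (f q, q)).map_add _ _).trans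
    (congrArg _ ((mfderiv 𝓘(ℝ, ℝ × E) (𝓡 n) G (f q, q)).map_smul _ _))

end Action

section Gauge

variable {M : Type*} [TopologicalSpace M] [ChartedSpace (EuclideanSpace ℝ (Fin 3)) M]
  [IsManifold (𝓡 3) ∞ M]
  {N : Type*} [TopologicalSpace N] [ChartedSpace (EuclideanSpace ℝ (Fin 3)) N]
  [IsManifold (𝓡 3) ∞ N] [MulAction Circle N]
  {P : Type*} [TopologicalSpace P] [ChartedSpace (EuclideanSpace ℝ (Fin 4)) P]
  [IsManifold (𝓡 4) ∞ P] [MulAction Circle P]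
  {π : P → M} {A : OneForm 4 P} {Φ : P → N}
  {gM : Metric M} {VM : ThreeForm 3 M} {gN : Metric N} {VN : ThreeForm 3 N} {μ : OneForm 3 N}
  (hπ : IsPrincipalBundle π) (hA : IsConnection A) (hΦ : IsSkyrmeField Φ)
  (hs : ContMDiff ((𝓡 1).prod (𝓡 3)) (𝓡 3) ∞ (fun q : Circle × N => q.1 • q.2))
  (hVM : IsVolumeForm gM VM) (hVN : IsVolumeForm gN VN)
  (hact : IsIsometricAction gN VN) (hμ : IsMomentMap VN μ)

/-- The points at which the differential is bijective and neither field vanishes. -/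
def regularSet (gN : Metric N) (μ : OneForm 3 N) (π : P → M) (A : OneForm 4 P) (Φ : P → N) : Set P :=
  {p | Function.Bijective (covP π A Φ p)} ∩ Φ ⁻¹' ({y | nu y ≠ 0} ∩ {y | muSharp gN μ y ≠ 0})

include hπ hA hΦ hs hμ

theorem isOpen_regularSet : IsOpen (regularSet gN μ π A Φ) :=
  (isOpen_bijective_covP hπ hA hΦ).inter (((isOpen_nu_ne_zero hs).inter
    (smooth_muSharp gN hμ.smooth).isOpen_ne_zero).preimage hΦ.smooth.continuous)

include hVM hVN

/-- A vector with `dΦ = 0` contracts with one that projects to `muSharp` to zero in the curvature. -/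
theorem extD_conn_eq_zero (h : ∀ x, SolvesBPSAt gM VM gN VN μ 0 0 0 π A Φ x) {p : P}
    (hp : p ∈ regularSet gN μ π A Φ) {S T : TangentSpace (𝓡 4) p}
    (hS : mfderiv (𝓡 4) (𝓡 3) Φ p S = 0) (hAS : A p S = -1)
    (hT : mfderiv (𝓡 4) (𝓡 3) Φ p T = muSharp gN μ (Φ p)) : extD A p S T = 0 := by
  -- The multiple of `S` makes the vector horizontal without changing its image under `dΦ`. It does
  -- not affect the contraction with `S`, by antisymmetry.
  have h1 : covP π A Φ p (mfderiv (𝓡 4) (𝓡 3) π p (T + A p T • S)) = muSharp gN μ (Φ p) := by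
    rw [covP_proj hπ hA hΦ, map_add, map_smul, hS, hT, map_add, map_smul, hAS]
    simp
  have h2 := ((h (π p)).bpsRel hπ hA hΦ).1.twoForm_eq_zero (isTwoForm_curvP p) hVM hVN hp.2.2 hp.2.1
    (by rw [inner_muSharp, hμ.apply_nu]) hp.1.2 h1 (mfderiv (𝓡 4) (𝓡 3) π p S)
  have hF := isTwoForm_extD A p
  rw [curvP_proj hπ hA, hF.add_left, hF.smul_left, hF.self, mul_zero, add_zero] at h2
  rw [hF.swap, h2, neg_zero]

/-- The box of `exists_flow_box` for the fields `X` with `(dΦ, A) = (μ♯, 0)` and `Y` with `(dΦ, A) =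
(0, -1)`. The vector `u₀` fixes the remaining direction at the centre. The equation enters only to
obtain `A(∂_t) = 0` off the slice `s = 0`. -/
theorem exists_gauge_box (h : ∀ x, SolvesBPSAt gM VM gN VN μ 0 0 0 π A Φ x) {p₀ : P}
    (hp₀ : p₀ ∈ regularSet gN μ π A Φ) (u₀ : EuclideanSpace ℝ (Fin 3)) :
    ∃ (δ : ℝ) (η : ℝ × ℝ × ℝ → P), 0 < δ ∧
      ContMDiffOn 𝓘(ℝ, ℝ × ℝ × ℝ) (𝓡 4) ∞ η (Metric.ball 0 δ) ∧ η 0 = p₀ ∧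
      A (η 0) (mfderiv 𝓘(ℝ, ℝ × ℝ × ℝ) (𝓡 4) η 0 ((1, 0, 0) : ℝ × ℝ × ℝ)) = 0 ∧
      (mfderiv (𝓡 4) (𝓡 3) Φ (η 0)
        (mfderiv 𝓘(ℝ, ℝ × ℝ × ℝ) (𝓡 4) η 0 ((1, 0, 0) : ℝ × ℝ × ℝ)) : EuclideanSpace ℝ (Fin 3)) = u₀ ∧
      ∀ q ∈ Metric.ball (0 : ℝ × ℝ × ℝ) δ, η q ∈ regularSet gN μ π A Φ ∧
        A (η q) (mfderiv 𝓘(ℝ, ℝ × ℝ × ℝ) (𝓡 4) η q ((0, 1, 0) : ℝ × ℝ × ℝ)) = -1 ∧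
        mfderiv (𝓡 4) (𝓡 3) Φ (η q)
          (mfderiv 𝓘(ℝ, ℝ × ℝ × ℝ) (𝓡 4) η q ((0, 1, 0) : ℝ × ℝ × ℝ)) = 0 ∧
        A (η q) (mfderiv 𝓘(ℝ, ℝ × ℝ × ℝ) (𝓡 4) η q ((0, 0, 1) : ℝ × ℝ × ℝ)) = 0 ∧
        mfderiv (𝓡 4) (𝓡 3) Φ (η q)
          (mfderiv 𝓘(ℝ, ℝ × ℝ × ℝ) (𝓡 4) η q ((0, 0, 1) : ℝ × ℝ × ℝ)) = muSharp gN μ (Φ (η q)) := by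
  set c := extChartAt (𝓡 4) p₀ with hc
  set O : Set (EuclideanSpace ℝ (Fin 4)) := mapChartDomain (m := 4) 3 Φ p₀ ∩
    (c.target ∩ c.symm ⁻¹' regularSet gN μ π A Φ) with hO
  have hOo : IsOpen O := (isOpen_mapChartDomain hΦ.smooth p₀).inter
    (isOpen_chart_preimage p₀ (isOpen_regularSet hπ hA hΦ hs hμ))
  have hq₀ : c p₀ ∈ O := ⟨mem_mapChartDomain p₀, mem_chart_preimage (mem_extChartAt_source p₀) hp₀⟩
  have hinv : ∀ z ∈ O, ∃ e : EuclideanSpace ℝ (Fin 4) ≃L[ℝ] EuclideanSpace ℝ (Fin 3) × ℝ,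
      (e : EuclideanSpace ℝ (Fin 4) →L[ℝ] EuclideanSpace ℝ (Fin 3) × ℝ) = fieldConn A Φ p₀ z := by
    intro z hz
    have h1 := (fieldConn_bijective hπ hA hΦ hz.1).1 hz.2.2.1
    exact ⟨(LinearEquiv.ofInjectiveOfFinrankEq (fieldConn A Φ p₀ z).toLinearMap h1
      (by simp)).toContinuousLinearEquiv, by ext1 v; rfl⟩
  have hL : ∀ z ∈ O, ∀ v, fieldConn A Φ p₀ z ((fieldConn A Φ p₀ z).inverse v) = v := by
    intro z hz v
    obtain ⟨e, he⟩ := hinv z hz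
    rw [← he, ContinuousLinearMap.inverse_equiv]
    exact e.apply_symm_apply v
  have hLs : ContDiffOn ℝ ∞ (fun z => (fieldConn A Φ p₀ z).inverse) O := by
    intro z hz
    obtain ⟨e, he⟩ := hinv z hz
    exact ContDiffAt.comp_contDiffWithinAt (g := ContinuousLinearMap.inverse) z
      (he ▸ contDiffAt_map_inverse e)
      (((contDiffOn_fieldConn hπ hA hΦ p₀).mono inter_subset_left) z hz)
  set φ := mapInChart (m := 4) (n := 3) Φ p₀ with hφ
  set m : EuclideanSpace ℝ (Fin 3) → EuclideanSpace ℝ (Fin 3) :=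
    VecField.inChart (muSharp gN μ) (Φ p₀) with hm
  have hφs : ContDiffOn ℝ ∞ φ O := (contDiffOn_mapInChart hΦ.smooth p₀).mono inter_subset_left
  have hms : ContDiffOn ℝ ∞ (fun z => m (φ z)) O :=
    (smooth_muSharp gN hμ.smooth (Φ p₀)).comp hφs fun z hz =>
      (extChartAt (𝓡 3) (Φ p₀)).map_source hz.1.2
  set X : EuclideanSpace ℝ (Fin 4) → EuclideanSpace ℝ (Fin 4) :=
    fun z => (fieldConn A Φ p₀ z).inverse (m (φ z), 0) with hX
  set Y : EuclideanSpace ℝ (Fin 4) → EuclideanSpace ℝ (Fin 4) :=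
    fun z => (fieldConn A Φ p₀ z).inverse (0, -1) with hY
  have hXs : ContDiffOn ℝ ∞ X O := hLs.clm_apply (hms.prodMk contDiffOn_const)
  have hYs : ContDiffOn ℝ ∞ Y O := hLs.clm_apply contDiffOn_const
  set c' := extChartAt (𝓡 3) (Φ p₀) with hc'
  -- The vector `u₀` in the chart. The starting direction of the box is then the horizontal vector
  -- whose image under `dΦ` is `u₀`.
  set û : EuclideanSpace ℝ (Fin 3) :=
    mfderiv (𝓡 3) 𝓘(ℝ, EuclideanSpace ℝ (Fin 3)) c' (Φ (c.symm (c p₀))) u₀ with hû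
  obtain ⟨δ, H, hδ, hHs, hH0, hHr, hH⟩ := exists_flow_box (m := m) hOo hXs hYs hφs
    (fun z hz => congrArg Prod.fst (hL z hz (m (φ z), 0)))
    (fun z hz => congrArg Prod.fst (hL z hz (0, -1))) hq₀
    ((fieldConn A Φ p₀ (c p₀)).inverse (û, 0))
  set η : ℝ × ℝ × ℝ → P := fun q => c.symm (H q) with hη
  have hηs : ContMDiffOn 𝓘(ℝ, ℝ × ℝ × ℝ) (𝓡 4) ∞ η (Metric.ball 0 δ) :=
    (contMDiffOn_chart_symm p₀).comp hHs.contMDiffOn fun q hq => (hH q hq).1.1.1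
  have hHd : ∀ q ∈ Metric.ball (0 : ℝ × ℝ × ℝ) δ, DifferentiableAt ℝ H q := fun q hq =>
    (hHs.contDiffAt (Metric.isOpen_ball.mem_nhds hq)).differentiableAt (by simp)
  have hdη : ∀ q ∈ Metric.ball (0 : ℝ × ℝ × ℝ) δ, ∀ v : ℝ × ℝ × ℝ,
      mfderiv 𝓘(ℝ, ℝ × ℝ × ℝ) (𝓡 4) η q v = coordFrame p₀ (H q) (fderiv ℝ H q v) := by
    intro q hq v
    have e1 := mfderiv_comp (I := 𝓘(ℝ, ℝ × ℝ × ℝ)) (I' := 𝓘(ℝ, EuclideanSpace ℝ (Fin 4)))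
      (I'' := 𝓡 4) q (f := H) (g := c.symm)
      ((contMDiffAt_chart_symm (hH q hq).1.1.1).mdifferentiableAt (by simp))
      (hHd q hq).mdifferentiableAt
    rw [mfderiv_eq_fderiv] at e1
    exact congrArg (fun T => T v) e1
  have hAη : ∀ q ∈ Metric.ball (0 : ℝ × ℝ × ℝ) δ, ∀ v : ℝ × ℝ × ℝ,
      A (η q) (mfderiv 𝓘(ℝ, ℝ × ℝ × ℝ) (𝓡 4) η q v) =
        (fieldConn A Φ p₀ (H q) (fderiv ℝ H q v)).2 := by
    intro q hq v
    rw [hdη q hq]; rfl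
  have hΦη : ∀ q ∈ Metric.ball (0 : ℝ × ℝ × ℝ) δ, ∀ (v : ℝ × ℝ × ℝ)
      (u : TangentSpace (𝓡 3) (Φ (η q))), fderiv ℝ φ (H q) (fderiv ℝ H q v) =
        mfderiv (𝓡 3) 𝓘(ℝ, EuclideanSpace ℝ (Fin 3)) c' (Φ (η q)) u →
      mfderiv (𝓡 4) (𝓡 3) Φ (η q) (mfderiv 𝓘(ℝ, ℝ × ℝ × ℝ) (𝓡 4) η q v) = u := by
    intro q hq v u hu
    rw [fderiv_mapInChart hΦ.smooth (hH q hq).1.1] at hu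
    rw [hdη q hq]
    exact chart_mfderiv_injective (hH q hq).1.1.2 hu
  have hAs : ∀ q ∈ Metric.ball (0 : ℝ × ℝ × ℝ) δ,
      A (η q) (mfderiv 𝓘(ℝ, ℝ × ℝ × ℝ) (𝓡 4) η q ((0, 1, 0) : ℝ × ℝ × ℝ)) = -1 := by
    intro q hq
    rw [hAη q hq, (hH q hq).2.1, hL _ (hH q hq).1]
  have hΦs : ∀ q ∈ Metric.ball (0 : ℝ × ℝ × ℝ) δ, mfderiv (𝓡 4) (𝓡 3) Φ (η q)
      (mfderiv 𝓘(ℝ, ℝ × ℝ × ℝ) (𝓡 4) η q ((0, 1, 0) : ℝ × ℝ × ℝ)) = 0 := by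
    intro q hq
    refine hΦη q hq _ _ ?_
    rw [(hH q hq).2.1, map_zero]
    exact congrArg Prod.fst (hL _ (hH q hq).1 (0, -1))
  have hΦt : ∀ q ∈ Metric.ball (0 : ℝ × ℝ × ℝ) δ, mfderiv (𝓡 4) (𝓡 3) Φ (η q)
      (mfderiv 𝓘(ℝ, ℝ × ℝ × ℝ) (𝓡 4) η q ((0, 0, 1) : ℝ × ℝ × ℝ)) = muSharp gN μ (Φ (η q)) := by
    intro q hq
    refine hΦη q hq _ _ ?_
    rw [(hH q hq).2.2.2]
    exact VecField.inChart_chart _ (hH q hq).1.1.2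
  have h0mem : (0 : ℝ × ℝ × ℝ) ∈ Metric.ball (0 : ℝ × ℝ × ℝ) δ := Metric.mem_ball_self hδ
  have hαs := contDiffOn_pullE hA.smooth Metric.isOpen_ball (fun q _ => mem_univ (η q)) hηs
  have hαd : ∀ q ∈ Metric.ball (0 : ℝ × ℝ × ℝ) δ, DifferentiableAt ℝ (pullE A η) q := fun q hq =>
    (hαs.contDiffAt (Metric.isOpen_ball.mem_nhds hq)).differentiableAt (by simp)
  have hαv : ∀ q ∈ Metric.ball (0 : ℝ × ℝ × ℝ) δ, ∀ v, HasFDerivAt (fun q => pullE A η q v)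
      ((ContinuousLinearMap.apply ℝ ℝ v).comp (fderiv ℝ (pullE A η) q)) q := fun q hq v =>
    (ContinuousLinearMap.apply ℝ ℝ v).hasFDerivAt.comp q (hαd q hq).hasFDerivAt
  -- `∂_s(A(∂_t)) = dA(∂_s, ∂_t) + ∂_t(A(∂_s))`. The first term vanishes because `F` annihilates the
  -- lift of `μ♯`, the second because `A(∂_s) = -1` is constant; and `A(∂_t) = A(X) = 0` at `s = 0`.
  have hAt : ∀ q ∈ Metric.ball (0 : ℝ × ℝ × ℝ) δ,
      A (η q) (mfderiv 𝓘(ℝ, ℝ × ℝ × ℝ) (𝓡 4) η q ((0, 0, 1) : ℝ × ℝ × ℝ)) = 0 := by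
    intro q hq
    have e1 := eq_of_fderiv_snd_eq_zero (f := fun q => pullE A η q (0, 0, 1))
      (fun q hq => (hαv q hq _).differentiableAt.differentiableWithinAt) (fun q hq => by
        rw [(hαv q hq _).fderiv]
        change fderiv ℝ (pullE A η) q (0, 1, 0) (0, 0, 1) = 0
        have e2 := fderiv_pullE hA.smooth isOpen_univ Metric.isOpen_ball hηs hq (mem_univ _)
          ((0, 1, 0) : ℝ × ℝ × ℝ) (0, 0, 1)
        rw [extD_conn_eq_zero hπ hA hΦ hs hVM hVN hμ h (hH q hq).1.2.2 (hΦs q hq) (hAs q hq)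
          (hΦt q hq), sub_eq_zero] at e2
        rw [e2]
        have e3 : (fun q => pullE A η q (0, 1, 0)) =ᶠ[𝓝 q] fun _ => -1 := by
          filter_upwards [Metric.isOpen_ball.mem_nhds hq] with q' hq' using hAs q' hq'
        have e4 := (hαv q hq (0, 1, 0)).fderiv
        rw [e3.fderiv_eq, fderiv_const_apply] at e4
        exact (congrArg (fun T => T ((0, 0, 1) : ℝ × ℝ × ℝ)) e4).symm) hq
    refine e1.trans ?_
    obtain ⟨b1, b2, b3⟩ := mem_box.1 hq
    have hq' : (q.1, 0, q.2.2) ∈ Metric.ball (0 : ℝ × ℝ × ℝ) δ :=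
      mem_box.2 ⟨b1, by simpa using hδ, b3⟩
    change A (η (q.1, 0, q.2.2)) (mfderiv 𝓘(ℝ, ℝ × ℝ × ℝ) (𝓡 4) η (q.1, 0, q.2.2)
      ((0, 0, 1) : ℝ × ℝ × ℝ)) = 0
    rw [hAη _ hq', (hH _ hq').2.2.1 rfl, hL _ (hH _ hq').1]
  refine ⟨δ, η, hδ, hηs, ?_, ?_, ?_, fun q hq => ⟨(hH q hq).1.2.2, hAs q hq, hΦs q hq, hAt q hq,
    hΦt q hq⟩⟩
  · change c.symm (H 0) = p₀
    rw [hH0]; exact extChartAt_to_inv p₀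
  · rw [hAη 0 h0mem, hHr, hH0, hL _ hq₀]
  · refine hΦη 0 h0mem _ _ ?_
    rw [hHr]
    have key : ∀ z, z = c p₀ → fderiv ℝ φ z ((fieldConn A Φ p₀ (c p₀)).inverse (û, 0)) =
        mfderiv (𝓡 3) 𝓘(ℝ, EuclideanSpace ℝ (Fin 3)) c' (Φ (c.symm z)) u₀ := by
      rintro z rfl
      exact congrArg Prod.fst (hL _ hq₀ (û, 0))
    exact key _ hH0

end Gauge

end

section

open Set Filter Topology Module

theorem apply_mfderiv_congr {n : ℕ} {X : Type*} [TopologicalSpace X]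
    [ChartedSpace (EuclideanSpace ℝ (Fin n)) X] {E H Y : Type*} [NormedAddCommGroup E]
    [NormedSpace ℝ E] [TopologicalSpace H] {I : ModelWithCorners ℝ E H} [TopologicalSpace Y]
    [ChartedSpace H Y] (η : OneForm n X) {f g : Y → X} {y : Y} (h : f =ᶠ[𝓝 y] g)
    (v : TangentSpace I y) :
    η (f y) (mfderiv I (𝓡 n) f y v) = η (g y) (mfderiv I (𝓡 n) g y v) := by
  have key : ∀ (x : X) (T : TangentSpace I y →L[ℝ] EuclideanSpace ℝ (Fin n)), x = g y →
      T = mfderiv I (𝓡 n) g y → η x (T v) = η (g y) (mfderiv I (𝓡 n) g y v) := by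
    rintro x T rfl rfl; rfl
  exact key (f y) _ h.eq_of_nhds h.mfderiv_eq

section Gauge

variable {M : Type*} [TopologicalSpace M] [ChartedSpace (EuclideanSpace ℝ (Fin 3)) M]
  [IsManifold (𝓡 3) ∞ M]
  {N : Type*} [TopologicalSpace N] [ChartedSpace (EuclideanSpace ℝ (Fin 3)) N]
  [IsManifold (𝓡 3) ∞ N] [MulAction Circle N]
  {P : Type*} [TopologicalSpace P] [ChartedSpace (EuclideanSpace ℝ (Fin 4)) P]
  [IsManifold (𝓡 4) ∞ P] [MulAction Circle P]
  {π : P → M} {A : OneForm 4 P} {Φ : P → N}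
  {gM : Metric M} {VM : ThreeForm 3 M} {gN : Metric N} {VN : ThreeForm 3 N} {μ : OneForm 3 N}
  (hπ : IsPrincipalBundle π) (hA : IsConnection A) (hΦ : IsSkyrmeField Φ)
  (hs : ContMDiff ((𝓡 1).prod (𝓡 3)) (𝓡 3) ∞ (fun q : Circle × N => q.1 • q.2))
  (hVM : IsVolumeForm gM VM) (hVN : IsVolumeForm gN VN)
  (hact : IsIsometricAction gN VN) (hμ : IsMomentMap VN μ)

include hπ hA hΦ hs hact hμ

/-- Sliding a box along the orbits: `A` vanishes on two coordinate directions of the new box, and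
the field maps them to `nu` and `muSharp`. -/
theorem exp_smul_box {η : ℝ × ℝ × ℝ → P} {q : ℝ × ℝ × ℝ}
    (hη : MDifferentiableAt 𝓘(ℝ, ℝ × ℝ × ℝ) (𝓡 4) η q) (v : ℝ × ℝ × ℝ) :
    A (Circle.exp q.2.1 • η q)
      (mfderiv 𝓘(ℝ, ℝ × ℝ × ℝ) (𝓡 4) (fun q => Circle.exp q.2.1 • η q) q v) =
        A (η q) (mfderiv 𝓘(ℝ, ℝ × ℝ × ℝ) (𝓡 4) η q v) + v.2.1 ∧
    ∀ u w : EuclideanSpace ℝ (Fin 3),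
      mfderiv (𝓡 3) (𝓡 3) (fun y : N => (Circle.exp q.2.1)⁻¹ • y) (Φ (η q))
        (mfderiv (𝓡 4) (𝓡 3) Φ (η q) (mfderiv 𝓘(ℝ, ℝ × ℝ × ℝ) (𝓡 4) η q v)) = u →
      nu (Φ (Circle.exp q.2.1 • η q)) = w →
      mfderiv (𝓡 4) (𝓡 3) Φ (Circle.exp q.2.1 • η q)
        (mfderiv 𝓘(ℝ, ℝ × ℝ × ℝ) (𝓡 4) (fun q => Circle.exp q.2.1 • η q) q v) =
          u + v.2.1 • w := by
  have hf : HasFDerivAt (fun q : ℝ × ℝ × ℝ => q.2.1)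
      ((ContinuousLinearMap.fst ℝ ℝ ℝ).comp (ContinuousLinearMap.snd ℝ ℝ (ℝ × ℝ))) q :=
    hasFDerivAt_fst.comp q hasFDerivAt_snd
  have e1 := mfderiv_exp_smul hπ.smooth_smul hf.differentiableAt hη v
  rw [hf.fderiv] at e1
  change _ = _ + v.2.1 • circleGen (Circle.exp q.2.1 • η q) at e1
  constructor
  · rw [e1, map_add, map_smul, hA.apply_circleGen, smul_eq_mul, mul_one]
    congr 1
    exact congrArg (fun T => T (mfderiv 𝓘(ℝ, ℝ × ℝ × ℝ) (𝓡 4) η q v))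
      (hA.invariant (Circle.exp q.2.1) (η q))
  · rintro u w rfl rfl
    rw [e1, map_add, map_smul, hΦ.mfderiv_circleGen hπ]
    exact congrArg (· + v.2.1 • (nu (Φ (Circle.exp q.2.1 • η q)) : EuclideanSpace ℝ (Fin 3)))
      (mfderiv_field_smul hπ hΦ hs _ _ _)

theorem muSharp_field_smul (z : Circle) (p : P) :
    (muSharp gN μ (Φ (z • p)) : EuclideanSpace ℝ (Fin 3)) =
      mfderiv (𝓡 3) (𝓡 3) (fun y : N => z⁻¹ • y) (Φ p) (muSharp gN μ (Φ p)) := by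
  rw [← muSharp_smul hs hact hμ z⁻¹ (Φ p)]
  exact congrArg (fun y => (muSharp gN μ y : EuclideanSpace ℝ (Fin 3))) (hΦ.equivariant z p)

include hVM hVN

/-- The box of `exists_gauge_box` is rotated by `exp(s)` along the fibres. This adds the generator
to `∂_s`, which changes `A(∂_s)` from `-1` to `0` and `dΦ(∂_s)` from `0` to `ν`. By invariance the
properties of `∂_t` are preserved. -/
theorem exists_adapted_box (h : ∀ x, SolvesBPSAt gM VM gN VN μ 0 0 0 π A Φ x) {p₀ : P}
    (hp₀ : p₀ ∈ regularSet gN μ π A Φ) :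
    ∃ (W : Set (ℝ × ℝ × ℝ)) (G : ℝ × ℝ × ℝ → P), IsOpen W ∧ (0 : ℝ × ℝ × ℝ) ∈ W ∧ G 0 = p₀ ∧
      ContMDiffOn 𝓘(ℝ, ℝ × ℝ × ℝ) (𝓡 4) ∞ G W ∧
      (∀ q ∈ W, G q ∈ regularSet gN μ π A Φ ∧
        A (G q) (mfderiv 𝓘(ℝ, ℝ × ℝ × ℝ) (𝓡 4) G q ((0, 1, 0) : ℝ × ℝ × ℝ)) = 0 ∧
        mfderiv (𝓡 4) (𝓡 3) Φ (G q)
          (mfderiv 𝓘(ℝ, ℝ × ℝ × ℝ) (𝓡 4) G q ((0, 1, 0) : ℝ × ℝ × ℝ)) = nu (Φ (G q)) ∧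
        A (G q) (mfderiv 𝓘(ℝ, ℝ × ℝ × ℝ) (𝓡 4) G q ((0, 0, 1) : ℝ × ℝ × ℝ)) = 0 ∧
        mfderiv (𝓡 4) (𝓡 3) Φ (G q)
          (mfderiv 𝓘(ℝ, ℝ × ℝ × ℝ) (𝓡 4) G q ((0, 0, 1) : ℝ × ℝ × ℝ)) = muSharp gN μ (Φ (G q))) ∧
      (∀ v, A (G 0) (mfderiv 𝓘(ℝ, ℝ × ℝ × ℝ) (𝓡 4) G 0 v) = 0) ∧
      Function.Bijective fun v : ℝ × ℝ × ℝ =>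
        mfderiv (𝓡 4) (𝓡 3) Φ (G 0) (mfderiv 𝓘(ℝ, ℝ × ℝ × ℝ) (𝓡 4) G 0 v) := by
  obtain ⟨b, c, ρ, hb, hc, hρ, hρ0, hc0⟩ := exists_frame_of_linearIndependent hVN
    (hμ.apply_nu (Φ p₀)) (linearIndependent_nu_muSharp (gN := gN) hμ hp₀.2.1 hp₀.2.2)
  obtain ⟨δ, η, hδ, hηs, hη0, hAr, hΦr, hη⟩ := exists_gauge_box hπ hA hΦ hs hVM hVN hμ h hp₀ (b 2)
  set G : ℝ × ℝ × ℝ → P := fun q => Circle.exp q.2.1 • η q with hG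
  have hGs : ContMDiffOn 𝓘(ℝ, ℝ × ℝ × ℝ) (𝓡 4) ∞ G (Metric.ball 0 δ) := by
    have h1 : ContMDiff 𝓘(ℝ, ℝ × ℝ × ℝ) 𝓘(ℝ, ℝ) ∞ (fun q : ℝ × ℝ × ℝ => q.2.1) :=
      (contDiff_fst.comp contDiff_snd).contMDiff
    exact (contMDiff_circleFlow hπ.smooth_smul).comp_contMDiffOn (h1.contMDiffOn.prodMk hηs)
  set W := Metric.ball (0 : ℝ × ℝ × ℝ) δ ∩ G ⁻¹' regularSet gN μ π A Φ with hW
  have h0 : (0 : ℝ × ℝ × ℝ) ∈ Metric.ball (0 : ℝ × ℝ × ℝ) δ := Metric.mem_ball_self hδ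
  have hG0 : G 0 = η 0 := by simp [hG]
  have hηd : ∀ q ∈ Metric.ball (0 : ℝ × ℝ × ℝ) δ, MDifferentiableAt 𝓘(ℝ, ℝ × ℝ × ℝ) (𝓡 4) η q :=
    fun q hq => (hηs.contMDiffAt (Metric.isOpen_ball.mem_nhds hq)).mdifferentiableAt (by simp)
  have hbox : ∀ q ∈ W, G q ∈ regularSet gN μ π A Φ ∧
        A (G q) (mfderiv 𝓘(ℝ, ℝ × ℝ × ℝ) (𝓡 4) G q ((0, 1, 0) : ℝ × ℝ × ℝ)) = 0 ∧
        mfderiv (𝓡 4) (𝓡 3) Φ (G q)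
          (mfderiv 𝓘(ℝ, ℝ × ℝ × ℝ) (𝓡 4) G q ((0, 1, 0) : ℝ × ℝ × ℝ)) = nu (Φ (G q)) ∧
        A (G q) (mfderiv 𝓘(ℝ, ℝ × ℝ × ℝ) (𝓡 4) G q ((0, 0, 1) : ℝ × ℝ × ℝ)) = 0 ∧
        mfderiv (𝓡 4) (𝓡 3) Φ (G q)
          (mfderiv 𝓘(ℝ, ℝ × ℝ × ℝ) (𝓡 4) G q ((0, 0, 1) : ℝ × ℝ × ℝ)) = muSharp gN μ (Φ (G q)) := by
    intro q hq
    obtain ⟨-, h1, h2, h3, h4⟩ := hη q hq.1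
    have es := exp_smul_box (gN := gN) hπ hA hΦ hs hact hμ (hηd q hq.1) ((0, 1, 0) : ℝ × ℝ × ℝ)
    have et := exp_smul_box (gN := gN) hπ hA hΦ hs hact hμ (hηd q hq.1) ((0, 0, 1) : ℝ × ℝ × ℝ)
    refine ⟨hq.2, ?_, ?_, ?_, ?_⟩
    · rw [es.1, h1]; norm_num
    · refine (es.2 0 _ (by rw [h2, map_zero]; rfl) rfl).trans ?_
      exact (zero_add _).trans (one_smul ℝ _)
    · rw [et.1, h3]; norm_num
    · refine (et.2 _ _ ((congrArg _ h4).trans (muSharp_field_smul hπ hA hΦ hs hact hμ _ _).symm)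
        rfl).trans ?_
      exact (congrArg _ (zero_smul ℝ _)).trans (add_zero _)
  have hr : A (G 0) (mfderiv 𝓘(ℝ, ℝ × ℝ × ℝ) (𝓡 4) G 0 ((1, 0, 0) : ℝ × ℝ × ℝ)) = 0 ∧
      (mfderiv (𝓡 4) (𝓡 3) Φ (G 0)
        (mfderiv 𝓘(ℝ, ℝ × ℝ × ℝ) (𝓡 4) G 0 ((1, 0, 0) : ℝ × ℝ × ℝ)) : EuclideanSpace ℝ (Fin 3)) =
        b 2 := by
    have er := exp_smul_box (gN := gN) hπ hA hΦ hs hact hμ (hηd 0 h0) ((1, 0, 0) : ℝ × ℝ × ℝ)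
    refine ⟨?_, ?_⟩
    · rw [er.1, hAr]; norm_num
    · have hid : (fun y : N => (Circle.exp (0 : ℝ × ℝ × ℝ).2.1)⁻¹ • y) = id := by
        funext y; simp
      refine (er.2 (b 2) _ ?_ rfl).trans ((congrArg _ (zero_smul ℝ _)).trans (add_zero _))
      rw [hid, mfderiv_id]
      exact hΦr
  have h0W : (0 : ℝ × ℝ × ℝ) ∈ W := ⟨h0, by rw [mem_preimage, hG0, hη0]; exact hp₀⟩
  have hdec : ∀ v : ℝ × ℝ × ℝ, v = v.1 • ((1, 0, 0) : ℝ × ℝ × ℝ) +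
      v.2.1 • ((0, 1, 0) : ℝ × ℝ × ℝ) + v.2.2 • ((0, 0, 1) : ℝ × ℝ × ℝ) := by
    rintro ⟨r, s, t⟩; simp
  refine ⟨W, G, hGs.continuousOn.isOpen_inter_preimage Metric.isOpen_ball
    (isOpen_regularSet hπ hA hΦ hs hμ), h0W, hG0.trans hη0, hGs.mono inter_subset_left, hbox,
    fun v => ?_, ?_⟩
  · have hL : ∀ (L : ℝ × ℝ × ℝ →L[ℝ] ℝ), L (1, 0, 0) = 0 → L (0, 1, 0) = 0 → L (0, 0, 1) = 0 →
        ∀ v, L v = 0 := by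
      intro L h1 h2 h3 v
      rw [hdec v, map_add, map_add, map_smul, map_smul, map_smul, h1, h2, h3]
      simp
    exact hL ((A (G 0)).comp (mfderiv 𝓘(ℝ, ℝ × ℝ × ℝ) (𝓡 4) G 0)) hr.1 (hbox 0 h0W).2.1
      (hbox 0 h0W).2.2.2.1 v
  -- At the centre the three coordinate directions go to `b 2`, `ν = ρ b₁` and `μ♯ = c b₀`, a basis.
  · set T : ℝ × ℝ × ℝ →L[ℝ] EuclideanSpace ℝ (Fin 3) :=
      (mfderiv (𝓡 4) (𝓡 3) Φ (G 0)).comp (mfderiv 𝓘(ℝ, ℝ × ℝ × ℝ) (𝓡 4) G 0) with hT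
    have hy : Φ (G 0) = Φ p₀ := by rw [hG0, hη0]
    have hn : (nu (Φ (G 0)) : EuclideanSpace ℝ (Fin 3)) = ρ • b 1 := by rw [← hρ, hy]
    have hm : (muSharp gN μ (Φ (G 0)) : EuclideanSpace ℝ (Fin 3)) = c • b 0 := by rw [← hc, hy]
    have hTv : ∀ v, T v = v.1 • b 2 + v.2.1 • ρ • b 1 + v.2.2 • c • b 0 := by
      intro v
      rw [← hr.2, ← hn, ← hm, ← (hbox 0 h0W).2.2.1, ← (hbox 0 h0W).2.2.2.2]
      conv_lhs => rw [hdec v, map_add, map_add, map_smul, map_smul, map_smul]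
      rfl
    have hinj : Function.Injective T := by
      rw [injective_iff_map_eq_zero]
      intro v hv
      have hz : v.1 • b 2 + v.2.1 • ρ • b 1 + v.2.2 • c • b 0 = 0 := (hTv v).symm.trans hv
      have h1 : ∀ i, gN.inner (Φ p₀) (v.1 • b 2 + v.2.1 • ρ • b 1 + v.2.2 • c • b 0) (b i) = 0 := by
        intro i; rw [hz]; simp
      have e2 := h1 2
      have e1 := h1 1
      have e0 := h1 0
      simp [hb.inner_eq, hρ0.ne', hc0.ne'] at e0 e1 e2
      exact Prod.ext e2 (Prod.ext e1 e0)
    exact (LinearEquiv.ofInjectiveOfFinrankEq T.toLinearMap hinj (by simp)).bijective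

/-- The adapted box `G` is the graph of the gauge. At the centre both `Φ ∘ G` and `π ∘ G` have
bijective derivatives: the first by construction, and the second because `G` is horizontal there, so
that `d^A φ` composed with one derivative is the other. -/
theorem locallyIdentityAt_of_regularAt (h : ∀ x, SolvesBPSAt gM VM gN VN μ 0 0 0 π A Φ x) {x : M}
    (hx : RegularAt gN μ π A Φ x) : LocallyIdentityAt gM VM gN VN μ π A Φ x := by
  obtain ⟨p₀, rfl⟩ := hπ.surjective x
  obtain ⟨hbij, hind⟩ := (regularAt_iff hπ hA hΦ hs hact hμ p₀).1 hx
  obtain ⟨W, G, hWo, h0, rfl, hGs, hbox, hA0, hΦ0⟩ := exists_adapted_box hπ hA hΦ hs hVM hVN hact hμ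
    h (p₀ := p₀) ⟨hbij, hind.ne_zero 0, hind.ne_zero 1⟩
  have hGd : ∀ q ∈ W, MDifferentiableAt 𝓘(ℝ, ℝ × ℝ × ℝ) (𝓡 4) G q := fun q hq =>
    (hGs.contMDiffAt (hWo.mem_nhds hq)).mdifferentiableAt (by simp)
  set k : ℝ × ℝ × ℝ → N := fun q => Φ (G q) with hk
  set f : ℝ × ℝ × ℝ → M := fun q => π (G q) with hf
  have hkd : ∀ q ∈ W, ∀ v : ℝ × ℝ × ℝ, mfderiv 𝓘(ℝ, ℝ × ℝ × ℝ) (𝓡 3) k q v =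
      mfderiv (𝓡 4) (𝓡 3) Φ (G q) (mfderiv 𝓘(ℝ, ℝ × ℝ × ℝ) (𝓡 4) G q v) := fun q hq v =>
    congrArg (fun T => T v) (mfderiv_comp q (hΦ.mdifferentiableAt (G q)) (hGd q hq))
  have hfd : ∀ v : ℝ × ℝ × ℝ, covP π A Φ (G 0) (mfderiv 𝓘(ℝ, ℝ × ℝ × ℝ) (𝓡 3) f 0 v) =
      mfderiv 𝓘(ℝ, ℝ × ℝ × ℝ) (𝓡 3) k 0 v := by
    intro v
    have e1 := congrArg (fun T => T v) (mfderiv_comp (I := 𝓘(ℝ, ℝ × ℝ × ℝ)) 0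
      (hπ.mdifferentiableAt (G 0)) (hGd 0 h0))
    have e2 := covP_proj hπ hA hΦ (mfderiv 𝓘(ℝ, ℝ × ℝ × ℝ) (𝓡 4) G 0 v)
    rw [hA0 v] at e2
    refine (congrArg (covP π A Φ (G 0)) e1).trans (e2.trans ?_)
    rw [hkd 0 h0 v]
    exact (congrArg _ (zero_smul ℝ _)).trans (sub_zero _)
  have hkb : Function.Bijective (mfderiv 𝓘(ℝ, ℝ × ℝ × ℝ) (𝓡 3) k 0) := by
    have e1 : ⇑(mfderiv 𝓘(ℝ, ℝ × ℝ × ℝ) (𝓡 3) k 0) = fun v : ℝ × ℝ × ℝ =>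
        mfderiv (𝓡 4) (𝓡 3) Φ (G 0) (mfderiv 𝓘(ℝ, ℝ × ℝ × ℝ) (𝓡 4) G 0 v) := funext (hkd 0 h0)
    rw [e1]; exact hΦ0
  have hfb : Function.Bijective (mfderiv 𝓘(ℝ, ℝ × ℝ × ℝ) (𝓡 3) f 0) := by
    have e1 : ⇑(covP π A Φ (G 0)) ∘ ⇑(mfderiv 𝓘(ℝ, ℝ × ℝ × ℝ) (𝓡 3) f 0) =
        ⇑(mfderiv 𝓘(ℝ, ℝ × ℝ × ℝ) (𝓡 3) k 0) := funext hfd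
    exact (Function.Bijective.of_comp_iff' hbij _).1 (e1 ▸ hkb)
  obtain ⟨κ, hκ0, hκW, hκ⟩ := exists_partialDiffeomorph (k := k) hWo
    (hΦ.smooth.comp_contMDiffOn hGs) h0 hkb
  obtain ⟨ϕ, hϕ0, hϕW, hϕ⟩ :=
    exists_partialDiffeomorph (k := f) hWo (hπ.smooth_proj.comp_contMDiffOn hGs) h0 hfb
  -- The same box is read over both manifolds: `s` is the section over `M`, `g` the corresponding
  -- map on `N`, and `e` matches them, so that `s = g ∘ e`. The form on `N` is the pullback of `A`
  -- by `g`.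
  set e : PartialDiffeomorph (𝓡 3) (𝓡 3) M N ∞ := ϕ.symm.trans κ with he
  set g : N → P := fun y => G (κ.symm y) with hg
  set s : M → P := fun x => G (ϕ.symm x) with hs'
  have hesrc : ∀ x ∈ e.source, x ∈ ϕ.target ∧ ϕ.symm x ∈ κ.source := fun x hx => hx
  have hetgt : ∀ y ∈ e.target, y ∈ κ.target := fun y hy => hy.1
  have hex : ∀ x, e x = k (ϕ.symm x) := fun x => hκ _
  have hgs : ContMDiffOn (𝓡 3) (𝓡 4) ∞ g κ.target :=
    hGs.comp κ.symm.contMDiffOn fun y hy => hκW (κ.map_target hy)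
  have hgd : ∀ y ∈ κ.target, MDifferentiableAt (𝓡 3) (𝓡 4) g y := fun y hy =>
    (hgs.contMDiffAt (κ.open_target.mem_nhds hy)).mdifferentiableAt (by simp)
  have hleft : ∀ q ∈ κ.source, κ.symm (k q) = q := fun q hq => by
    rw [← hκ]; exact κ.left_inv hq
  -- the potential on the target, pulled back to the box, is `A`
  have hpull : ∀ q ∈ κ.source, ∀ v : ℝ × ℝ × ℝ, pullM A g (k q)
      (mfderiv 𝓘(ℝ, ℝ × ℝ × ℝ) (𝓡 3) k q v) =
        A (G q) (mfderiv 𝓘(ℝ, ℝ × ℝ × ℝ) (𝓡 4) G q v) := by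
    intro q hq v
    have hkq : k q ∈ κ.target := by rw [← hκ]; exact κ.map_source hq
    have hgk : (fun q => g (k q)) =ᶠ[𝓝 q] G := by
      filter_upwards [κ.open_source.mem_nhds hq] with q' hq'
      simp only [hg, hleft q' hq']
    have hkdq : MDifferentiableAt 𝓘(ℝ, ℝ × ℝ × ℝ) (𝓡 3) k q :=
      MDifferentiableAt.comp q (hΦ.mdifferentiableAt _) (hGd q (hκW hq))
    exact (congrArg (fun T => A (g (k q)) (T v)) (mfderiv_comp q (hgd _ hkq) hkdq).symm).trans
      (apply_mfderiv_congr A hgk v)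
  have htgt : ∀ y ∈ κ.target, ∃ q ∈ κ.source, k q = y := fun y hy =>
    ⟨κ.symm y, κ.map_target hy, by rw [← hκ]; exact κ.right_inv hy⟩
  refine locallyIdentityAt_of_gauge (e := e) (s := s) (B := pullM A g) hπ hA hΦ hs hVM hVN hact hμ h
    ?_ ⟨e.open_source, ?_, ?_⟩ ?_ ?_ ?_ ?_ ?_ ?_ ?_
  · have e1 : ϕ.symm (π (G 0)) = 0 := by
      change ϕ.symm (f 0) = 0
      rw [← hϕ]; exact ϕ.left_inv hϕ0
    have e2 : π (G 0) ∈ ϕ.target := by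
      change f 0 ∈ ϕ.target
      rw [← hϕ]; exact ϕ.map_source hϕ0
    exact ⟨e2, by change ϕ.symm (π (G 0)) ∈ κ.source; rw [e1]; exact hκ0⟩
  · exact hGs.comp (ϕ.symm.contMDiffOn.mono fun x hx => (hesrc x hx).1)
      fun x hx => hκW (hesrc x hx).2
  · intro x hx
    change f (ϕ.symm x) = x
    rw [← hϕ]; exact ϕ.right_inv (hesrc x hx).1
  · exact smoothOn_pullM hA.smooth e.open_target (fun _ _ => mem_univ _)
      (hgs.mono fun y hy => hetgt y hy)
  · exact fun x hx => (hex x).symm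
  · intro x hx
    ext1 v
    have hsg : s =ᶠ[𝓝 x] fun x => g (e x) := by
      filter_upwards [e.open_source.mem_nhds hx] with x' hx'
      simp only [hs', hg, hex, hleft _ (hesrc x' hx').2]
    refine (apply_mfderiv_congr A hsg v).trans ?_
    exact congrArg (fun T => A (g (e x)) (T v)) (mfderiv_comp x
      (hgd _ (hetgt _ (e.map_source hx))) (e.mdifferentiableAt (by simp) hx))
  · exact fun x hx => (hbox _ (hκW (hesrc x hx).2)).1.1
  · intro y hy
    obtain ⟨q, hq, rfl⟩ := htgt y (hetgt y hy)
    exact linearIndependent_nu_muSharp hμ (hbox q (hκW hq)).1.2.1 (hbox q (hκW hq)).1.2.2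
  -- The fields `ν` and `μ♯` are the images under `dk` of the second and third coordinate directions
  -- of the box, and `A` vanishes on those.
  · intro y hy
    obtain ⟨q, hq, rfl⟩ := htgt y (hetgt y hy)
    have h1 := hbox q (hκW hq)
    have h2 := hpull q hq (0, 1, 0)
    rw [hkd q (hκW hq), h1.2.1, h1.2.2.1] at h2
    exact h2
  · intro y hy
    obtain ⟨q, hq, rfl⟩ := htgt y (hetgt y hy)
    have h1 := hbox q (hκW hq)
    have h2 := hpull q hq (0, 0, 1)
    rw [hkd q (hκW hq), h1.2.2.2.1, h1.2.2.2.2] at h2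
    exact h2

end Gauge

end

end GaugedSkyrme

end

/-- Nonvanishing of `ν` along `φ` is expressed at points `p` of the bundle. It depends only on `π
p`, because the action carries `ν` to itself. -/
theorem theorem4p1
    {M : Type*} [TopologicalSpace M] [T2Space M] [ChartedSpace (EuclideanSpace ℝ (Fin 3)) M]
    [IsManifold (𝓡 3) ∞ M]
    {N : Type*} [TopologicalSpace N] [T2Space N] [ChartedSpace (EuclideanSpace ℝ (Fin 3)) N]
    [IsManifold (𝓡 3) ∞ N] [MulAction Circle N] [ContMDiffSMul (𝓡 1) (𝓡 3) ∞ Circle N]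
    {P : Type*} [TopologicalSpace P] [T2Space P] [ChartedSpace (EuclideanSpace ℝ (Fin 4)) P]
    [IsManifold (𝓡 4) ∞ P] [MulAction Circle P]
    (gM : GaugedSkyrme.Metric M) (VM : ThreeForm 3 M) (hVM : IsVolumeForm gM VM)
    (gN : GaugedSkyrme.Metric N) (VN : ThreeForm 3 N) (hVN : IsVolumeForm gN VN)
    (hact : IsIsometricAction gN VN) (μ : OneForm 3 N) (hμ : IsMomentMap VN μ)
    (π : P → M) (hπ : IsPrincipalBundle π)
    (A : OneForm 4 P) (hA : IsConnection A) (Φ : P → N) (hΦ : IsSkyrmeField Φ) :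
    (∀ α β γ : ℝ, (∀ x, SolvesBPSAt gM VM gN VN μ α β γ π A Φ x) →
      (∃ p : P, CurvatureNeZeroAt π A (π p) ∧ nu (Φ p) ≠ 0) → α = 0 ∧ β = 0 ∧ γ = 0) ∧
    ((∀ x, SolvesBPSAt gM VM gN VN μ 0 0 0 π A Φ x) →
      (∀ x, RegularAt gN μ π A Φ x → LocallyIdentityAt gM VM gN VN μ π A Φ x) ∧
      ∀ Y : Set M, IsOpen Y → IsPreconnected Y → (∀ p : P, π p ∈ Y → nu (Φ p) ≠ 0) →
        (∃ x ∈ Y, CurvatureNeZeroAt π A x) → Y ⊆ closure {x | RegularAt gN μ π A Φ x}) ∧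
    ∀ x, LocallyIdentityAt gM VM gN VN μ π A Φ x →
      SolvesBPSAt gM VM gN VN μ 0 0 0 π A Φ x := by
  have hs : ContMDiff ((𝓡 1).prod (𝓡 3)) (𝓡 3) ∞ (fun q : Circle × N => q.1 • q.2) :=
    ContMDiffSMul.contMDiff_smul
  refine ⟨fun α β γ h ⟨p, hp, hp'⟩ => eq_zero_of_curvature hπ hA hΦ hs hVM hVN hμ h hp hp',
    fun h => ⟨fun x hx => ?_, fun Y hY hYc hYν hF =>
      subset_closure_regular hπ hA hΦ hs hVM hVN hact hμ h hY hYc hYν hF⟩, fun x hx => ?_⟩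
  · exact locallyIdentityAt_of_regularAt hπ hA hΦ hs hVM hVN hact hμ h hx
  · exact hx.solvesBPSAt hπ hA hΦ hs hVM hVN hact hμ
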